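/- **Theorem 1.4 (Stabilization Theorem).** Work over a field $F$ of characteristic $0$. A *Filippov $n$-algebra* is a vector space with an $n$-linear bracket satisfying $[x_1,\dots,x_n]=\operatorname{sgn}(\sigma)[x_{\sigma(1)},\dots,x_{\sigma(n)}]$ for all $\sigma\in\mathfrak S_n$ and $$[[x_1,\dots,x_n],x_{n+1},\dots,x_{2n-1}]=\sum_{i=1}^n[x_1,\dots,x_{i-1},[x_i,x_{n+1},\dots,x_{2n-1}],x_{i+1},\dots,x_n].$$ The *free Filippov $n$-algebra* on a finite set $X$ is the vector space spanned by all $n$-ary bracketings of elements of $X$, subject only to the consequences of $n$-linearity and of these two identities. For $n,k\ge 1$ let $\rho_{n,k}$ be the representation of $\mathfrak S_{k(n-1)+1}$, acting by permuting letters, on the subspace of the free Filippov $n$-algebra on $\{1,\dots,k(n-1)+1\}$ spanned by the bracketings with $k$ brackets in which each letter occurs exactly once. (For $n=1$, $\rho_{1,k}=S^{1}$ is the trivial representation of $\mathfrak S_1$.) For a partition $\lambda$ let $S^\lambda$ be the corresponding Specht module. Put $\beta_{1,k}=S^{1}$, and for $n\ge 2$ let $$\beta_{n,k}=\bigoplus_{\lambda}\bigl(S^{(k,\lambda)}\bigr)^{\oplus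 c_\lambda},$$ where $\lambda$ runs over the partitions of $k(n-2)+1$ with all parts at most $k$, $c_\lambda$ is the multiplicity of $S^\lambda$ in $\rho_{n-1,k}$, and $(k,\lambda)$ is the partition whose Young diagram is obtained from that of $\lambda$ by adding a row of length $k$ on top. Let $n\ge k\ge 1$. If $n\ge 2$, then every $S^\lambda$ contained in $\rho_{n-1,k}$ has all parts of $\lambda$ at most $k$ (so the row of length $k$ can be added on top of every Young diagram in the decomposition of $\rho_{n-1,k}$), and, as $\mathfrak S_{k(n-1)+1}$-modules, $$\rho_{n,k}\cong\beta_{n,k}.$$ The isomorphism also holds for $n=1$. -/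

import Mathlib

namespace Filippov

/-! ### Bracketed words and the free Filippov `n`-algebra -/

/-- The `n`-ary bracketed words on a set `X`: letters, and brackets `[w₁, …, wₙ]`. -/
inductive Word (n : ℕ) (X : Type) : Type
  | letter (x : X) : Word n X
  | bracket (w : Fin n → Word n X) : Word n X

namespace Word

variable {n : ℕ} {X : Type}

/-- Replace every letter of a bracketed word by its image under `f`. -/
def map {Y : Type} (f : X → Y) : Word n X → Word n Y
  | letter x => letter (f x)
  | bracket w => bracket fun i => (w i).map f

/-- The number of brackets of a bracketed word. -/
def numBrackets : Word n X → ℕ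
  | letter _ => 0
  | bracket w => 1 + ∑ i, (w i).numBrackets

/-- The letters of a bracketed word, counted with multiplicity. -/
def letters : Word n X → Multiset X
  | letter x => {x}
  | bracket w => ∑ i, (w i).letters

/-- A bracketed permutation of the finite set `X`: each element of `X` occurs exactly once. -/
def IsBracketedPerm [Fintype X] (w : Word n X) : Prop :=
  w.letters = Finset.univ.val

theorem map_id (w : Word n X) : w.map id = w := by
  induction w with
  | letter x => rfl
  | bracket w ih => simp [map, ih]

theorem map_map {Y Z : Type} (f : X → Y) (g : Y → Z) (w : Word n X) :
    (w.map f).map g = w.map (g ∘ f) := by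
  induction w with
  | letter x => rfl
  | bracket w ih => simp [map, ih]

theorem numBrackets_map {Y : Type} (f : X → Y) (w : Word n X) :
    (w.map f).numBrackets = w.numBrackets := by
  induction w with
  | letter x => rfl
  | bracket w ih => simp [map, numBrackets, ih]

theorem letters_map {Y : Type} (f : X → Y) (w : Word n X) :
    (w.map f).letters = w.letters.map f := by
  induction w with
  | letter x => rfl
  | bracket w ih =>
    simp only [map, letters, ih]
    exact (map_sum (Multiset.mapAddMonoidHom f) _ _).symm

theorem IsBracketedPerm.map [Fintype X] {w : Word n X} (hw : w.IsBracketedPerm)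
    (σ : Equiv.Perm X) : (w.map σ).IsBracketedPerm := by
  unfold IsBracketedPerm at *
  rw [letters_map, hw]
  exact congrArg Finset.val (Finset.map_univ_equiv σ)

end Word

/-- The sequence `(a, y₁, …, yₙ₋₁)` of length `n`. -/
def cons {n : ℕ} {α : Type*} (a : α) (y : Fin (n - 1) → α) : Fin n → α :=
  fun i => if h : (i : ℕ) = 0 then a else y ⟨(i : ℕ) - 1, by omega⟩

theorem apply_cons {n : ℕ} {α β : Type*} (f : α → β) (a : α) (y : Fin (n - 1) → α) (i : Fin n) :
    f (cons a y i) = cons (f a) (fun j => f (y j)) i := by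
  unfold cons
  split <;> rfl

/-- The elements of the vector space with basis the bracketed words that are set equal to zero
in the free Filippov algebra: antisymmetry, the generalized Jacobi identity, and the elements
obtained from these by bracketing with further words. The bracket is extended `n`-linearly from
words to their linear combinations; thus, for a linear combination `r` of words,
`r.mapDomain fun s => .bracket (Function.update w i s)` is the bracket whose `i`-th argument is `r`
and whose other arguments are the words `w j`. -/
inductive Relator (F : Type*) [Field F] (n : ℕ) (X : Type) : (Word n X →₀ F) → Prop
  | antisymmetry (w : Fin n → Word n X) (σ : Equiv.Perm (Fin n)) :
      Relator F n X (Finsupp.single (.bracket w) 1 -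
        ((Equiv.Perm.sign σ : ℤ) : F) • Finsupp.single (.bracket (w ∘ σ)) 1)
  | jacobi (x : Fin n → Word n X) (y : Fin (n - 1) → Word n X) :
      Relator F n X (Finsupp.single (.bracket (cons (.bracket x) y)) 1 -
        ∑ i, Finsupp.single (.bracket (Function.update x i (.bracket (cons (x i) y)))) 1)
  | congr (w : Fin n → Word n X) (i : Fin n) (r : Word n X →₀ F) (hr : Relator F n X r) :
      Relator F n X (r.mapDomain fun s => .bracket (Function.update w i s))

/-- The ideal of relations of the free Filippov `n`-algebra on `X`. -/
noncomputable def relations (F : Type*) [Field F] (n : ℕ) (X : Type) : Submodule F (Word n X →₀ F) :=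
  Submodule.span F {r | Relator F n X r}

/-- The free Filippov `n`-algebra on `X`. -/
abbrev FreeFilippov (F : Type*) [Field F] (n : ℕ) (X : Type) : Type _ :=
  (Word n X →₀ F) ⧸ relations F n X

/-- The class of a bracketed word in the free Filippov algebra. -/
noncomputable def wordClass (F : Type*) [Field F] {n : ℕ} {X : Type} (w : Word n X) :
    FreeFilippov F n X :=
  (relations F n X).mkQ (Finsupp.single w 1)

/-- The permutation representation on the vector space with basis the bracketed words:
a permutation of `X` acts by replacing letters. -/
noncomputable def wordRep (F : Type*) [Field F] (n : ℕ) (X : Type) :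
    Representation F (Equiv.Perm X) (Word n X →₀ F) where
  toFun σ := Finsupp.lmapDomain F F (Word.map σ)
  map_one' := by
    ext w : 2
    simp [show Word.map (n := n) (id : X → X) = id from funext Word.map_id]
  map_mul' σ τ := by
    ext w : 2
    simp [Word.map_map]

theorem Relator.map {F : Type*} [Field F] {n : ℕ} {X : Type} {r : Word n X →₀ F}
    (hr : Relator F n X r) (σ : Equiv.Perm X) : Relator F n X (wordRep F n X σ r) := by
  induction hr with
  | antisymmetry w τ =>
    have := Relator.antisymmetry (F := F) (fun i => (w i).map σ) τ
    simp only [wordRep, MonoidHom.coe_mk, OneHom.coe_mk, map_sub, map_smul,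
      Finsupp.lmapDomain_apply, Finsupp.mapDomain_single, Word.map]
    exact this
  | jacobi x y =>
    have := Relator.jacobi (F := F) (fun i => (x i).map σ) (fun i => (y i).map σ)
    simp only [wordRep, MonoidHom.coe_mk, OneHom.coe_mk, map_sub, map_sum,
      Finsupp.lmapDomain_apply, Finsupp.mapDomain_single, Word.map, apply_cons (Word.map σ)]
    convert this using 5 with i
    congr 1
    ext j : 1
    rcases eq_or_ne j i with rfl | h
    · simp [Word.map, apply_cons (Word.map σ)]
    · simp [h]
  | congr w i r hr ih =>
    have := Relator.congr (fun j => (w j).map σ) i _ ih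
    simp only [wordRep, MonoidHom.coe_mk, OneHom.coe_mk, Finsupp.lmapDomain_apply,
      ← Finsupp.mapDomain_comp] at this ⊢
    convert this using 2
    ext s : 1
    simp only [Function.comp_apply, Word.map]
    congr 1
    ext j : 1
    rcases eq_or_ne j i with rfl | h
    · simp
    · simp [h]

theorem relations_le_comap (F : Type*) [Field F] (n : ℕ) (X : Type) (σ : Equiv.Perm X) :
    relations F n X ≤ (relations F n X).comap (wordRep F n X σ) :=
  Submodule.span_le.2 fun _ hr => Submodule.subset_span (Relator.map hr σ)

/-- The action of the permutations of `X` on the free Filippov algebra on `X`. -/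
noncomputable def freeFilippovRep (F : Type*) [Field F] (n : ℕ) (X : Type) :
    Representation F (Equiv.Perm X) (FreeFilippov F n X) :=
  (wordRep F n X).quotient (relations F n X) (relations_le_comap F n X)

theorem freeFilippovRep_wordClass (F : Type*) [Field F] {n : ℕ} {X : Type} (σ : Equiv.Perm X)
    (w : Word n X) : freeFilippovRep F n X σ (wordClass F w) = wordClass F (w.map σ) := by
  simp [freeFilippovRep, wordClass, wordRep, Finsupp.mapDomain_single]

/-- The multilinear component of the free Filippov `n`-algebra on the finite set `X`: the span of
the bracketed permutations of `X` with `k` brackets. When `n ≥ 2`, every bracketed permutation of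
a set with `k (n - 1) + 1` elements has exactly `k` brackets. -/
noncomputable def multilinearPart (F : Type*) [Field F] (n k : ℕ) (X : Type) [Fintype X] :
    Submodule F (FreeFilippov F n X) :=
  Submodule.span F (wordClass F '' {w | w.IsBracketedPerm ∧ w.numBrackets = k})

theorem multilinearPart_le_comap (F : Type*) [Field F] (n k : ℕ) (X : Type) [Fintype X]
    (σ : Equiv.Perm X) :
    multilinearPart F n k X ≤ (multilinearPart F n k X).comap (freeFilippovRep F n X σ) := by
  refine Submodule.span_le.2 ?_
  rintro _ ⟨w, ⟨hw, hk⟩, rfl⟩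
  refine Submodule.subset_span ⟨w.map σ, ⟨hw.map σ, ?_⟩, ?_⟩
  · rw [Word.numBrackets_map, hk]
  · rw [freeFilippovRep_wordClass]

/-- The representation `ρ_{n,k}` of the symmetric group on `k (n - 1) + 1` letters. For `n = 1` it
is spanned by the single word `[[⋯[x]⋯]]` with `k` brackets, so it is the trivial representation
of the symmetric group on one letter. -/
noncomputable def rho (F : Type*) [Field F] (n k : ℕ) :
    Representation F (Equiv.Perm (Fin (k * (n - 1) + 1)))
      (multilinearPart F n k (Fin (k * (n - 1) + 1))) :=
  (freeFilippovRep F n _).subrepresentation _ (multilinearPart_le_comap F n k _)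

/-! ### Specht modules -/

/-- Young tableaux of shape `μ`: bijective fillings of the cells with the numbers in `Fin m`
(there are none unless `μ` has `m` cells). -/
abbrev Tableau (m : ℕ) (μ : YoungDiagram) : Type := μ.cells ≃ Fin m

/-- The vector space with basis the tableaux; permutations act by replacing the entries. -/
noncomputable def tableauRep (F : Type*) [Field F] (m : ℕ) (μ : YoungDiagram) :
    Representation F (Equiv.Perm (Fin m)) (Tableau m μ →₀ F) where
  toFun σ := Finsupp.lmapDomain F F fun t => t.trans σ
  map_one' := by
    ext t : 2
    simp [Equiv.Perm.one_def]
  map_mul' σ τ := by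
    ext t : 2
    simp [Equiv.Perm.mul_def, Equiv.trans_assoc]

/-- The permutations of the cells of `μ` preserving each row. -/
def rowPerms (μ : YoungDiagram) : Finset (Equiv.Perm μ.cells) :=
  Finset.univ.filter fun p => ∀ c, (p c).1.1 = c.1.1

/-- The permutations of the cells of `μ` preserving each column. -/
def colPerms (μ : YoungDiagram) : Finset (Equiv.Perm μ.cells) :=
  Finset.univ.filter fun q => ∀ c, (q c).1.2 = c.1.2

/-- The polytabloid of a tableau `t`: the sum of `sgn q • (t ∘ q ∘ p)` over the column
permutations `q` and the row permutations `p`. -/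
noncomputable def polytabloid (F : Type*) [Field F] {m : ℕ} {μ : YoungDiagram}
    (t : Tableau m μ) : Tableau m μ →₀ F :=
  ∑ q ∈ colPerms μ, ∑ p ∈ rowPerms μ,
    ((Equiv.Perm.sign q : ℤ) : F) • Finsupp.single ((p.trans q).trans t) 1

theorem tableauRep_polytabloid (F : Type*) [Field F] {m : ℕ} {μ : YoungDiagram}
    (σ : Equiv.Perm (Fin m)) (t : Tableau m μ) :
    tableauRep F m μ σ (polytabloid F t) = polytabloid F (t.trans σ) := by
  simp [tableauRep, polytabloid, Finsupp.mapDomain_single, Equiv.trans_assoc,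
    -Finsupp.smul_single]

/-- The underlying space of the Specht module `S^μ`: the span of the polytabloids. -/
noncomputable def spechtSpace (F : Type*) [Field F] (m : ℕ) (μ : YoungDiagram) :
    Submodule F (Tableau m μ →₀ F) :=
  Submodule.span F (Set.range (polytabloid F))

theorem spechtSpace_le_comap (F : Type*) [Field F] (m : ℕ) (μ : YoungDiagram)
    (σ : Equiv.Perm (Fin m)) :
    spechtSpace F m μ ≤ (spechtSpace F m μ).comap (tableauRep F m μ σ) := by
  refine Submodule.span_le.2 ?_
  rintro _ ⟨t, rfl⟩
  exact Submodule.subset_span ⟨t.trans σ, (tableauRep_polytabloid F σ t).symm⟩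

/-- The Specht module `S^μ` as a representation of the symmetric group on `m` letters,
where `μ` is a Young diagram with `m` cells. -/
noncomputable def specht (F : Type*) [Field F] (m : ℕ) (μ : YoungDiagram) :
    Representation F (Equiv.Perm (Fin m)) (spechtSpace F m μ) :=
  (tableauRep F m μ).subrepresentation _ (spechtSpace_le_comap F m μ)

/-- The Specht module `S^μ` is contained in the representation `ρ`: it is isomorphic to a
subrepresentation of `ρ`. -/
def ContainsSpecht {F : Type*} [Field F] {m : ℕ} {V : Type*} [AddCommGroup V] [Module F V]
    (ρ : Representation F (Equiv.Perm (Fin m)) V) (μ : YoungDiagram) : Prop :=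
  ∃ f : (specht F m μ).IntertwiningMap ρ, Function.Injective f

/-- The multiplicity of the Specht module `S^μ` in `ρ`: the largest `c` such that the direct sum
of `c` copies of `S^μ` is isomorphic to a subrepresentation of `ρ`. -/
noncomputable def multiplicity {F : Type*} [Field F] {m : ℕ} {V : Type*} [AddCommGroup V]
    [Module F V] (ρ : Representation F (Equiv.Perm (Fin m)) V) (μ : YoungDiagram) : ℕ :=
  sSup {c : ℕ | ∃ f : (Representation.directSum fun _ : Fin c => specht F m μ).IntertwiningMap ρ,
    Function.Injective f}

/-! ### Adding a row, and the representation `β_{n,k}` -/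

/-- The Young diagram obtained from `μ` by adding a row of length `k` on top of it; all rows of
`μ` have length at most `k`. -/
def addTopRow (μ : YoungDiagram) (k : ℕ) (h : μ.rowLen 0 ≤ k) : YoungDiagram where
  cells := (Finset.range k).image (fun j => (0, j)) ∪ μ.cells.image (fun c => (c.1 + 1, c.2))
  isLowerSet := by
    rintro ⟨i, j⟩ ⟨i', j'⟩ hle hmem
    obtain ⟨hi, hj⟩ := Prod.mk_le_mk.1 hle
    simp only [Finset.coe_union, Finset.coe_image, Set.mem_union, Set.mem_image, Finset.mem_coe,
      Finset.mem_range, Prod.mk.injEq, Prod.exists, YoungDiagram.mem_cells] at hmem ⊢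
    have key : ∀ a b, (a, b) ∈ μ → b < k := fun a b hab =>
      (YoungDiagram.mem_iff_lt_rowLen.1 (μ.up_left_mem (Nat.zero_le a) le_rfl hab)).trans_le h
    rcases hmem with ⟨b, hb, h0, rfl⟩ | ⟨a, b, hab, rfl, rfl⟩
    · exact Or.inl ⟨j', by omega, by omega, rfl⟩
    · rcases i' with _ | i'
      · exact Or.inl ⟨j', lt_of_le_of_lt hj (key _ _ hab), rfl, rfl⟩
      · exact Or.inr ⟨i', j', μ.up_left_mem (by omega) hj hab, rfl, rfl⟩

/-- The Young diagram with a single cell. -/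
def singleCell : YoungDiagram := addTopRow ⊥ 1 (by
  by_contra h
  exact YoungDiagram.notMem_bot _ (YoungDiagram.mem_iff_lt_rowLen.2
    (show 0 < (⊥ : YoungDiagram).rowLen 0 by omega)))

/-- An index set for the irreducible summands of `β_{n,k}`. There is one summand if `n = 1`. For
`n ≥ 2` the summands correspond to those of `ρ_{n-1,k}`: each Young diagram `μ` with
`k (n - 2) + 1` cells (and rows of length at most `k`) is taken as many times as the multiplicity
of `S^μ` in `ρ_{n-1,k}`. The value at `n = 0` plays no role. -/
def BetaIndex (F : Type*) [Field F] : ℕ → ℕ → Type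
  | 0, _ => Empty
  | 1, _ => Unit
  | n + 2, k => (μ : {μ : YoungDiagram // μ.card = k * n + 1 ∧ μ.rowLen 0 ≤ k}) ×
      Fin (multiplicity (rho F (n + 1) k) μ.1)

/-- The Young diagrams of the irreducible summands of `β_{n,k}`: a single cell if `n = 1`, and the
diagrams of the summands of `ρ_{n-1,k}` with a row of length `k` added on top if `n ≥ 2`. -/
def betaShape (F : Type*) [Field F] : (n k : ℕ) → BetaIndex F n k → YoungDiagram
  | 0, _, i => i.elim
  | 1, _, _ => singleCell
  | _ + 2, k, i => addTopRow i.1.1 k i.1.2.2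

/-- The representation `β_{n,k}` of the symmetric group on `k (n - 1) + 1` letters. -/
noncomputable def beta (F : Type*) [Field F] (n k : ℕ) :
    Representation F (Equiv.Perm (Fin (k * (n - 1) + 1)))
      (DirectSum (BetaIndex F n k)
        fun i => spechtSpace F (k * (n - 1) + 1) (betaShape F n k i)) :=
  Representation.directSum fun i => specht F (k * (n - 1) + 1) (betaShape F n k i)

end Filippov

namespace Filippov

/-! ### Filippov algebras and the universal property of the free one -/

/-! Fix a set K of k letters and replace all letters of K in a word with k brackets by one element
e. Since the bracket alternates, at most one of its arguments can be e. Counting then shows that a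
word that does not vanish has exactly one e in each bracket, and erasing these e's leaves a word for
arity n - 1, again with k brackets. Two constructions make this precise. Fixing one argument of a
Filippov bracket lowers the arity (`IsFilippov.curryLeft`). Conversely, a Filippov algebra L extends
to L × F with arity one higher, (0, 1) playing the role of e (`IsFilippov.extend`). The second gives
the erasing map `reduce`, the first the insertion map `insertLetters`. By polarization, insertion
after erasing is the symmetrizer of K (`insertLetters_reduce`). Erasing is onto, so the K-invariants
of ρ_{n,k}, as a module over the permutations of the other letters, are ρ_{n-1,k}.

On the other side, the K-invariants of S^{(k,λ)} form S^λ (`exists_specht_hom_range_eq`). By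
complete reducibility it therefore suffices that every constituent of ρ_{n,k} has first row of
length exactly k. It is at most k because the same count makes every symmetrization over more than k
letters vanish (`symmetrizer_eq_zero`); this bound does not involve n ≥ k and also gives the
statement about ρ_{n-1,k}. It is at least k because the K-symmetrizations generate the whole module
(`eq_top_of_symmetrizer_mem`). For n ≥ 2 this is the only place where k ≤ n enters.

To prove generation, pass to the quotient V by an invariant subspace containing the
K-symmetrizations. Left-normed brackets span (`wordClass_mem_combSpan`). They alternate within each
row of letters, so after a sign twist they become one function φ, with values in V, on the colorings
of letters by rows 0, …, q, where q = k - 1. Matrix units E_{ab} act on such functions. The Jacobi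
identity for rows 0 and 1 becomes E_{01} φ = 0, and for later adjacent rows E_{j,j+1}² φ = 0.
Commutator identities then show that every product of q operators E_{lq} with l < q kills φ. If φ ≠
0, some product of fewer than q of them gives a nonzero vector annihilated by all E_{lq}, and
because k ≤ n color q still occurs in it. Moving up to a highest weight vector yields a nonzero
sign-equivariant vector in which color q occurs, and such a vector cannot exist when symmetrizers of
k letters vanish on V (`eq_zero_of_highestWeight`).

The required theory of Specht modules is obtained from Young symmetrizers: simplicity, pairwise
non-isomorphism by dominance, and exhaustion by comparing with the number of conjugacy classes. -/

theorem cons_eq {n : ℕ} {α : Type*} (a : α) (y : Fin n → α) :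
    cons (n := n + 1) a y = Fin.cons a y := by
  ext i
  refine Fin.cases ?_ (fun j => ?_) i <;> simp [cons]

section Algebra

variable {F : Type*} [Field F] {n : ℕ} {X : Type} {L : Type*} [AddCommGroup L] [Module F L]

/-- An alternating bracket with `n + 1` arguments satisfying the generalized Jacobi identity. -/
def IsFilippov (B : L [⋀^Fin (n + 1)]→ₗ[F] L) : Prop :=
  ∀ (x : Fin (n + 1) → L) (y : Fin n → L),
    B (Fin.cons (B x) y) = ∑ i, B (Function.update x i (B (Fin.cons (x i) y)))

/-- The operator `z ↦ [z, y₁, …, yₙ]`. -/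
def adj (B : L [⋀^Fin (n + 1)]→ₗ[F] L) (y : Fin n → L) : L →ₗ[F] L :=
  B.toMultilinearMap.toLinearMap (Fin.cons 0 y) 0

@[simp]
theorem adj_apply (B : L [⋀^Fin (n + 1)]→ₗ[F] L) (y : Fin n → L) (z : L) :
    adj B y z = B (Fin.cons z y) := by
  simp [adj]

/-- The value of a bracketed word when the letters are replaced by elements of an algebra. -/
def eval (B : L [⋀^Fin n]→ₗ[F] L) (α : X → L) : Word n X → L
  | .letter x => α x
  | .bracket w => B fun i => eval B α (w i)

theorem eval_map (B : L [⋀^Fin n]→ₗ[F] L) {Y : Type} (f : X → Y) (α : Y → L) (w : Word n X) :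
    eval B α (w.map f) = eval B (α ∘ f) w := by
  induction w with
  | letter x => rfl
  | bracket w ih => simp [Word.map, eval, ih]

/-- Linear extension of `eval` to linear combinations of words. -/
noncomputable def evalLin (B : L [⋀^Fin n]→ₗ[F] L) (α : X → L) : (Word n X →₀ F) →ₗ[F] L :=
  Finsupp.linearCombination F (eval B α)

@[simp]
theorem evalLin_single (B : L [⋀^Fin n]→ₗ[F] L) (α : X → L) (w : Word n X) :
    evalLin B α (Finsupp.single w 1) = eval B α w := by
  simp [evalLin]

theorem eval_bracket_update (B : L [⋀^Fin n]→ₗ[F] L) (α : X → L) (w : Fin n → Word n X)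
    (i : Fin n) (s : Word n X) :
    eval B α (.bracket (Function.update w i s)) =
      B (Function.update (fun j => eval B α (w j)) i (eval B α s)) := by
  simp only [eval]
  congr 1
  ext j
  rcases eq_or_ne j i with rfl | h <;> simp [*]

/-- Induction on the way the relator arises. In the case `congr`, evaluation turns the surrounding
bracket into a linear map of the value of `r`, which is zero. -/
theorem evalLin_relator {B : L [⋀^Fin (n + 1)]→ₗ[F] L} (hB : IsFilippov B) (α : X → L)
    {r : Word (n + 1) X →₀ F} (hr : Relator F (n + 1) X r) : evalLin B α r = 0 := by
  induction hr with
  | antisymmetry w σ =>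
    have := B.map_perm (fun i => eval B α (w i)) σ
    simp only [map_sub, map_smul, evalLin_single, eval, Function.comp_apply] at this ⊢
    simp only [Function.comp_def] at this
    rw [this, Units.smul_def, ← Int.cast_smul_eq_zsmul F, smul_smul, ← Int.cast_mul, ← Units.val_mul,
      Int.units_mul_self]
    simp
  | jacobi x y =>
    have key : ∀ a : Word (n + 1) X, eval B α (.bracket (cons a y)) =
        B (Fin.cons (eval B α a) fun j => eval B α (y j)) := by
      intro a
      rw [← cons_eq]
      simp only [eval]
      congr 1
      ext i
      exact apply_cons (eval B α) a y i
    simp only [map_sub, map_sum, evalLin_single, eval_bracket_update, key]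
    rw [sub_eq_zero]
    exact hB (fun i => eval B α (x i)) fun j => eval B α (y j)
  | congr w i r hr ih =>
    have : evalLin B α ∘ₗ Finsupp.lmapDomain F F
          (fun s => Word.bracket (Function.update w i s)) =
        B.toMultilinearMap.toLinearMap (fun j => eval B α (w j)) i ∘ₗ evalLin B α := by
      ext s
      simp only [LinearMap.comp_apply, Finsupp.lsingle_apply, Finsupp.lmapDomain_apply,
        Finsupp.mapDomain_single, evalLin_single, eval_bracket_update]
      rfl
    have h := LinearMap.congr_fun this r
    simp only [LinearMap.comp_apply, Finsupp.lmapDomain_apply, ih, map_zero] at h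
    exact h

/-- The universal property of the free Filippov algebra. -/
noncomputable def lift {B : L [⋀^Fin (n + 1)]→ₗ[F] L} (hB : IsFilippov B) (α : X → L) :
    FreeFilippov F (n + 1) X →ₗ[F] L :=
  (relations F (n + 1) X).liftQ (evalLin B α)
    (Submodule.span_le.2 fun _ hr => evalLin_relator hB α hr)

@[simp]
theorem lift_wordClass {B : L [⋀^Fin (n + 1)]→ₗ[F] L} (hB : IsFilippov B) (α : X → L)
    (w : Word (n + 1) X) : lift hB α (wordClass F w) = eval B α w :=
  ((relations F (n + 1) X).liftQ_apply _ _).trans (evalLin_single B α w)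

theorem span_wordClass (F : Type*) [Field F] (n : ℕ) (X : Type) :
    Submodule.span F (Set.range (wordClass F (n := n) (X := X))) = ⊤ := by
  rw [show (wordClass F (n := n) (X := X)) =
    (relations F n X).mkQ ∘ fun w => Finsupp.single w 1 from rfl, Set.range_comp,
    Submodule.span_image]
  have : Submodule.span F (Set.range fun w : Word n X => Finsupp.single w (1 : F)) = ⊤ := by
    have := (Finsupp.basisSingleOne (R := F) (ι := Word n X)).span_eq
    simpa using this
  rw [this, Submodule.map_top, Submodule.range_mkQ]

/-- The slots are passed from generators to arbitrary elements of the span one at a time, by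
linearity in that slot. This reduces multilinear identities to words. -/
theorem _root_.MultilinearMap.map_mem_of_mem_span {ι M N : Type*} [Finite ι] [AddCommGroup M]
    [Module F M] [AddCommGroup N] [Module F N] (B : MultilinearMap F (fun _ : ι => M) N)
    (S : ι → Set M) (P : Submodule F N) (h : ∀ v : ι → M, (∀ i, v i ∈ S i) → B v ∈ P)
    (v : ι → M) (hv : ∀ i, v i ∈ Submodule.span F (S i)) : B v ∈ P := by
  classical
  have := Fintype.ofFinite ι
  have key : ∀ (s : Finset ι) (v : ι → M), (∀ i ∈ s, v i ∈ Submodule.span F (S i)) →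
      (∀ i ∉ s, v i ∈ S i) → B v ∈ P := by
    intro s
    induction s using Finset.induction_on with
    | empty => exact fun v _ hv => h v fun i => hv i (by simp)
    | insert a s ha ih =>
      intro v h1 h2
      have h3 : Submodule.span F (S a) ≤ P.comap (B.toLinearMap v a) := by
        refine Submodule.span_le.2 fun x hx => ih _ (fun i hi => ?_) fun i hi => ?_
        · rw [Function.update_of_ne (ne_of_mem_of_not_mem hi ha)]
          exact h1 i (Finset.mem_insert_of_mem hi)
        · rcases eq_or_ne i a with rfl | hia
          · simpa using hx
          · rw [Function.update_of_ne hia]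
            exact h2 i (by simp [hia, hi])
      have h4 := h3 (h1 a (Finset.mem_insert_self a s))
      simpa using h4
  exact key Finset.univ v (fun i _ => hv i) (by simp)

/-- Every term of the Jacobi identity is linear in each `x i` and each `y j`. The spanning argument
is applied first in `x` with `y` fixed, then in `y`. -/
theorem isFilippov_of_span {B : L [⋀^Fin (n + 1)]→ₗ[F] L} (S : Set L)
    (hS : Submodule.span F S = ⊤)
    (h : ∀ (x : Fin (n + 1) → L) (y : Fin n → L), (∀ i, x i ∈ S) → (∀ j, y j ∈ S) →
      B (Fin.cons (B x) y) = ∑ i, B (Function.update x i (B (Fin.cons (x i) y)))) :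
    IsFilippov B := by
  have h1 : ∀ (x : Fin (n + 1) → L) (y : Fin n → L), (∀ j, y j ∈ S) →
      B (Fin.cons (B x) y) = ∑ i, B (Function.update x i (B (Fin.cons (x i) y))) := by
    intro x y hy
    have hupd : ∀ (x : Fin (n + 1) → L) i, (fun j => (Function.update
        (fun _ => LinearMap.id) i (adj B y) : Fin (n + 1) → (L →ₗ[F] L)) j (x j)) =
        Function.update x i (B (Fin.cons (x i) y)) := by
      intro x i
      ext j
      rcases eq_or_ne j i with rfl | hj <;> simp [*]
    have := ((adj B y).compMultilinearMap B.toMultilinearMap -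
        ∑ i, B.toMultilinearMap.compLinearMap
          (Function.update (fun _ => LinearMap.id) i (adj B y))).map_mem_of_mem_span
      (fun _ => S) ⊥ (fun v hv => ?_) x (fun i => by rw [hS]; trivial)
    · simpa [sub_eq_zero, hupd] using this
    · simpa [sub_eq_zero, hupd] using h v y hv hy
  intro x y
  have := ((B.curryLeft (B x)).toMultilinearMap -
      ∑ i, (B.toMultilinearMap.toLinearMap x i).compMultilinearMap
        (B.curryLeft (x i)).toMultilinearMap).map_mem_of_mem_span
    (fun _ => S) ⊥ (fun v hv => ?_) y (fun i => by rw [hS]; trivial)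
  · simpa [sub_eq_zero, Matrix.vecCons] using this
  · simpa [sub_eq_zero, Matrix.vecCons] using h1 x v hv

/-- The bracket of linear combinations of words, with values in the free algebra. -/
noncomputable def preBracket (F : Type*) [Field F] (n : ℕ) (X : Type) :
    MultilinearMap F (fun _ : Fin n => Word n X →₀ F) (FreeFilippov F n X) :=
  ((Basis.piTensorProduct fun _ : Fin n =>
      Finsupp.basisSingleOne (R := F) (ι := Word n X)).constr F
        fun w => wordClass F (.bracket w)).compMultilinearMap (PiTensorProduct.tprod F)

theorem preBracket_single (w : Fin n → Word n X) :
    preBracket F n X (fun i => Finsupp.single (w i) 1) = wordClass F (.bracket w) := by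
  have := (Basis.piTensorProduct fun _ : Fin n =>
      Finsupp.basisSingleOne (R := F) (ι := Word n X)).constr_basis F
        (fun w => wordClass F (.bracket w)) w
  simpa [preBracket, Basis.piTensorProduct_apply] using this

/-- The relations form an ideal. If the other arguments are single words this is the constructor
`congr`, and multilinearity gives the general case. -/
theorem preBracket_update_relator (f : Fin n → Word n X →₀ F) (i : Fin n) {r : Word n X →₀ F}
    (hr : r ∈ relations F n X) : preBracket F n X (Function.update f i r) = 0 := by
  have hspan : Submodule.span F (Set.range fun w : Word n X => Finsupp.single w (1 : F)) = ⊤ := by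
    simpa using (Finsupp.basisSingleOne (R := F) (ι := Word n X)).span_eq
  have := (preBracket F n X).map_mem_of_mem_span
    (Function.update (fun _ => Set.range fun w => Finsupp.single w 1) i {r | Relator F n X r})
    ⊥ ?_ (Function.update f i r) ?_
  · simpa using this
  · intro v hv
    have hvi : Relator F n X (v i) := by simpa using hv i
    have : ∀ j, ∃ w : Word n X, j ≠ i → v j = Finsupp.single w 1 := by
      intro j
      rcases eq_or_ne j i with rfl | hj
      · have : Nonempty (Word n X) := by
          generalize v j = r at hvi
          cases hvi with
          | antisymmetry w σ => exact ⟨.bracket w⟩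
          | jacobi x y => exact ⟨.bracket x⟩
          | congr w i r hr => exact ⟨.bracket w⟩
        exact ⟨this.some, fun h => absurd rfl h⟩
      · have := hv j
        rw [Function.update_of_ne hj] at this
        obtain ⟨w, hw⟩ := this
        exact ⟨w, fun _ => hw.symm⟩
    choose w hw using this
    have hlin : (preBracket F n X).toLinearMap v i =
        (relations F n X).mkQ ∘ₗ
          Finsupp.lmapDomain F F fun s => Word.bracket (Function.update w i s) := by
      ext s
      have : Function.update v i (Finsupp.single s 1) =
          fun j => Finsupp.single (Function.update w i s j) (1 : F) := by
        ext j : 1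
        rcases eq_or_ne j i with rfl | hj
        · simp
        · simp [hj, hw]
      simp only [LinearMap.comp_apply, Finsupp.lsingle_apply, MultilinearMap.toLinearMap_apply, this,
        preBracket_single, Finsupp.lmapDomain_apply, Finsupp.mapDomain_single, wordClass]
    have h := LinearMap.congr_fun hlin (v i)
    simp only [MultilinearMap.toLinearMap_apply, Function.update_eq_self, LinearMap.comp_apply,
      Finsupp.lmapDomain_apply] at h
    rw [h, Submodule.mem_bot, Submodule.mkQ_apply, Submodule.Quotient.mk_eq_zero]
    exact Submodule.subset_span (Relator.congr w i _ hvi)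
  · intro j
    rcases eq_or_ne j i with rfl | hj
    · simpa [relations] using hr
    · simp [hj, hspan]

theorem preBracket_congr {f g : Fin n → Word n X →₀ F}
    (h : ∀ i, (relations F n X).mkQ (f i) = (relations F n X).mkQ (g i)) :
    preBracket F n X f = preBracket F n X g := by
  have key : ∀ s : Finset (Fin n), preBracket F n X (s.piecewise f g) = preBracket F n X g := by
    intro s
    induction s using Finset.induction_on with
    | empty => simp
    | insert a s ha ih =>
      rw [Finset.piecewise_insert, ← ih, ← sub_eq_zero]
      conv_lhs => enter [2]; rw [← Function.update_eq_self a (s.piecewise f g)]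
      rw [← MultilinearMap.map_update_sub]
      refine preBracket_update_relator _ _ ?_
      rw [Finset.piecewise_eq_of_notMem _ _ _ ha, ← Submodule.Quotient.eq]
      exact h a
  simpa using key Finset.univ

/-- A representative of an element of the free algebra. -/
noncomputable def rep (x : FreeFilippov F n X) : Word n X →₀ F :=
  Function.surjInv (relations F n X).mkQ_surjective x

@[simp]
theorem mkQ_rep (x : FreeFilippov F n X) : (relations F n X).mkQ (rep x) = x :=
  Function.surjInv_eq _ x

variable (F n X) in
/-- The bracket of the free algebra, as a multilinear map. -/
noncomputable def freeMultilinear :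
    MultilinearMap F (fun _ : Fin n => FreeFilippov F n X) (FreeFilippov F n X) where
  toFun x := preBracket F n X fun i => rep (x i)
  map_update_add' := by
    intro inst x i a b
    obtain rfl : inst = instDecidableEqFin n := Subsingleton.elim _ _
    have : ∀ c d, (relations F n X).mkQ d = c → preBracket F n X (fun j => rep (Function.update x i c j)) =
        preBracket F n X (Function.update (fun j => rep (x j)) i d) := by
      intro c d hd
      refine preBracket_congr fun j => ?_
      rcases eq_or_ne j i with rfl | hj <;> simp [*, -Submodule.mkQ_apply]
    rw [this (a + b) (rep a + rep b) (by simp only [map_add, mkQ_rep]), this a (rep a) (mkQ_rep a),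
      this b (rep b) (mkQ_rep b), MultilinearMap.map_update_add]
  map_update_smul' := by
    intro inst x i c a
    obtain rfl : inst = instDecidableEqFin n := Subsingleton.elim _ _
    have : ∀ c d, (relations F n X).mkQ d = c → preBracket F n X (fun j => rep (Function.update x i c j)) =
        preBracket F n X (Function.update (fun j => rep (x j)) i d) := by
      intro c d hd
      refine preBracket_congr fun j => ?_
      rcases eq_or_ne j i with rfl | hj <;> simp [*, -Submodule.mkQ_apply]
    rw [this (c • a) (c • rep a) (by simp only [map_smul, mkQ_rep]), this a (rep a) (mkQ_rep a),
      MultilinearMap.map_update_smul]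

theorem freeMultilinear_wordClass (w : Fin n → Word n X) :
    freeMultilinear F n X (fun i => wordClass F (w i)) = wordClass F (.bracket w) := by
  rw [← preBracket_single]
  exact preBracket_congr fun i => mkQ_rep _

theorem freeMultilinear_ext_mem (P : Submodule F (FreeFilippov F n X)) {ι : Type*} [Finite ι]
    (B : MultilinearMap F (fun _ : ι => FreeFilippov F n X) (FreeFilippov F n X))
    (h : ∀ w : ι → Word n X, B (fun i => wordClass F (w i)) ∈ P)
    (x : ι → FreeFilippov F n X) : B x ∈ P := by
  refine B.map_mem_of_mem_span (fun _ => Set.range (wordClass F)) P (fun v hv => ?_) x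
    fun i => by rw [span_wordClass]; trivial
  choose w hw using hv
  obtain rfl : (fun i => wordClass F (w i)) = v := funext hw
  exact h w

theorem wordClass_bracket_comp_perm (w : Fin n → Word n X) (σ : Equiv.Perm (Fin n)) :
    wordClass F (.bracket w) =
      ((Equiv.Perm.sign σ : ℤ) : F) • wordClass F (.bracket (w ∘ σ)) := by
  rw [← sub_eq_zero, wordClass, wordClass, ← map_smul, ← map_sub, Submodule.mkQ_apply,
    Submodule.Quotient.mk_eq_zero]
  exact Submodule.subset_span (Relator.antisymmetry w σ)

theorem freeMultilinear_swap (x : Fin n → FreeFilippov F n X) {i j : Fin n} (hij : i ≠ j) :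
    freeMultilinear F n X (x ∘ Equiv.swap i j) = - freeMultilinear F n X x := by
  have := freeMultilinear_ext_mem (F := F) (n := n) (X := X) ⊥
    ((freeMultilinear F n X).domDomCongr (Equiv.swap i j) + freeMultilinear F n X) (fun w => ?_) x
  · rw [Submodule.mem_bot] at this
    exact eq_neg_of_add_eq_zero_left this
  · rw [Submodule.mem_bot, add_apply, MultilinearMap.domDomCongr_apply,
      freeMultilinear_wordClass w, freeMultilinear_wordClass (fun k => w (Equiv.swap i j k)),
      wordClass_bracket_comp_perm w (Equiv.swap i j), Equiv.Perm.sign_swap hij]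
    simp [Function.comp_def]

variable (F n X) in
/-- The bracket of the free algebra. -/
noncomputable def freeBracket [CharZero F] :
    FreeFilippov F n X [⋀^Fin n]→ₗ[F] FreeFilippov F n X :=
  { freeMultilinear F n X with
    map_eq_zero_of_eq' := fun x i j hx hij => by
      -- Exchanging two equal arguments changes nothing and also changes the sign, so twice the
      -- value is zero; characteristic 0 permits division by 2.
      have h := freeMultilinear_swap (F := F) x hij
      rw [show x ∘ Equiv.swap i j = x by
        ext k
        simp only [Function.comp_apply, Equiv.swap_apply_def]
        split_ifs with h1 h2
        · rw [h1, hx]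
        · rw [h2, hx]
        · rfl] at h
      have h2 : (2 : F) • freeMultilinear F n X x = 0 := by
        rw [two_smul]
        nth_rw 1 [h]
        simp
      exact (smul_eq_zero.1 h2).resolve_left two_ne_zero }

variable [CharZero F]

theorem freeBracket_wordClass (w : Fin n → Word n X) :
    freeBracket F n X (fun i => wordClass F (w i)) = wordClass F (.bracket w) :=
  freeMultilinear_wordClass w

omit [CharZero F] in
theorem cons_wordClass {n : ℕ} (a : Word (n + 1) X) (y : Fin n → Word (n + 1) X) :
    (Fin.cons (wordClass F a) fun j => wordClass F (y j)) =
      fun i => wordClass F (cons (n := n + 1) a y i) := by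
  rw [cons_eq]
  ext i : 1
  refine Fin.cases ?_ (fun j => ?_) i <;> simp

variable (F n X) in
theorem isFilippov_freeBracket : IsFilippov (freeBracket F (n + 1) X) := by
  refine isFilippov_of_span _ (span_wordClass F (n + 1) X) fun x y hx hy => ?_
  choose x' hx using hx
  choose y' hy using hy
  obtain rfl : (fun i => wordClass F (x' i)) = x := funext hx
  obtain rfl : (fun i => wordClass F (y' i)) = y := funext hy
  have hup : ∀ (i : Fin (n + 1)) (z : Word (n + 1) X),
      Function.update (fun i => wordClass F (x' i)) i (wordClass F z) =
        fun j => wordClass F (Function.update x' i z j) := by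
    intro i z
    ext j : 1
    rcases eq_or_ne j i with rfl | hj
    · simp
    · simp [hj]
  simp only [freeBracket_wordClass, cons_wordClass, hup]
  rw [← sub_eq_zero]
  simp only [wordClass, ← map_sum, ← map_sub]
  rw [Submodule.mkQ_apply, Submodule.Quotient.mk_eq_zero]
  exact Submodule.subset_span (Relator.jacobi x' y')

theorem eval_freeBracket (w : Word n X) :
    eval (freeBracket F n X) (fun x => wordClass F (.letter x)) w = wordClass F w := by
  induction w with
  | letter x => rfl
  | bracket w ih => simp only [eval, ih, freeBracket_wordClass]

end Algebra

/-! ### Changing the arity of a Filippov algebra by one -/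

section Derived

variable {F : Type*} [Field F] {n : ℕ} {L : Type*} [AddCommGroup L] [Module F L]

theorem map_cons_cons (B : L [⋀^Fin (n + 2)]→ₗ[F] L) (a b : L) (y : Fin n → L) :
    B (Fin.cons a (Fin.cons b y)) = - B (Fin.cons b (Fin.cons a y)) := by
  rw [← B.map_swap _ (Fin.zero_ne_one (n := n))]
  congr 1
  ext i
  refine Fin.cases ?_ (fun i => Fin.cases ?_ (fun j => ?_) i) i
  · simp
  · rw [Function.comp_apply, show Fin.succ (0 : Fin (n + 1)) = 1 from rfl, Equiv.swap_apply_right]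
    rfl
  · rw [Function.comp_apply, Equiv.swap_apply_of_ne_of_ne (Fin.succ_ne_zero _)]
    · simp
    · exact fun h => Fin.succ_ne_zero _ (Fin.succ_injective _ h)

/-- Fixing the first argument of a Filippov bracket gives a Filippov bracket. -/
theorem IsFilippov.curryLeft {B : L [⋀^Fin (n + 2)]→ₗ[F] L} (hB : IsFilippov B) (c : L) :
    IsFilippov (B.curryLeft c) := by
  intro x y
  have h0 : B (Fin.cons c (Fin.cons c y)) = 0 :=
    B.map_eq_zero_of_eq _ (i := 0) (j := 1) rfl Fin.zero_ne_one
  simp only [AlternatingMap.curryLeft_apply_apply, Matrix.vecCons]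
  rw [map_cons_cons, hB, Fin.sum_univ_succ]
  simp only [Fin.cons_zero, h0, Fin.cons_succ]
  rw [B.map_coord_zero (i := 0) (by simp), zero_add, ← Finset.sum_neg_distrib]
  refine Finset.sum_congr rfl fun i _ => ?_
  rw [map_cons_cons, Fin.cons_update, AlternatingMap.map_update_neg, neg_neg]

/-- The first component of the bracket with one more argument on `L × F`. -/
def extendForm (B : L [⋀^Fin n]→ₗ[F] L) : (L × F) [⋀^Fin (n + 1)]→ₗ[F] L :=
  AlternatingMap.alternatizeUncurryFin
    ((LinearMap.snd F L F).smulRight (B.compLinearMap (LinearMap.fst F L F)))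

theorem extendForm_apply (B : L [⋀^Fin n]→ₗ[F] L) (z : Fin (n + 1) → L × F) :
    extendForm B z = ∑ i : Fin (n + 1), (-1 : ℤ) ^ (i : ℕ) • (z i).2 • B fun j => (z (i.succAbove j)).1 := by
  simp only [extendForm, AlternatingMap.alternatizeUncurryFin_apply]
  rfl

/-- The bracket on `L × F` for which bracketing with `(0, 1)` gives the bracket of `L`. -/
def extend (B : L [⋀^Fin n]→ₗ[F] L) : (L × F) [⋀^Fin (n + 1)]→ₗ[F] (L × F) :=
  (LinearMap.inl F L F).compAlternatingMap (extendForm B)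

theorem extend_apply (B : L [⋀^Fin n]→ₗ[F] L) (z : Fin (n + 1) → L × F) :
    extend B z = (extendForm B z, 0) := rfl

theorem extendForm_cons (B : L [⋀^Fin (n + 1)]→ₗ[F] L) (u : L) (y : Fin (n + 1) → L × F) :
    extendForm B (Fin.cons (u, 0) y) =
      - ∑ j : Fin (n + 1), (-1 : ℤ) ^ (j : ℕ) • (y j).2 • B (Fin.cons u fun k => (y (j.succAbove k)).1) := by
  rw [extendForm_apply, Fin.sum_univ_succ, ← Finset.sum_neg_distrib]
  simp only [Fin.cons_zero, zero_smul, smul_zero, zero_add]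
  refine Finset.sum_congr rfl fun j _ => ?_
  rw [Fin.val_succ, pow_succ, mul_neg_one, neg_smul]
  congr 4
  ext k
  refine Fin.cases ?_ (fun k => ?_) k <;> simp

theorem extendForm_cons_eq (B : L [⋀^Fin (n + 1)]→ₗ[F] L) (z : L × F) (y : Fin (n + 1) → L × F) :
    extendForm B (Fin.cons z y) =
      z.2 • B (fun j => (y j).1) + extendForm B (Fin.cons (z.1, 0) y) := by
  rw [extendForm_cons, extendForm_apply, Fin.sum_univ_succ, ← Finset.sum_neg_distrib]
  congr 1
  · simp
  · refine Finset.sum_congr rfl fun j _ => ?_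
    rw [Fin.val_succ, pow_succ, mul_neg_one, neg_smul]
    congr 4
    ext k
    refine Fin.cases ?_ (fun k => ?_) k <;> simp

/-- Expanding gives a double sum over pairs i ≠ j of (x i).2 (x j).2 times a value of B with u
inserted. The scalar is symmetric in i and j and the sign is antisymmetric, so everything cancels.
In other words, alternatizing twice a form symmetric in its first two arguments gives zero. -/
theorem sum_smul_extendForm_update (B : L [⋀^Fin (n + 1)]→ₗ[F] L) (x : Fin (n + 2) → L × F)
    (u : L) : ∑ i, (x i).2 • extendForm B (Function.update x i (u, 0)) = 0 := by
  set f : (L × F) →ₗ[F] (L × F) →ₗ[F] (L × F) [⋀^Fin n]→ₗ[F] L :=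
    (LinearMap.snd F L F).smulRight ((LinearMap.snd F L F).smulRight
      ((B.curryLeft u).compLinearMap (LinearMap.fst F L F))) with hf
  have h := AlternatingMap.alternatizeUncurryFin_alternatizeUncurryFinLM_comp_of_symmetric
    (f := f) (fun a b => by ext; simp only [hf]; exact smul_comm _ _ _)
  have h2 := DFunLike.congr_fun h x
  rw [AlternatingMap.alternatizeUncurryFin_apply] at h2
  rw [← neg_eq_zero, ← Finset.sum_neg_distrib]
  refine Eq.trans (Finset.sum_congr rfl fun i _ => ?_) h2
  rw [← Fin.insertNth_removeNth, AlternatingMap.map_insertNth, Matrix.vecCons, extendForm_cons,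
    smul_neg, smul_neg, neg_neg, LinearMap.comp_apply]
  simp only [AlternatingMap.alternatizeUncurryFinLM_apply,
    AlternatingMap.alternatizeUncurryFin_apply]
  rw [smul_comm, Finset.smul_sum]
  congr 1
  refine Finset.sum_congr rfl fun j _ => ?_
  rw [smul_comm]
  rfl

/-- D acts as zero on the scalar components: the summand in which the updated slot supplies the
scalar drops out, and what remains is the derivation rule for B. -/
theorem isDerivation_extendForm {B : L [⋀^Fin (n + 1)]→ₗ[F] L} (D : L →ₗ[F] L)
    (hD : ∀ x, D (B x) = ∑ i, B (Function.update x i (D (x i)))) (x : Fin (n + 2) → L × F) :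
    D (extendForm B x) = ∑ i, extendForm B (Function.update x i (D (x i).1, 0)) := by
  simp only [extendForm_apply, map_sum]
  rw [Finset.sum_comm]
  refine Finset.sum_congr rfl fun l _ => ?_
  rw [Fin.sum_univ_succAbove _ l]
  simp only [Function.update_self, zero_smul, smul_zero, zero_add]
  rw [map_zsmul, map_smul, hD, Finset.smul_sum, Finset.smul_sum]
  refine Finset.sum_congr rfl fun i _ => ?_
  rw [Function.update_of_ne (Fin.succAbove_ne l i).symm]
  congr 3
  ext j
  rcases eq_or_ne j i with rfl | hj
  · simp
  · simp [hj]

/-- The map u ↦ [(u, 0), y] is a combination of operators of the form [·, y'] on L, hence a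
derivation of B and then of the extended form. Bracketing `x i` with y gives, besides this
derivation, the extra term (x i).2 • B(y); the contributions of the extra terms cancel by
`sum_smul_extendForm_update`. -/
theorem IsFilippov.extend {B : L [⋀^Fin (n + 1)]→ₗ[F] L} (hB : IsFilippov B) :
    IsFilippov (extend B) := by
  intro x y
  simp only [extend_apply]
  set D : L →ₗ[F] L :=
    (extendForm B).toMultilinearMap.toLinearMap (Fin.cons 0 y) 0 ∘ₗ LinearMap.inl F L F with hD
  have hDapp : ∀ u, D u = extendForm B (Fin.cons (u, 0) y) := by
    intro u
    simp [hD]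
  have hder : ∀ x, D (B x) = ∑ i, B (Function.update x i (D (x i))) := by
    intro x
    simp only [hDapp, extendForm_cons, AlternatingMap.map_update_neg, AlternatingMap.map_update_sum]
    rw [Finset.sum_neg_distrib, Finset.sum_comm]
    congr 1
    refine Finset.sum_congr rfl fun j _ => ?_
    rw [hB, Finset.smul_sum, Finset.smul_sum]
    refine Finset.sum_congr rfl fun i _ => ?_
    rw [← Int.cast_smul_eq_zsmul F, ← Int.cast_smul_eq_zsmul F, AlternatingMap.map_update_smul,
      AlternatingMap.map_update_smul]
  have hsplit : ∀ i, extendForm B (Function.update x i (extendForm B (Fin.cons (x i) y), 0)) =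
      (x i).2 • extendForm B (Function.update x i (B fun j => (y j).1, 0)) +
        extendForm B (Function.update x i (D (x i).1, 0)) := by
    intro i
    rw [← AlternatingMap.map_update_smul, ← AlternatingMap.map_update_add]
    congr 2
    rw [extendForm_cons_eq, hDapp]
    simp
  have : extendForm B (Fin.cons (extendForm B x, 0) y) =
      ∑ i, extendForm B (Function.update x i (extendForm B (Fin.cons (x i) y), 0)) := by
    rw [← hDapp, isDerivation_extendForm D hder, Finset.sum_congr rfl fun i _ => hsplit i,
      Finset.sum_add_distrib, sum_smul_extendForm_update, zero_add]
  rw [this]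
  ext
  · simp [Prod.fst_sum]
  · simp [Prod.snd_sum]

end Derived

/-! ### Counting marked letters against brackets -/

namespace Word
variable {n : ℕ} {X : Type}

/-- The number of letters of a word satisfying `p`. -/
def countLetters (p : X → Prop) [DecidablePred p] (w : Word n X) : ℕ :=
  w.letters.countP p

variable (p : X → Prop) [DecidablePred p]

theorem countLetters_letter (x : X) :
    (letter x : Word n X).countLetters p = if p x then 1 else 0 := by
  simp [countLetters, letters, ← Multiset.cons_zero, Multiset.countP_cons]

theorem countLetters_bracket (w : Fin n → Word n X) :
    (bracket w).countLetters p = ∑ i, (w i).countLetters p :=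
  map_sum (Multiset.countPAddMonoidHom p) _ _

/-- The word is a single letter satisfying `p`. -/
def IsLetterOf (w : Word n X) : Prop := ∃ x, w = letter x ∧ p x

/-- The arguments together contain at most one marked letter more than they have brackets, and the
outer bracket absorbs that one. If the total reaches the number of brackets, all inequalities are
equalities. -/
theorem exists_of_forall_countLetters_le {w : Fin n → Word n X}
    (h : ∀ i, ¬ (w i).IsLetterOf p → (w i).countLetters p ≤ (w i).numBrackets)
    (h2 : ∀ i j, (w i).IsLetterOf p → (w j).IsLetterOf p → i = j)
    (hw : (bracket w).numBrackets ≤ (bracket w).countLetters p) :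
    (bracket w).numBrackets = (bracket w).countLetters p ∧
    ∃ l, (w l).IsLetterOf p ∧ ∀ i, i ≠ l → ¬ (w i).IsLetterOf p ∧
      (w i).countLetters p = (w i).numBrackets := by
  classical
  have h3 : ∀ i, (w i).countLetters p ≤ (w i).numBrackets + if (w i).IsLetterOf p then 1 else 0 := by
    intro i
    split_ifs with hi
    · obtain ⟨x, hx, hpx⟩ := hi
      rw [hx, countLetters_letter, if_pos hpx]
      omega
    · simpa using h i hi
  rw [countLetters_bracket, numBrackets] at *
  by_cases hl : ∃ l, (w l).IsLetterOf p
  · obtain ⟨l, hl⟩ := hl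
    have h4 : (∑ i, if (w i).IsLetterOf p then 1 else 0) = 1 := by
      rw [Finset.sum_eq_single l (fun i _ hi => if_neg fun h => hi (h2 _ _ h hl)) (by simp),
        if_pos hl]
    have h5 : ∑ i, (w i).countLetters p = ∑ i, ((w i).numBrackets + if (w i).IsLetterOf p then 1 else 0) := by
      refine le_antisymm (Finset.sum_le_sum fun i _ => h3 i) ?_
      rw [Finset.sum_add_distrib, h4]
      omega
    refine ⟨by rw [h5, Finset.sum_add_distrib, h4, add_comm], l, hl, fun i hi => ?_⟩
    have hi' : ¬ (w i).IsLetterOf p := fun h => hi (h2 _ _ h hl)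
    refine ⟨hi', ?_⟩
    have := (Finset.sum_eq_sum_iff_of_le fun i _ => h3 i).1 h5 i (Finset.mem_univ i)
    simpa [hi'] using this
  · push Not at hl
    have := Finset.sum_le_sum fun i (_ : i ∈ Finset.univ) => h3 i
    simp only [hl, if_false, add_zero] at this
    omega

end Word

/-! ### Evaluating words whose marked letters have a common value -/

section Eval

variable {F : Type*} [Field F] {n : ℕ} {X : Type} {L : Type*} [AddCommGroup L] [Module F L]

theorem eval_eq_of_isLetterOf (B : L [⋀^Fin n]→ₗ[F] L) {α : X → L} {p : X → Prop} {e : L}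
    (hα : ∀ x, p x → α x = e) {w : Word n X} (hw : w.IsLetterOf p) : eval B α w = e := by
  obtain ⟨x, rfl, hx⟩ := hw
  exact hα x hx

/-- If the letters satisfying `p` all have the same value, then a bracketed word containing more
such letters than brackets vanishes. -/
theorem eval_eq_zero (B : L [⋀^Fin n]→ₗ[F] L) {α : X → L} (p : X → Prop) [DecidablePred p] {e : L}
    (hα : ∀ x, p x → α x = e) (w : Word n X) (hw : ¬ w.IsLetterOf p)
    (h : w.numBrackets < w.countLetters p) : eval B α w = 0 := by
  induction w with
  | letter x =>
    rw [Word.countLetters_letter] at h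
    have : ¬ p x := fun hx => hw ⟨x, rfl, hx⟩
    simp [this] at h
  | bracket w ih =>
    by_cases h1 : ∀ i, ¬ (w i).IsLetterOf p → (w i).countLetters p ≤ (w i).numBrackets
    · by_cases h2 : ∀ i j, (w i).IsLetterOf p → (w j).IsLetterOf p → i = j
      · have := (Word.exists_of_forall_countLetters_le p h1 h2 h.le).1
        omega
      · push Not at h2
        obtain ⟨i, j, hi, hj, hij⟩ := h2
        exact B.map_eq_zero_of_eq _ ((eval_eq_of_isLetterOf B hα hi).trans
          (eval_eq_of_isLetterOf B hα hj).symm) hij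
    · push Not at h1
      obtain ⟨i, hi, hlt⟩ := h1
      exact B.map_coord_zero (i := i) (ih i hi hlt)

theorem extend_of_single (B : L [⋀^Fin n]→ₗ[F] L) (z : Fin (n + 1) → L × F) (l : Fin (n + 1))
    (hl : (z l).2 = 1) (h : ∀ i, i ≠ l → (z i).2 = 0) :
    extend B z = ((-1 : ℤ) ^ (l : ℕ) • B fun j => (z (l.succAbove j)).1, 0) := by
  rw [extend_apply, extendForm_apply, Finset.sum_eq_single l]
  · rw [hl, one_smul]
  · intro i _ hi
    rw [h i hi, zero_smul, smul_zero]
  · simp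

/-- The extended bracket takes values in L × 0, so only a letter can have a nonzero scalar
component. -/
theorem eval_extend_snd (B : L [⋀^Fin n]→ₗ[F] L) {α : X → L × F} {p : X → Prop}
    (hα : ∀ x, ¬ p x → (α x).2 = 0) {w : Word (n + 1) X} (hw : ¬ w.IsLetterOf p) :
    (eval (extend B) α w).2 = 0 := by
  cases w with
  | letter x => exact hα x fun h => hw ⟨x, rfl, h⟩
  | bracket w => rfl

/-- A word with at least as many letters satisfying `p` as brackets can be evaluated in an
algebra `L₁` after evaluating it in `L × F`, when the letters satisfying `p` have the value `e`
in `L₁`, and `(0, 1)` in `L × F`. -/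
theorem eval_eq_eval_extend {L₁ : Type*} [AddCommGroup L₁] [Module F L₁]
    (B₁ : L₁ [⋀^Fin (n + 1)]→ₗ[F] L₁) (B : L [⋀^Fin n]→ₗ[F] L) (e : L₁) (Ψ : L →ₗ[F] L₁)
    (hΨ : ∀ x, Ψ (B x) = B₁ (Fin.cons e fun i => Ψ (x i))) {p : X → Prop} [DecidablePred p]
    {α : X → L × F} {α₁ : X → L₁} (hp : ∀ x, p x → α x = (0, 1)) (hp1 : ∀ x, p x → α₁ x = e)
    (hnp : ∀ x, ¬ p x → (α x).2 = 0) (hnp1 : ∀ x, ¬ p x → α₁ x = Ψ (α x).1) (w : Word (n + 1) X)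
    (h : w.numBrackets ≤ w.countLetters p) :
    eval B₁ α₁ w = Ψ (eval (extend B) α w).1 + (eval (extend B) α w).2 • e := by
  induction w with
  | letter x =>
    by_cases hx : p x
    · simp [eval, hp x hx, hp1 x hx]
    · simp [eval, hnp x hx, hnp1 x hx]
  | bracket w ih =>
    by_cases h1 : ∀ i, ¬ (w i).IsLetterOf p → (w i).countLetters p ≤ (w i).numBrackets
    · by_cases h2 : ∀ i j, (w i).IsLetterOf p → (w j).IsLetterOf p → i = j
      · obtain ⟨-, l, hl, hne⟩ := Word.exists_of_forall_countLetters_le p h1 h2 h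
        have hwl : eval (extend B) α (w l) = (0, 1) := eval_eq_of_isLetterOf _ hp hl
        have hne2 : ∀ i, i ≠ l → (eval (extend B) α (w i)).2 = 0 := fun i hi =>
          eval_extend_snd B hnp (hne i hi).1
        have hv : (fun i => eval B₁ α₁ (w i)) =
            Fin.insertNth l e fun j => Ψ (eval (extend B) α (w (l.succAbove j))).1 := by
          rw [Fin.eq_insertNth_iff]
          refine ⟨eval_eq_of_isLetterOf _ hp1 hl, ?_⟩
          ext j
          have hj := hne _ (Fin.succAbove_ne l j)
          rw [Fin.removeNth_apply, ih _ hj.2.ge, hne2 _ (Fin.succAbove_ne l j), zero_smul, add_zero]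
        simp only [eval]
        -- Removing slot l on one side and moving e from slot l to the front on the other side
        -- produce the same sign (-1)^l.
        rw [extend_of_single B _ l (by rw [hwl]) hne2, hv, AlternatingMap.map_insertNth, zero_smul,
          add_zero, map_zsmul, hΨ]
        rfl
      · push Not at h2
        obtain ⟨i, j, hi, hj, hij⟩ := h2
        simp only [eval]
        rw [B₁.map_eq_zero_of_eq _ ((eval_eq_of_isLetterOf B₁ hp1 hi).trans
            (eval_eq_of_isLetterOf B₁ hp1 hj).symm) hij,
          (extend B).map_eq_zero_of_eq _ ((eval_eq_of_isLetterOf (extend B) hp hi).trans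
            (eval_eq_of_isLetterOf (extend B) hp hj).symm) hij]
        simp
    · push Not at h1
      obtain ⟨i, hi, hlt⟩ := h1
      simp only [eval]
      rw [B₁.map_coord_zero (i := i) (eval_eq_zero B₁ p hp1 _ hi hlt),
        (extend B).map_coord_zero (i := i) (eval_eq_zero (extend B) p hp _ hi hlt)]
      simp

theorem map_eval {L₁ : Type*} [AddCommGroup L₁] [Module F L₁] {B : L [⋀^Fin n]→ₗ[F] L}
    {B₁ : L₁ [⋀^Fin n]→ₗ[F] L₁} {φ : L →ₗ[F] L₁} (hφ : ∀ x, φ (B x) = B₁ fun i => φ (x i))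
    (α : X → L) (w : Word n X) : φ (eval B α w) = eval B₁ (fun x => φ (α x)) w := by
  induction w with
  | letter x => rfl
  | bracket w ih => simp only [eval, hφ, ih]

variable [CharZero F]

theorem map_freeBracket {B : L [⋀^Fin n]→ₗ[F] L} {φ : FreeFilippov F n X →ₗ[F] L}
    (hφ : ∀ w : Fin n → Word n X,
      φ (wordClass F (.bracket w)) = B fun i => φ (wordClass F (w i)))
    (x : Fin n → FreeFilippov F n X) : φ (freeBracket F n X x) = B fun i => φ (x i) := by
  have := (φ.compMultilinearMap (freeBracket F n X).toMultilinearMap -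
    B.toMultilinearMap.compLinearMap fun _ => φ).map_mem_of_mem_span
      (fun _ => Set.range (wordClass F)) ⊥ (fun v hv => ?_) x
      fun i => by rw [span_wordClass]; trivial
  · simpa [sub_eq_zero] using this
  · choose w hw using hv
    obtain rfl : (fun i => wordClass F (w i)) = v := funext hw
    simpa [sub_eq_zero, freeBracket_wordClass] using hφ w

theorem lift_freeBracket {B : L [⋀^Fin (n + 1)]→ₗ[F] L} (hB : IsFilippov B) (α : X → L)
    (x : Fin (n + 1) → FreeFilippov F (n + 1) X) :
    lift hB α (freeBracket F (n + 1) X x) = B fun i => lift hB α (x i) :=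
  map_freeBracket (fun w => by simp [eval]) x

theorem freeFilippovRep_freeBracket (σ : Equiv.Perm X) (x : Fin n → FreeFilippov F n X) :
    freeFilippovRep F n X σ (freeBracket F n X x) =
      freeBracket F n X fun i => freeFilippovRep F n X σ (x i) :=
  map_freeBracket (fun w => by simp [freeFilippovRep_wordClass, freeBracket_wordClass, Word.map]) x

end Eval

/-! ### Symmetrizers and inclusion–exclusion -/

section Symmetrizer

theorem sum_Icc_neg_one_pow_card {X : Type*} [DecidableEq X] (I K : Finset X) (h : I ⊆ K) :
    ∑ S ∈ Finset.Icc I K, (-1 : ℤ) ^ (S.card) = if I = K then (-1) ^ K.card else 0 := by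
  have hinj : Set.InjOn (fun S => I ∪ S) ((K \ I).powerset : Set (Finset X)) := by
    intro S hS T hT hST
    simp only [Finset.coe_powerset, Set.mem_preimage, Set.mem_powerset_iff, Finset.coe_subset,
      Finset.subset_sdiff] at hS hT
    rw [← Finset.union_sdiff_cancel_left hS.2.symm, ← Finset.union_sdiff_cancel_left hT.2.symm]
    exact congrArg (· \ I) hST
  rw [Finset.Icc_eq_image_powerset h, Finset.sum_image hinj]
  have : ∀ S ∈ (K \ I).powerset, (-1 : ℤ) ^ (I ∪ S).card = (-1) ^ I.card * (-1) ^ S.card := by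
    intro S hS
    rw [Finset.mem_powerset, Finset.subset_sdiff] at hS
    rw [Finset.card_union_of_disjoint hS.2.symm, pow_add]
  rw [Finset.sum_congr rfl this, ← Finset.mul_sum, Finset.sum_powerset_neg_one_pow_card]
  have h2 : K \ I = ∅ ↔ I = K := by
    rw [Finset.sdiff_eq_empty_iff_subset]
    exact ⟨fun h' => h.antisymm h', fun h' => h'.ge⟩
  simp only [h2]
  split_ifs with h3
  · simp [h3]
  · simp

variable {F : Type*} [Field F] {X : Type} [Fintype X] [DecidableEq X]
  {V : Type*} [AddCommGroup V] [Module F V]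

/-- The permutations of `X` fixing all elements outside `T`. -/
def permsOn (T : Finset X) : Finset (Equiv.Perm X) :=
  Finset.univ.filter fun σ => ∀ x ∉ T, σ x = x

theorem mem_permsOn {T : Finset X} {σ : Equiv.Perm X} : σ ∈ permsOn T ↔ ∀ x ∉ T, σ x = x := by
  simp [permsOn]

theorem image_eq_of_mem_permsOn {T : Finset X} {σ : Equiv.Perm X} (hσ : σ ∈ permsOn T) :
    T.image σ = T := by
  rw [mem_permsOn] at hσ
  refine Finset.eq_of_subset_of_card_le (Finset.image_subset_iff.2 fun x hx => ?_)
    (Finset.card_image_of_injective _ σ.injective).ge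
  by_contra h
  have := σ.injective (hσ _ h)
  exact h (this.symm ▸ hx)

/-- The sum of all permutations of `T` acting on a representation. -/
noncomputable def symmetrizer (ρ : Representation F (Equiv.Perm X) V) (T : Finset X) : V →ₗ[F] V :=
  ∑ σ ∈ permsOn T, ρ σ

theorem symmetrizer_apply (ρ : Representation F (Equiv.Perm X) V) (T : Finset X) (v : V) :
    symmetrizer ρ T v = ∑ σ ∈ permsOn T, ρ σ v := by
  simp [symmetrizer]

/-- The values allowed for a function which sends `K` to `S` and fixes all other elements. -/
def targets (K S : Finset X) (x : X) : Finset X := if x ∈ K then S else {x}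

/-- Inclusion-exclusion: the alternating sum over `S ⊆ K` of the sums over all maps `K → S` is the
sum over all permutations of `K`. -/
theorem sum_powerset_sum_piFinset (K : Finset X) (G : (X → X) → V) :
    ∑ S ∈ K.powerset, (-1 : ℤ) ^ (K.card + S.card) •
      ∑ f ∈ Fintype.piFinset (targets K S), G f = ∑ σ ∈ permsOn K, G σ := by
  have hmem : ∀ S (f : X → X), f ∈ Fintype.piFinset (targets K S) ↔
      K.image f ⊆ S ∧ ∀ x ∉ K, f x = x := by
    intro S f
    simp only [Fintype.mem_piFinset, targets, Finset.image_subset_iff]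
    refine ⟨fun h => ⟨fun x hx => by simpa [hx] using h x, fun x hx => by simpa [hx] using h x⟩,
      fun h x => ?_⟩
    by_cases hx : x ∈ K
    · simpa [hx] using h.1 x hx
    · simpa [hx] using h.2 x hx
  have h1 : ∀ S ∈ K.powerset, ∑ f ∈ Fintype.piFinset (targets K S), G f =
      ∑ f ∈ Fintype.piFinset (targets K K), if K.image f ⊆ S then G f else 0 := by
    intro S hS
    rw [← Finset.sum_filter]
    refine Finset.sum_congr ?_ fun _ _ => rfl
    ext f
    rw [Finset.mem_filter, hmem, hmem]
    rw [Finset.mem_powerset] at hS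
    exact ⟨fun h => ⟨⟨h.1.trans hS, h.2⟩, h.1⟩, fun h => ⟨h.2, h.1.2⟩⟩
  have h2 : ∀ f ∈ Fintype.piFinset (targets K K),
      ∑ S ∈ K.powerset, (-1 : ℤ) ^ (K.card + S.card) • (if K.image f ⊆ S then G f else 0) =
        if K.image f = K then G f else 0 := by
    intro f hf
    rw [hmem] at hf
    have : ∀ S ∈ K.powerset,
        (-1 : ℤ) ^ (K.card + S.card) • (if K.image f ⊆ S then G f else 0) =
        if K.image f ⊆ S then (-1 : ℤ) ^ K.card • (-1 : ℤ) ^ S.card • G f else 0 := by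
      intro S _
      split_ifs <;> simp [pow_add, mul_smul]
    rw [Finset.sum_congr rfl this, ← Finset.sum_filter, ← Finset.smul_sum, ← Finset.sum_smul]
    -- The alternating sum over all S between the image of f and K vanishes unless the image is all
    -- of K, that is, unless f permutes K.
    have h3 : K.powerset.filter (fun S => K.image f ⊆ S) = Finset.Icc (K.image f) K := by
      ext S
      simp [and_comm]
    rw [h3, sum_Icc_neg_one_pow_card _ _ hf.1]
    split_ifs
    · rw [smul_smul, ← pow_add, Even.neg_one_pow ⟨_, rfl⟩, one_smul]
    · simp
  rw [Finset.sum_congr rfl fun S hS => by rw [h1 S hS, Finset.smul_sum], Finset.sum_comm,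
    Finset.sum_congr rfl h2, ← Finset.sum_filter]
  symm
  refine Finset.sum_bij (fun σ _ => ⇑σ) (fun σ hσ => ?_) (fun _ _ _ _ h => DFunLike.coe_injective h)
    (fun f hf => ?_) (fun _ _ => rfl)
  · have himg := image_eq_of_mem_permsOn hσ
    rw [mem_permsOn] at hσ
    rw [Finset.mem_filter, hmem]
    exact ⟨⟨himg.le, hσ⟩, himg⟩
  · rw [Finset.mem_filter, hmem] at hf
    obtain ⟨⟨-, hf1⟩, hf2⟩ := hf
    have hsurj : Function.Surjective f := by
      intro y
      by_cases hy : y ∈ K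
      · rw [← hf2] at hy
        obtain ⟨x, -, hx⟩ := Finset.mem_image.1 hy
        exact ⟨x, hx⟩
      · exact ⟨y, hf1 y hy⟩
    exact ⟨Equiv.ofBijective f (Finite.surjective_iff_bijective.1 hsurj), mem_permsOn.2 hf1, rfl⟩

end Symmetrizer

/-! ### Polarization: symmetrizing amounts to substituting equal letters -/

section Polarization

variable {F : Type*} [Field F] {n : ℕ} {X : Type} [hX : DecidableEq X] {L : Type*} [AddCommGroup L]
  [Module F L]

theorem eval_update_of_notMem (B : L [⋀^Fin n]→ₗ[F] L) (α : X → L) (x : X) (a : L) (w : Word n X)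
    (h : w.letters.count x = 0) : eval B (Function.update α x a) w = eval B α w := by
  induction w with
  | letter y =>
    have : y ≠ x := by
      rintro rfl
      simp [Word.letters] at h
    simp [eval, this]
  | bracket w ih =>
    rw [Word.letters, Multiset.count_sum', Finset.sum_eq_zero_iff] at h
    simp only [eval]
    congr 1
    ext i
    exact ih i (h i (Finset.mem_univ i))

/-- Exactly one argument of each bracket above the single occurrence of x depends on the value of x,
and the bracket is linear in that argument. -/
theorem exists_eval_update (B : L [⋀^Fin n]→ₗ[F] L) (α : X → L) (x : X) (w : Word n X)
    (h : w.letters.count x = 1) : ∃ g : L →ₗ[F] L, ∀ a, eval B (Function.update α x a) w = g a := by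
  induction w with
  | letter y =>
    have : y = x := by
      by_contra hne
      rw [Word.letters, Multiset.count_singleton, if_neg (Ne.symm hne)] at h
      omega
    subst this
    exact ⟨LinearMap.id, fun a => by simp [eval]⟩
  | bracket w ih =>
    rw [Word.letters, Multiset.count_sum'] at h
    obtain ⟨l, -, hl⟩ : ∃ l ∈ Finset.univ, (w l).letters.count x ≠ 0 :=
      Finset.exists_ne_zero_of_sum_ne_zero (by omega)
    rw [← Finset.add_sum_erase _ _ (Finset.mem_univ l)] at h
    have h0 : ∑ i ∈ Finset.univ.erase l, (w i).letters.count x = 0 := by omega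
    obtain ⟨g, hg⟩ := ih l (by omega)
    refine ⟨B.toMultilinearMap.toLinearMap (fun i => eval B α (w i)) l ∘ₗ g, fun a => ?_⟩
    simp only [eval, LinearMap.comp_apply, ← hg, MultilinearMap.toLinearMap_apply]
    change B _ = B _
    congr 1
    ext i
    rcases eq_or_ne i l with rfl | hi
    · simp
    · rw [Function.update_of_ne hi]
      rw [Finset.sum_eq_zero_iff] at h0
      exact eval_update_of_notMem B α x a _ (h0 i (by simp [hi]))

variable [Fintype X]

theorem Word.IsBracketedPerm.count_eq_one {w : Word n X} (hw : w.IsBracketedPerm) (x : X) :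
    w.letters.count x = 1 := by
  rw [hw]
  exact Multiset.count_eq_one_of_mem Finset.univ.nodup (Finset.mem_univ x)

/-- The value of a bracketed permutation is a multilinear function of the values of its letters. -/
def evalMultilinear (B : L [⋀^Fin n]→ₗ[F] L) (w : Word n X) (hw : w.IsBracketedPerm) :
    MultilinearMap F (fun _ : X => L) L where
  toFun α := eval B α w
  map_update_add' := by
    intro inst α x a b
    obtain rfl : inst = hX := Subsingleton.elim _ _
    obtain ⟨g, hg⟩ := exists_eval_update B α x w (hw.count_eq_one x)
    simp [hg]
  map_update_smul' := by
    intro inst α x c a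
    obtain rfl : inst = hX := Subsingleton.elim _ _
    obtain ⟨g, hg⟩ := exists_eval_update B α x w (hw.count_eq_one x)
    simp [hg]

theorem eval_sum (B : L [⋀^Fin n]→ₗ[F] L) {w : Word n X} (hw : w.IsBracketedPerm)
    (A : X → Finset X) (z : X → L) :
    eval B (fun x => ∑ j ∈ A x, z j) w = ∑ f ∈ Fintype.piFinset A, eval B (z ∘ f) w :=
  (evalMultilinear B w hw).map_sum_finset (fun _ => z) A

variable [CharZero F]

/-- The letters of `K` are replaced by the sum of the letters in `S`. -/
noncomputable def collapse (F : Type*) [Field F] (n : ℕ) (K S : Finset X) (x : X) :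
    FreeFilippov F n X :=
  if x ∈ K then ∑ s ∈ S, wordClass F (.letter s) else wordClass F (.letter x)

/-- By multilinearity, replacing each letter of K by the sum of the letters in S amounts to summing
over all maps K → S; inclusion–exclusion over S keeps the permutations of K. In each term on the
right the letters of K share one value, so the counting of marked letters applies. -/
theorem symmetrizer_wordClass (K : Finset X) {w : Word n X} (hw : w.IsBracketedPerm) :
    symmetrizer (freeFilippovRep F n X) K (wordClass F w) =
      ∑ S ∈ K.powerset, (-1 : ℤ) ^ (K.card + S.card) •
        eval (freeBracket F n X) (collapse F n K S) w := by
  have h1 : ∀ S, eval (freeBracket F n X) (collapse F n K S) w =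
      ∑ f ∈ Fintype.piFinset (targets K S), wordClass F (w.map f) := by
    intro S
    have : collapse F n K S = fun x => ∑ j ∈ targets K S x, wordClass F (.letter j) := by
      ext x
      unfold collapse targets
      split_ifs <;> simp
    rw [this, eval_sum _ hw]
    refine Finset.sum_congr rfl fun f _ => ?_
    rw [← eval_freeBracket, eval_map]
  simp only [h1]
  rw [sum_powerset_sum_piFinset K fun f => wordClass F (w.map f), symmetrizer_apply]
  exact Finset.sum_congr rfl fun σ _ => freeFilippovRep_wordClass F σ w

/-- In the span of the bracketed permutations with `k` brackets, the symmetrization over more than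
`k` letters is zero. -/
theorem symmetrizer_eq_zero {k : ℕ} (hk : 1 ≤ k) (K : Finset X) (hK : k < K.card)
    {v : FreeFilippov F n X} (hv : v ∈ multilinearPart F n k X) :
    symmetrizer (freeFilippovRep F n X) K v = 0 := by
  have : multilinearPart F n k X ≤ LinearMap.ker (symmetrizer (freeFilippovRep F n X) K) := by
    refine Submodule.span_le.2 ?_
    rintro _ ⟨w, ⟨hw, hwk⟩, rfl⟩
    rw [SetLike.mem_coe, LinearMap.mem_ker, symmetrizer_wordClass K hw]
    refine Finset.sum_eq_zero fun S _ => ?_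
    rw [eval_eq_zero (freeBracket F n X) (· ∈ K) (e := ∑ s ∈ S, wordClass F (.letter s)), smul_zero]
    · intro x hx
      simp [collapse, hx]
    · rintro ⟨x, rfl, -⟩
      simp [Word.numBrackets] at hwk
      omega
    · rw [hwk, Word.countLetters, hw, Multiset.countP_eq_card_filter]
      refine hK.trans_eq ?_
      rw [← Finset.filter_val, Finset.card_val]
      congr 1
      ext
      simp
  exact this hv

end Polarization

/-! ### Erasing one letter from each bracket -/

section Reduction

variable {F : Type*} [Field F] {n : ℕ} {X Y : Type}

variable (F n) in
/-- The values of the letters in the extension of the free algebra on `Y`: the letters on which `κ`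
is defined are renamed, all the others are replaced by `(0, 1)`. -/
noncomputable def reduceLetter (κ : X → Option Y) (x : X) : FreeFilippov F (n + 1) Y × F :=
  (κ x).elim (0, 1) fun y => (wordClass F (.letter y), 0)

theorem reduceLetter_none {κ : X → Option Y} {x : X} (hx : κ x = none) :
    reduceLetter F n κ x = (0, 1) := by
  simp [reduceLetter, hx]

theorem reduceLetter_some {κ : X → Option Y} {x : X} {y : Y} (hx : κ x = some y) :
    reduceLetter F n κ x = (wordClass F (.letter y), 0) := by
  simp [reduceLetter, hx]

theorem reduceLetter_snd {κ : X → Option Y} {x : X} (hx : ¬ κ x = none) :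
    (reduceLetter F n κ x).2 = 0 := by
  obtain ⟨y, hy⟩ := Option.ne_none_iff_exists'.1 hx
  rw [reduceLetter_some hy]

variable [CharZero F]

variable (F n) in
/-- The evaluation homomorphism to the extension of the free algebra on `Y`. -/
noncomputable def reduceFull (κ : X → Option Y) :
    FreeFilippov F (n + 2) X →ₗ[F] FreeFilippov F (n + 1) Y × F :=
  lift (isFilippov_freeBracket F n Y).extend (reduceLetter F n κ)

variable (F n) in
/-- Deleting from each bracket a letter on which `κ` is not defined. -/
noncomputable def reduce (κ : X → Option Y) :
    FreeFilippov F (n + 2) X →ₗ[F] FreeFilippov F (n + 1) Y :=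
  LinearMap.fst F _ F ∘ₗ reduceFull F n κ

theorem reduce_wordClass (κ : X → Option Y) (w : Word (n + 2) X) :
    reduce F n κ (wordClass F w) =
      (eval (extend (freeBracket F (n + 1) Y)) (reduceLetter F n κ) w).1 := by
  simp [reduce, reduceFull]

/-- Each term of the extended bracket removes one argument and survives only if that argument is an
erased letter. Each bracket thus loses one letter and becomes a bracket of arity one less, so the
number of brackets is preserved. -/
theorem eval_extend_fst_mem (κ : X → Option Y) (w : Word (n + 2) X) :
    (eval (extend (freeBracket F (n + 1) Y)) (reduceLetter F n κ) w).1 ∈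
      Submodule.span F (wordClass F ''
        {u | u.letters = w.letters.filterMap κ ∧ u.numBrackets = w.numBrackets}) := by
  induction w with
  | letter x =>
    rcases h : κ x with _ | y
    · simp [eval, reduceLetter_none h]
    · rw [eval, reduceLetter_some h]
      refine Submodule.subset_span ⟨.letter y, ⟨?_, rfl⟩, rfl⟩
      simp only [Word.letters]
      rw [← Multiset.cons_zero, ← Multiset.cons_zero, Multiset.filterMap_cons_some _ _ _ h,
        Multiset.filterMap_zero]
  | bracket w ih =>
    rw [eval, extend_apply, extendForm_apply]
    dsimp only
    refine Submodule.sum_mem _ fun l _ => ?_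
    by_cases hl : (w l).IsLetterOf fun x => κ x = none
    · obtain ⟨x, hx, hκ⟩ := hl
      rw [← Int.cast_smul_eq_zsmul F]
      refine Submodule.smul_mem _ _ (Submodule.smul_mem _ _ ?_)
      refine MultilinearMap.map_mem_of_mem_span (freeBracket F (n + 1) Y).toMultilinearMap
        (fun j => wordClass F '' {u | u.letters = (w (l.succAbove j)).letters.filterMap κ ∧
          u.numBrackets = (w (l.succAbove j)).numBrackets}) _ (fun v hv => ?_) _
        fun j => ih (l.succAbove j)
      choose u hu huv using hv
      obtain rfl : (fun j => wordClass F (u j)) = v := funext huv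
      refine Submodule.subset_span ⟨.bracket u, ⟨?_, ?_⟩, (freeBracket_wordClass u).symm⟩
      · have hsum : ∀ (s : Finset (Fin (n + 2))),
            Multiset.filterMap κ (∑ i ∈ s, (w i).letters) =
              ∑ i ∈ s, Multiset.filterMap κ (w i).letters := by
          intro s
          induction s using Finset.induction_on with
          | empty => simp
          | insert a s ha ih => rw [Finset.sum_insert ha, Multiset.filterMap_add, ih,
              Finset.sum_insert ha]
        rw [Word.letters, Word.letters, hsum, Fin.sum_univ_succAbove _ l, hx, Word.letters,
          ← Multiset.cons_zero, Multiset.filterMap_cons_none _ _ hκ, Multiset.filterMap_zero,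
          zero_add]
        exact Finset.sum_congr rfl fun j _ => (hu j).1
      · rw [Word.numBrackets, Word.numBrackets, Fin.sum_univ_succAbove _ l, hx, Word.numBrackets,
          zero_add]
        congr 1
        exact Finset.sum_congr rfl fun j _ => (hu j).2
    -- An argument other than an erased letter has scalar component zero, and its term vanishes.
    · rw [eval_extend_snd _ (fun x hx => reduceLetter_snd hx) hl]
      simp

section Partition

variable {Z : Type}

/-- The partial map to `Y` for a type partitioned in two parts. -/
def leftPart (θ : Y ⊕ Z ≃ X) (x : X) : Option Y := (θ.symm x).getLeft?

@[simp]
theorem leftPart_inl (θ : Y ⊕ Z ≃ X) (y : Y) : leftPart θ (θ (.inl y)) = some y := by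
  simp [leftPart]

@[simp]
theorem leftPart_inr (θ : Y ⊕ Z ≃ X) (z : Z) : leftPart θ (θ (.inr z)) = none := by
  simp [leftPart]

theorem leftPart_eq_some {θ : Y ⊕ Z ≃ X} {x : X} {y : Y} :
    leftPart θ x = some y ↔ x = θ (.inl y) := by
  rw [leftPart, Sum.getLeft?_eq_some_iff, Equiv.symm_apply_eq]

/-- A multiset can be partitioned with prescribed cardinalities. -/
theorem exists_multiset_partition {m : ℕ} (f : Fin m → ℕ) (s : Multiset Z)
    (hs : s.card = ∑ i, f i) : ∃ g : Fin m → Multiset Z, (∀ i, (g i).card = f i) ∧ ∑ i, g i = s := by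
  induction m generalizing s with
  | zero => exact ⟨fun i => i.elim0, fun i => i.elim0, by simpa [eq_comm] using hs⟩
  | succ m ih =>
    rw [Fin.sum_univ_succ] at hs
    obtain ⟨t, ht⟩ := Multiset.card_pos_iff_exists_mem.1
      (by rw [Multiset.card_powersetCard]; exact Nat.choose_pos (by omega) :
        0 < (s.powersetCard (f 0)).card)
    obtain ⟨ht, htc⟩ := Multiset.mem_powersetCard.1 ht
    obtain ⟨u, rfl⟩ := Multiset.le_iff_exists_add.1 ht
    rw [Multiset.card_add] at hs
    obtain ⟨g, hg, hgs⟩ := ih (fun i => f i.succ) u (by omega)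
    refine ⟨Fin.cons t g, fun i => ?_, ?_⟩
    · refine Fin.cases ?_ (fun j => ?_) i
      · simpa using htc
      · simpa using hg j
    · rw [Fin.sum_univ_succ]
      simp [hgs]

/-- One letter of Z is placed in front of each bracket of u. This uses as many letters as there are
brackets, and erasing them recovers u; hence erasing is surjective. -/
theorem exists_word_reduce (u : Word (n + 1) Y) (s : Multiset Z) (hs : s.card = u.numBrackets) :
    ∃ w : Word (n + 2) (Y ⊕ Z), w.letters = u.letters.map .inl + s.map .inr ∧
      w.numBrackets = u.numBrackets ∧
      eval (extend (freeBracket F (n + 1) Y)) (reduceLetter F n Sum.getLeft?) w =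
        (wordClass F u, 0) := by
  induction u generalizing s with
  | letter y =>
    refine ⟨.letter (.inl y), ?_, rfl, ?_⟩
    · rw [Word.numBrackets, Multiset.card_eq_zero] at hs
      simp [Word.letters, hs]
    · rw [eval, reduceLetter_some (κ := Sum.getLeft?) (y := y) rfl]
  | bracket u ih =>
    rw [Word.numBrackets] at hs
    obtain ⟨z, hz⟩ := Multiset.card_pos_iff_exists_mem.1 (by omega : 0 < s.card)
    obtain ⟨t, rfl⟩ := Multiset.exists_cons_of_mem hz
    rw [Multiset.card_cons] at hs
    -- One letter z goes to the outer bracket; the others are distributed so that each argument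
    -- receives as many as it has brackets.
    obtain ⟨g, hg, rfl⟩ := exists_multiset_partition (fun i => (u i).numBrackets) t (by omega)
    choose w hw1 hw2 hw3 using fun i => ih i (g i) (hg i)
    refine ⟨.bracket (Fin.cons (.letter (.inr z)) w), ?_, ?_, ?_⟩
    · have h1 : ∀ {Z' : Type} (f : Z → Z'), Multiset.map f (∑ i, g i) = ∑ i, (g i).map f :=
        fun f => map_sum (Multiset.mapAddMonoidHom f) _ _
      have h2 : Multiset.map (Sum.inl : Y → Y ⊕ Z) (∑ i, (u i).letters) =
        ∑ i, (u i).letters.map Sum.inl := map_sum (Multiset.mapAddMonoidHom _) _ _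
      rw [Word.letters, Fin.sum_univ_succ]
      simp only [Fin.cons_zero, Fin.cons_succ, hw1, Finset.sum_add_distrib]
      rw [← h1, ← h2, Multiset.map_cons, Word.letters, Word.letters, add_left_comm,
        Multiset.singleton_add]
    · simp [Word.numBrackets, Fin.sum_univ_succ, hw2]
    · have hz2 : reduceLetter F n (Y := Y) Sum.getLeft? (Sum.inr z) = (0, 1) :=
        reduceLetter_none rfl
      rw [eval, extend_of_single _ _ 0]
      · simp [hw3, freeBracket_wordClass]
      · simp [eval, hz2]
      · intro i hi
        obtain ⟨j, rfl⟩ := Fin.exists_succ_eq.2 hi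
        simp [hw3]

variable [Fintype Z]

/-- The letters forming the second part. -/
def rightLetters (θ : Y ⊕ Z ≃ X) : Finset X :=
  Finset.univ.map ((Function.Embedding.inr).trans θ.toEmbedding)

theorem mem_rightLetters {θ : Y ⊕ Z ≃ X} {x : X} :
    x ∈ rightLetters θ ↔ leftPart θ x = none := by
  obtain ⟨a, rfl⟩ := θ.surjective x
  rcases a with y | z <;> simp [rightLetters]

theorem card_rightLetters (θ : Y ⊕ Z ≃ X) : (rightLetters θ).card = Fintype.card Z := by
  simp [rightLetters]

variable [Fintype X] [Fintype Y]

omit [Fintype Z] in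
theorem filterMap_leftPart_univ (θ : Y ⊕ Z ≃ X) :
    (Finset.univ : Finset X).val.filterMap (leftPart θ) = (Finset.univ : Finset Y).val := by
  have hnd : ((Finset.univ : Finset X).val.filterMap (leftPart θ)).Nodup := by
    refine Multiset.Nodup.filterMap (leftPart θ) (fun a a' y h h' => ?_) Finset.univ.nodup
    rw [Option.mem_def, leftPart_eq_some] at h h'
    rw [h, h']
  refine (Multiset.Nodup.ext hnd Finset.univ.nodup).2 fun y => ?_
  simp only [Multiset.mem_filterMap, Finset.mem_val, Finset.mem_univ, true_and, iff_true]
  exact ⟨_, leftPart_inl θ y⟩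

omit [Fintype Z] in
theorem reduce_mem (θ : Y ⊕ Z ≃ X) (k : ℕ) {v : FreeFilippov F (n + 2) X}
    (hv : v ∈ multilinearPart F (n + 2) k X) :
    reduce F n (leftPart θ) v ∈ multilinearPart F (n + 1) k Y := by
  have : multilinearPart F (n + 2) k X ≤
      (multilinearPart F (n + 1) k Y).comap (reduce F n (leftPart θ)) := by
    refine Submodule.span_le.2 ?_
    rintro _ ⟨w, ⟨hw, hwk⟩, rfl⟩
    rw [SetLike.mem_coe, Submodule.mem_comap, reduce_wordClass]
    have := eval_extend_fst_mem (F := F) (leftPart θ) w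
    rwa [hw, filterMap_leftPart_univ, hwk] at this
  exact this hv

theorem exists_reduce_eq (θ : Y ⊕ Z ≃ X) {v : FreeFilippov F (n + 1) Y}
    (hv : v ∈ multilinearPart F (n + 1) (Fintype.card Z) Y) :
    ∃ r ∈ multilinearPart F (n + 2) (Fintype.card Z) X, reduce F n (leftPart θ) r = v := by
  have : multilinearPart F (n + 1) (Fintype.card Z) Y ≤
      (multilinearPart F (n + 2) (Fintype.card Z) X).map (reduce F n (leftPart θ)) := by
    refine Submodule.span_le.2 ?_
    rintro _ ⟨u, ⟨hu, huk⟩, rfl⟩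
    obtain ⟨w, hw1, hw2, hw3⟩ := exists_word_reduce (F := F) u (Finset.univ : Finset Z).val
      (by rw [huk]; rfl)
    refine ⟨wordClass F (w.map θ), Submodule.subset_span ⟨_, ⟨?_, ?_⟩, rfl⟩, ?_⟩
    · rw [Word.IsBracketedPerm, Word.letters_map, hw1, hu]
      have h1 : Multiset.map Sum.inl (Finset.univ : Finset Y).val +
          Multiset.map Sum.inr (Finset.univ : Finset Z).val =
          (Finset.univ : Finset (Y ⊕ Z)).val := rfl
      rw [h1]
      exact congrArg Finset.val (Finset.map_univ_equiv θ)
    · rw [Word.numBrackets_map, hw2, huk]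
    · rw [reduce_wordClass, eval_map,
        show reduceLetter F n (leftPart θ) ∘ θ = reduceLetter F n Sum.getLeft? by
          ext x : 1
          simp [reduceLetter, leftPart], hw3]
  exact this hv

variable [DecidableEq X]

variable (F n) in
/-- Inserting all letters of the second part in all possible ways. -/
noncomputable def insertLetters (θ : Y ⊕ Z ≃ X) :
    FreeFilippov F (n + 1) Y →ₗ[F] FreeFilippov F (n + 2) X :=
  ∑ S ∈ (rightLetters θ).powerset, (-1 : ℤ) ^ ((rightLetters θ).card + S.card) •
    lift ((isFilippov_freeBracket F (n + 1) X).curryLeft (∑ s ∈ S, wordClass F (.letter s)))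
      fun y => wordClass F (.letter (θ (.inl y)))

omit [Fintype Y] in
-- A multilinear word with |Z| brackets contains as many erased letters as brackets, which is the
-- boundary case of `eval_eq_eval_extend`. Applying it with e the sum of the letters in S identifies
-- the two sides term by term over S. Consequently the symmetrization of v depends only on the
-- reduction of v.
theorem insertLetters_reduce (θ : Y ⊕ Z ≃ X) (hZ : 1 ≤ Fintype.card Z)
    {v : FreeFilippov F (n + 2) X} (hv : v ∈ multilinearPart F (n + 2) (Fintype.card Z) X) :
    insertLetters F n θ (reduce F n (leftPart θ) v) =
      symmetrizer (freeFilippovRep F (n + 2) X) (rightLetters θ) v := by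
  have : multilinearPart F (n + 2) (Fintype.card Z) X ≤
      LinearMap.eqLocus (insertLetters F n θ ∘ₗ reduce F n (leftPart θ))
        (symmetrizer (freeFilippovRep F (n + 2) X) (rightLetters θ)) := by
    refine Submodule.span_le.2 ?_
    rintro _ ⟨w, ⟨hw, hwk⟩, rfl⟩
    rw [SetLike.mem_coe, LinearMap.mem_eqLocus, symmetrizer_wordClass _ hw, LinearMap.comp_apply,
      reduce_wordClass, insertLetters, LinearMap.sum_apply]
    refine Finset.sum_congr rfl fun S _ => ?_
    rw [LinearMap.smul_apply]
    congr 1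
    have hcount : w.countLetters (· ∈ rightLetters θ) = Fintype.card Z := by
      rw [Word.countLetters, hw, Multiset.countP_eq_card_filter, ← Finset.filter_val,
        Finset.card_val, ← card_rightLetters θ]
      congr 1
      ext
      simp
    rw [eval_eq_eval_extend (freeBracket F (n + 2) X) (freeBracket F (n + 1) Y)
      (∑ s ∈ S, wordClass F (.letter s))
      (lift ((isFilippov_freeBracket F (n + 1) X).curryLeft (∑ s ∈ S, wordClass F (.letter s)))
        fun y => wordClass F (.letter (θ (.inl y))))
      (fun x => lift_freeBracket _ _ x) (p := (· ∈ rightLetters θ)) (α := reduceLetter F n (leftPart θ))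
      (fun x hx => reduceLetter_none (mem_rightLetters.1 hx))
      (fun x hx => by simp [collapse, hx])
      (fun x hx => reduceLetter_snd fun h => hx (mem_rightLetters.2 h))
      (fun x hx => ?_) w (by rw [hwk, hcount]), eval_extend_snd (p := (· ∈ rightLetters θ)),
      zero_smul, add_zero]
    · exact fun x hx => reduceLetter_snd fun h => hx (mem_rightLetters.2 h)
    · rintro ⟨x, rfl, -⟩
      simp [Word.numBrackets] at hwk
      omega
    · obtain ⟨y, hy⟩ := Option.ne_none_iff_exists'.1 fun h => hx (mem_rightLetters.2 h)
      rw [reduceLetter_some hy, lift_wordClass, collapse, if_neg hx, eval, leftPart_eq_some.1 hy]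
  exact this hv

end Partition

/-- The permutation τ acts on the extended algebra as the homomorphism τ × id, and the hypothesis on
κ says that it carries the value of the letter x to that of σ x. -/
theorem reduce_freeFilippovRep {κ : X → Option Y} {σ : Equiv.Perm X} {τ : Equiv.Perm Y}
    (h : ∀ x, κ (σ x) = (κ x).map τ) (v : FreeFilippov F (n + 2) X) :
    reduce F n κ (freeFilippovRep F (n + 2) X σ v) =
      freeFilippovRep F (n + 1) Y τ (reduce F n κ v) := by
  have : (⊤ : Submodule F (FreeFilippov F (n + 2) X)) ≤
      LinearMap.eqLocus (reduce F n κ ∘ₗ freeFilippovRep F (n + 2) X σ)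
        (freeFilippovRep F (n + 1) Y τ ∘ₗ reduce F n κ) := by
    rw [← span_wordClass]
    refine Submodule.span_le.2 ?_
    rintro _ ⟨w, rfl⟩
    rw [SetLike.mem_coe, LinearMap.mem_eqLocus, LinearMap.comp_apply, LinearMap.comp_apply,
      freeFilippovRep_wordClass, reduce_wordClass, reduce_wordClass, eval_map]
    have := map_eval (B := extend (freeBracket F (n + 1) Y)) (B₁ := extend (freeBracket F (n + 1) Y))
      (φ := (freeFilippovRep F (n + 1) Y τ).prodMap LinearMap.id) (fun z => ?_)
      (reduceLetter F n κ) w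
    · rw [show reduceLetter F n κ ∘ σ = fun x => ((freeFilippovRep F (n + 1) Y τ).prodMap
        LinearMap.id) (reduceLetter F n κ x) from ?_, ← this]
      · rfl
      · ext x : 1
        rcases hx : κ x with _ | y
        · rw [Function.comp_apply, reduceLetter_none hx, reduceLetter_none (by rw [h, hx]; rfl)]
          simp
        · rw [Function.comp_apply, reduceLetter_some hx,
            reduceLetter_some (y := τ y) (by rw [h, hx]; rfl)]
          simp [freeFilippovRep_wordClass, Word.map]
    · rw [extend_apply, extend_apply]
      ext
      · simp only [extendForm_apply, LinearMap.prodMap_apply, map_sum, map_zsmul, map_smul,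
          freeFilippovRep_freeBracket, LinearMap.id_apply]
      · simp
  exact this (x := v) trivial

theorem reduce_eq_of_leftPart {κ : X → Option Y} {σ : Equiv.Perm X} (h : ∀ x, κ (σ x) = κ x)
    (v : FreeFilippov F (n + 2) X) :
    reduce F n κ (freeFilippovRep F (n + 2) X σ v) = reduce F n κ v := by
  rw [reduce_freeFilippovRep (τ := 1) (fun x => by simp [h]), map_one]
  rfl

end Reduction

/-! ### Left-normed brackets span the free algebra -/

section Comb

variable {n : ℕ} {X : Type}

/-- Left-normed bracketings. -/
inductive IsComb : Word (n + 1) X → Prop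
  | letter (x : X) : IsComb (.letter x)
  | bracket (u : Word (n + 1) X) (hu : IsComb u) (y : Fin n → X) :
      IsComb (.bracket (Fin.cons u fun i => .letter (y i)))

theorem IsComb.eq_letter {w : Word (n + 1) X} (hw : IsComb w) (h : w.numBrackets = 0) :
    ∃ x, w = .letter x := by
  cases hw with
  | letter x => exact ⟨x, rfl⟩
  | bracket u hu y => simp [Word.numBrackets] at h

variable (F : Type*) [Field F]

/-- The span of the left-normed bracketings with given letters and number of brackets. -/
noncomputable def combSpan (s : Multiset X) (j : ℕ) : Submodule F (FreeFilippov F (n + 1) X) :=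
  Submodule.span F (wordClass F '' {w | IsComb w ∧ w.letters = s ∧ w.numBrackets = j})

variable {F}

theorem IsComb.mem_combSpan {w : Word (n + 1) X} (hw : IsComb w) :
    wordClass F w ∈ combSpan F w.letters w.numBrackets :=
  Submodule.subset_span ⟨w, ⟨hw, rfl, rfl⟩, rfl⟩

variable [CharZero F]

theorem freeBracket_cons_letters_mem {s : Multiset X} {j : ℕ} {u : FreeFilippov F (n + 1) X}
    (hu : u ∈ combSpan F s j) (y : Fin n → X) :
    freeBracket F (n + 1) X (Fin.cons u fun i => wordClass F (.letter (y i))) ∈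
      combSpan F (s + ∑ i, {y i}) (1 + j) := by
  rw [← adj_apply]
  have : combSpan F s j ≤ (combSpan F (s + ∑ i, {y i}) (1 + j)).comap
      (adj (freeBracket F (n + 1) X) fun i => wordClass F (.letter (y i))) := by
    refine Submodule.span_le.2 ?_
    rintro _ ⟨w, ⟨hw, rfl, rfl⟩, rfl⟩
    have := (IsComb.bracket w hw y).mem_combSpan (F := F)
    rw [← freeBracket_wordClass] at this
    simp only [Word.letters, Word.numBrackets, Fin.sum_univ_succ, Fin.cons_zero, Fin.cons_succ,
      Finset.sum_const_zero, add_zero] at this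
    rw [SetLike.mem_coe, Submodule.mem_comap, adj_apply]
    convert this using 2
    ext i : 1
    refine Fin.cases ?_ (fun j => ?_) i <;> simp
  exact this hu

/-- Brackets of left-normed bracketings with `T` brackets in total are combinations of left-normed
bracketings. -/
def CombClosed (F : Type*) [Field F] (n : ℕ) (X : Type) (T : ℕ) : Prop :=
  ∀ w : Fin (n + 1) → Word (n + 1) X, (∀ i, IsComb (w i)) → ∑ i, (w i).numBrackets = T →
    wordClass F (.bracket w) ∈ combSpan F (∑ i, (w i).letters) (1 + T)

theorem CombClosed.freeBracket_mem {T : ℕ} (hT : CombClosed F n X T)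
    {v : Fin (n + 1) → FreeFilippov F (n + 1) X} {s : Fin (n + 1) → Multiset X}
    {j : Fin (n + 1) → ℕ} (hv : ∀ i, v i ∈ combSpan F (s i) (j i)) (hj : ∑ i, j i = T) :
    freeBracket F (n + 1) X v ∈ combSpan F (∑ i, s i) (1 + T) := by
  refine MultilinearMap.map_mem_of_mem_span (freeBracket F (n + 1) X).toMultilinearMap
    (fun i => wordClass F '' {w | IsComb w ∧ w.letters = s i ∧ w.numBrackets = j i}) _
    (fun v hv => ?_) v hv
  choose w hw hwv using hv
  obtain rfl : (fun i => wordClass F (w i)) = v := funext hwv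
  have h := hT w (fun i => (hw i).1) (by rw [← hj]; exact Finset.sum_congr rfl fun i _ => (hw i).2.2)
  rw [← freeBracket_wordClass, Finset.sum_congr rfl fun i _ => (hw i).2.1] at h
  exact h

omit [CharZero F] in
theorem wordClass_bracket_mem_of_swap (P : Submodule F (FreeFilippov F (n + 1) X))
    (w : Fin (n + 1) → Word (n + 1) X) (σ : Equiv.Perm (Fin (n + 1)))
    (h : wordClass F (.bracket (w ∘ σ)) ∈ P) : wordClass F (.bracket w) ∈ P := by
  rw [wordClass_bracket_comp_perm w σ]
  exact P.smul_mem _ h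

/-- The case that all but two of the arguments are letters; the first argument has `j` brackets. -/
def CombClosedTwo (F : Type*) [Field F] (n : ℕ) (X : Type) (T j : ℕ) : Prop :=
  ∀ w : Fin (n + 1) → Word (n + 1) X, (∀ i, IsComb (w i)) → ∑ i, (w i).numBrackets = T →
    (w 0).numBrackets = j → (∃ l, ∀ i, i ≠ 0 → i ≠ l → ∃ x, w i = .letter x) →
    wordClass F (.bracket w) ∈ combSpan F (∑ i, (w i).letters) (1 + T)

omit [CharZero F] in
-- Antisymmetry moves the only possibly composite argument to the front, and the bracket becomes
-- left-normed.
theorem wordClass_mem_combSpan_of_letters {T : ℕ} {w : Fin (n + 1) → Word (n + 1) X}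
    (hw : ∀ i, IsComb (w i)) (hT : ∑ i, (w i).numBrackets = T) (l : Fin (n + 1))
    (h : ∀ i, i ≠ l → ∃ x, w i = .letter x) :
    wordClass F (.bracket w) ∈ combSpan F (∑ i, (w i).letters) (1 + T) := by
  refine wordClass_bracket_mem_of_swap _ w (Equiv.swap 0 l) ?_
  have h2 : ∀ i : Fin n, ∃ x, w (Equiv.swap 0 l i.succ) = .letter x := fun i => h _ fun h => by
    rw [Equiv.swap_apply_eq_iff, Equiv.swap_apply_right] at h
    exact Fin.succ_ne_zero _ h
  choose y hy using h2
  have hws : w ∘ Equiv.swap 0 l = Fin.cons (w l) fun i => .letter (y i) := by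
    ext i : 1
    refine Fin.cases ?_ (fun j => ?_) i
    · simp
    · simp [hy]
  have hsum : ∀ {M : Type} [AddCommMonoid M] (f : Word (n + 1) X → M),
      ∑ i, f (w i) = f (w l) + ∑ i, f (.letter (y i)) := by
    intro M _ f
    rw [← Equiv.sum_comp (Equiv.swap 0 l), Fin.sum_univ_succ]
    simp [hy]
  have h3 := (IsComb.bracket _ (hw l) y).mem_combSpan (F := F)
  rw [hws, hsum, ← hT, hsum]
  simpa [Word.letters, Word.numBrackets, Fin.sum_univ_succ] using h3

/-- Write the first argument as [u, m] with letters m. The Jacobi identity distributes the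
bracketing with the other arguments over u and the letters m i; both kinds of summands are simpler,
in different measures. -/
theorem bracket_bracket_mem_combSpan {T : ℕ} (ih : ∀ T' < T, CombClosed F n X T')
    {w : Fin (n + 1) → Word (n + 1) X} (hw : ∀ i, IsComb (w i))
    (hT : ∑ i, (w i).numBrackets = T) {u : Word (n + 1) X} (hu : IsComb u) (m : Fin n → X)
    (h0 : w 0 = .bracket (Fin.cons u fun i => .letter (m i)))
    (h2 : CombClosedTwo F n X T u.numBrackets) :
    wordClass F (.bracket w) ∈ combSpan F (∑ i, (w i).letters) (1 + T) := by
  have hcons : (fun i => wordClass F (w i)) =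
      Fin.cons (freeBracket F (n + 1) X (Fin.cons (wordClass F u) fun i => wordClass F (.letter (m i))))
        fun i => wordClass F (w i.succ) := by
    ext i : 1
    refine Fin.cases ?_ (fun j => ?_) i
    · rw [h0, ← freeBracket_wordClass, Fin.cons_zero]
      congr 1
      ext i : 1
      refine Fin.cases ?_ (fun j => ?_) i <;> simp
    · simp
  have hbr : (w 0).numBrackets = 1 + u.numBrackets := by
    simp [h0, Word.numBrackets, Fin.sum_univ_succ]
  have hlet : (w 0).letters = u.letters + ∑ i, {m i} := by
    simp [h0, Word.letters, Fin.sum_univ_succ]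
  rw [Fin.sum_univ_succ] at hT
  rw [← freeBracket_wordClass, hcons, isFilippov_freeBracket F n X]
  refine Submodule.sum_mem _ fun i _ => ?_
  refine Fin.cases ?_ (fun i => ?_) i
  -- Here u is bracketed with the remaining arguments, one bracket fewer in total. Induction on T
  -- makes the result left-normed, and bracketing with the letters m keeps it so.
  · rw [Fin.update_cons_zero, Fin.cons_zero]
    have h3 := (ih (T - 1) (by omega)).freeBracket_mem
      (v := Fin.cons (wordClass F u) fun i => wordClass F (w i.succ))
      (s := Fin.cons u.letters fun i => (w i.succ).letters)
      (j := Fin.cons u.numBrackets fun i => (w i.succ).numBrackets) (fun i => ?_) ?_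
    · have h4 := freeBracket_cons_letters_mem h3 m
      rw [Fin.sum_univ_succ, hlet]
      convert h4 using 2
      · simp only [Fin.sum_univ_succ, Fin.cons_zero, Fin.cons_succ]
        abel
      · omega
    · refine Fin.cases ?_ (fun j => ?_) i
      · exact hu.mem_combSpan
      · exact (hw _).mem_combSpan
    · rw [Fin.sum_univ_succ]
      simp only [Fin.cons_zero, Fin.cons_succ]
      omega
  -- Here [m i, …] becomes left-normed by induction on T. The resulting bracket has only letters
  -- besides u and this element; T is unchanged, but the first argument u has one bracket fewer than
  -- `w 0`.
  · rw [Fin.cons_succ]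
    have h3 := (ih (T - (1 + u.numBrackets)) (by omega)).freeBracket_mem
      (v := Fin.cons (wordClass F (.letter (m i))) fun i => wordClass F (w i.succ))
      (s := Fin.cons {m i} fun i => (w i.succ).letters)
      (j := Fin.cons 0 fun i => (w i.succ).numBrackets) (fun i => ?_) ?_
    · revert h3
      generalize freeBracket F (n + 1) X (Fin.cons (wordClass F (.letter (m i)))
        fun i => wordClass F (w i.succ)) = z
      intro h3
      change (freeBracket F (n + 1) X).toMultilinearMap.toLinearMap _ i.succ z ∈ _
      rw [← Submodule.mem_comap]
      refine (Submodule.span_le.2 ?_ :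
        combSpan F _ _ ≤ Submodule.comap _ _) h3
      rintro _ ⟨c, ⟨hc, hcl, hcb⟩, rfl⟩
      rw [SetLike.mem_coe, Submodule.mem_comap, MultilinearMap.toLinearMap_apply]
      have hv : (Function.update (Fin.cons (wordClass F u) fun i => wordClass F (.letter (m i)))
          i.succ (wordClass F c) : Fin (n + 1) → FreeFilippov F (n + 1) X) =
          fun j => wordClass F ((Fin.cons u (Function.update (fun i => .letter (m i)) i c) :
            Fin (n + 1) → Word (n + 1) X) j) := by
        ext j : 1
        refine Fin.cases ?_ (fun j => ?_) j
        · rw [Function.update_of_ne (Fin.succ_ne_zero i).symm]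
          rfl
        · rcases eq_or_ne j i with rfl | hj
          · simp
          · rw [Function.update_of_ne (fun h => hj (Fin.succ_injective _ h))]
            simp [hj]
      change freeBracket F (n + 1) X _ ∈ _
      rw [hv, freeBracket_wordClass]
      have hne : ∀ (M : Type) [AddCommMonoid M] (f : Word (n + 1) X → M),
          ∑ j, f ((Function.update (fun i => .letter (m i)) i c : Fin n → Word (n + 1) X) j) =
            f c + ∑ j ∈ Finset.univ.erase i, f (.letter (m j)) := by
        intro M _ f
        rw [← Finset.add_sum_erase _ _ (Finset.mem_univ i), Function.update_self]
        congr 1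
        refine Finset.sum_congr rfl fun j hj => ?_
        rw [Function.update_of_ne (Finset.ne_of_mem_erase hj)]
      have h4 := h2 (Fin.cons u (Function.update (fun i => .letter (m i)) i c)) (fun j => ?_) ?_
        (by simp) ⟨i.succ, fun j hj hji => ?_⟩
      · convert h4 using 2
        rw [Fin.sum_univ_succ, Fin.sum_univ_succ, hlet, Fin.cons_zero]
        simp only [Fin.cons_succ]
        rw [hne, hcl, Fin.sum_univ_succ, ← Finset.add_sum_erase Finset.univ (fun i => {m i})
          (Finset.mem_univ i)]
        simp only [Fin.cons_zero, Fin.cons_succ, Word.letters]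
        abel
      · refine Fin.cases ?_ (fun j => ?_) j
        · simpa using hu
        · rcases eq_or_ne j i with rfl | hj
          · simpa using hc
          · simpa [hj] using IsComb.letter _
      · rw [Fin.sum_univ_succ]
        simp only [Fin.cons_zero, Fin.cons_succ]
        rw [hne ℕ Word.numBrackets, hcb]
        simp only [Word.numBrackets, Finset.sum_const_zero]
        omega
      · obtain ⟨j, rfl⟩ := Fin.exists_succ_eq.2 hj
        have : j ≠ i := fun h => hji (h ▸ rfl)
        exact ⟨m j, by simp [this]⟩
    · refine Fin.cases ?_ (fun j => ?_) i
      · exact (IsComb.letter _).mem_combSpan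
      · exact (hw _).mem_combSpan
    · rw [Fin.sum_univ_succ]
      simp only [Fin.cons_zero, Fin.cons_succ]
      omega

/-- Induction on the number of brackets of the first argument. When it is a letter, at most one
argument is composite. -/
theorem combClosedTwo {T : ℕ} (ih : ∀ T' < T, CombClosed F n X T') (j : ℕ) :
    CombClosedTwo F n X T j := by
  induction j with
  | zero =>
    rintro w hw hT h0 ⟨l, hl⟩
    refine wordClass_mem_combSpan_of_letters hw hT l fun i hi => ?_
    rcases eq_or_ne i 0 with rfl | hi0
    · exact (hw 0).eq_letter h0
    · exact hl i hi0 hi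
  | succ j ihj =>
    rintro w hw hT h0 -
    have h1 := hw 0
    generalize hw0 : w 0 = w0 at h1 h0
    cases h1 with
    | letter x => simp [Word.numBrackets] at h0
    | bracket u hu m =>
      refine bracket_bracket_mem_combSpan ih hw hT hu m hw0 ?_
      have : u.numBrackets = j := by
        simp [Word.numBrackets, Fin.sum_univ_succ] at h0
        omega
      rwa [this]

/-- Strong induction on the number of brackets inside the arguments: a composite argument is moved
to the front and the Jacobi identity is applied there. -/
theorem combClosed (T : ℕ) : CombClosed F n X T := by
  induction T using Nat.strong_induction_on with
  | _ T ih =>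
    intro w hw hT
    by_cases h : ∃ l, ∀ x, w l ≠ .letter x
    · obtain ⟨l, hl⟩ := h
      refine wordClass_bracket_mem_of_swap _ w (Equiv.swap 0 l) ?_
      have h1 := hw l
      generalize hw0 : w l = w0 at h1 hl
      cases h1 with
      | letter x => exact absurd rfl (hl x)
      | bracket u hu m =>
        rw [← Equiv.sum_comp (Equiv.swap 0 l)] at hT ⊢
        exact bracket_bracket_mem_combSpan ih (fun i => hw _) hT hu m (by simpa using hw0)
          (combClosedTwo ih _)
    · push Not at h
      exact wordClass_mem_combSpan_of_letters hw hT 0 fun i _ => h i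

theorem wordClass_mem_combSpan (w : Word (n + 1) X) :
    wordClass F w ∈ combSpan F w.letters w.numBrackets := by
  induction w with
  | letter x => exact (IsComb.letter x).mem_combSpan
  | bracket w ih =>
    rw [← freeBracket_wordClass]
    exact (combClosed _).freeBracket_mem ih rfl

end Comb

/-! ### Exchange relations between adjacent rows of a left-normed bracket -/

section CombValue

variable {F : Type*} [Field F] {n : ℕ} {L : Type*} [AddCommGroup L] [Module F L]

/-- The left-normed bracket `[⋯[[a₀, a₀₁, …, a₀ₙ], a₁₁, …, a₁ₙ], ⋯]` with `j` brackets. -/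
def combValue (B : L [⋀^Fin (n + 1)]→ₗ[F] L) (a : Option (ℕ × Fin n) → L) : ℕ → L
  | 0 => a none
  | j + 1 => B (Fin.cons (combValue B a j) fun i => a (some (j, i)))

/-- Rows from j on act by the operators [·, row], linearly in the value of the inner bracket. A
relation between adjacent rows can thus be checked where it occurs and carried outward. -/
theorem exists_combValue_eq (B : L [⋀^Fin (n + 1)]→ₗ[F] L) (a : Option (ℕ × Fin n) → L) {j k : ℕ}
    (hjk : j ≤ k) : ∃ Φ : L →ₗ[F] L, ∀ b : Option (ℕ × Fin n) → L,
      (∀ j' i, j ≤ j' → j' < k → b (some (j', i)) = a (some (j', i))) →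
        combValue B b k = Φ (combValue B b j) := by
  induction k, hjk using Nat.le_induction with
  | base => exact ⟨LinearMap.id, fun b _ => rfl⟩
  | succ k hjk ih =>
    obtain ⟨Φ, hΦ⟩ := ih
    refine ⟨adj B (fun i => a (some (k, i))) ∘ₗ Φ, fun b hb => ?_⟩
    rw [combValue, hΦ b fun j' i h1 h2 => hb j' i h1 (by omega), LinearMap.comp_apply, adj_apply]
    simp only [hb k _ hjk (Nat.lt_succ_self k)]

theorem combValue_congr (B : L [⋀^Fin (n + 1)]→ₗ[F] L) {a b : Option (ℕ × Fin n) → L} {k : ℕ}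
    (h0 : b none = a none) (h : ∀ j i, j < k → b (some (j, i)) = a (some (j, i))) :
    combValue B b k = combValue B a k := by
  obtain ⟨Φ, hΦ⟩ := exists_combValue_eq B a (Nat.zero_le k)
  rw [hΦ b fun j i _ hj => h j i hj, hΦ a fun _ _ _ _ => rfl, combValue, combValue, h0]

/-- The permutation of the positions exchanging the rows `j` and `j + 1`. -/
def swapRows (n j : ℕ) : Equiv.Perm (Option (ℕ × Fin n)) :=
  (((Equiv.swap j (j + 1)).prodCongr (Equiv.refl (Fin n)))).optionCongr

@[simp]
theorem swapRows_none (n j : ℕ) : swapRows n j none = none := rfl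

theorem swapRows_some (n j j' : ℕ) (i : Fin n) :
    swapRows n j (some (j', i)) = some (Equiv.swap j (j + 1) j', i) := rfl

theorem map_cons_update (B : L [⋀^Fin (n + 1)]→ₗ[F] L) (u v : L) (y : Fin n → L) (i : Fin n) :
    B (Fin.cons u (Function.update y i v)) = - B (Fin.cons v (Function.update y i u)) := by
  rw [← B.map_swap _ (Fin.succ_ne_zero i).symm]
  congr 1
  ext j
  refine Fin.cases ?_ (fun j => ?_) j
  · simp
  · rcases eq_or_ne j i with rfl | hj
    · simp [Function.update_of_ne (Fin.succ_ne_zero j).symm]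
    · rw [Function.comp_apply, Equiv.swap_apply_of_ne_of_ne (Fin.succ_ne_zero j)
        (fun h => hj (Fin.succ_injective _ h))]
      simp [hj]

theorem bracket_bracket_eq {B : L [⋀^Fin (n + 1)]→ₗ[F] L} (hB : IsFilippov B) (u : L)
    (x y : Fin n → L) :
    B (Fin.cons (B (Fin.cons u x)) y) = B (Fin.cons (B (Fin.cons u y)) x) -
      ∑ i, B (Fin.cons (B (Fin.cons (x i) y)) (Function.update x i u)) := by
  rw [hB, Fin.sum_univ_succ, sub_eq_add_neg, ← Finset.sum_neg_distrib]
  congr 1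
  · rw [Fin.update_cons_zero, Fin.cons_zero]
  · refine Finset.sum_congr rfl fun i _ => ?_
    rw [← Fin.cons_update, map_cons_update, Fin.cons_succ]

/-- The Jacobi identity is used twice. Each error term of `bracket_bracket_eq` is expanded again,
giving -[[u, x], y] (n copies in all) and brackets in which one entry of x is exchanged with one of
y. -/
theorem bracket_bracket_comm {B : L [⋀^Fin (n + 1)]→ₗ[F] L} (hB : IsFilippov B) (u : L)
    (x y : Fin n → L) :
    B (Fin.cons (B (Fin.cons u y)) x) =
      B (Fin.cons (B (Fin.cons u x)) y) - n • B (Fin.cons (B (Fin.cons u x)) y) +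
      ∑ i, ∑ j, B (Fin.cons (B (Fin.cons u (Function.update x i (y j))))
        (Function.update y j (x i))) := by
  have h1 : ∀ i, B (Fin.cons (B (Fin.cons (x i) y)) (Function.update x i u)) =
      - B (Fin.cons (B (Fin.cons u x)) y) + ∑ j, B (Fin.cons (B (Fin.cons u
        (Function.update x i (y j)))) (Function.update y j (x i))) := by
    intro i
    rw [hB, Fin.sum_univ_succ]
    congr 1
    · rw [Fin.update_cons_zero, Fin.cons_zero, map_cons_update, Function.update_eq_self,
        ← adj_apply, map_neg, adj_apply]
    · refine Finset.sum_congr rfl fun j _ => ?_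
      rw [Fin.cons_succ, ← Fin.cons_update, map_cons_update, map_cons_update B (y j), ← adj_apply,
        map_neg, adj_apply, neg_neg]
  have h2 := bracket_bracket_eq hB u x y
  rw [Finset.sum_congr rfl fun i _ => h1 i, Finset.sum_add_distrib] at h2
  simp only [Finset.sum_const, Finset.card_univ, Fintype.card_fin, smul_neg] at h2
  rw [eq_comm, h2]
  nth_rw 1 [h2]
  abel_nf

/-- This is `bracket_bracket_comm` with u the bracket of the rows before j. Being composite, u must
stay innermost, so the relation has to be expressed by exchanges of letters between the two rows
only. -/
theorem combValue_swapRows {B : L [⋀^Fin (n + 1)]→ₗ[F] L} (hB : IsFilippov B)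
    (a : Option (ℕ × Fin n) → L) {j k : ℕ} (hjk : j + 2 ≤ k) :
    combValue B (a ∘ swapRows n j) k = combValue B a k - n • combValue B a k +
      ∑ i, ∑ i', combValue B (a ∘ Equiv.swap (some (j, i)) (some (j + 1, i'))) k := by
  obtain ⟨Φ, hΦ⟩ := exists_combValue_eq B a hjk
  have hlow : ∀ b : Option (ℕ × Fin n) → L, b none = a none →
      (∀ j' i, j' < j → b (some (j', i)) = a (some (j', i))) →
      combValue B b j = combValue B a j := fun b h0 h => combValue_congr B h0 h
  rw [hΦ a (fun _ _ _ _ => rfl), hΦ (a ∘ swapRows n j)]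
  · have : ∀ i i', combValue B (a ∘ Equiv.swap (some (j, i)) (some (j + 1, i'))) k =
        Φ (combValue B (a ∘ Equiv.swap (some (j, i)) (some (j + 1, i'))) (j + 2)) := by
      intro i i'
      refine hΦ _ fun j' i'' h1 h2 => ?_
      rw [Function.comp_apply, Equiv.swap_apply_of_ne_of_ne] <;> simp <;> omega
    simp only [this, ← map_nsmul, ← map_sub, ← map_sum, ← map_add]
    congr 1
    simp only [combValue]
    rw [hlow (a ∘ swapRows n j) rfl]
    · convert bracket_bracket_comm hB (combValue B a j) (fun i => a (some (j, i)))
        (fun i => a (some (j + 1, i))) using 2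
      · congr 2
        · congr 2
          ext i
          simp [swapRows_some]
        · ext i
          simp [swapRows_some]
      · refine Finset.sum_congr rfl fun i _ => Finset.sum_congr rfl fun i' _ => ?_
        rw [hlow]
        · congr 2
          · congr 2
            ext i''
            rcases eq_or_ne i'' i with rfl | h
            · simp
            · rw [Function.comp_apply, Equiv.swap_apply_of_ne_of_ne, Function.update_of_ne h] <;>
                simp [h]
          · ext i''
            rcases eq_or_ne i'' i' with rfl | h
            · simp
            · rw [Function.comp_apply, Equiv.swap_apply_of_ne_of_ne, Function.update_of_ne h] <;>
                simp [h]
        · rw [Function.comp_apply, Equiv.swap_apply_of_ne_of_ne] <;> simp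
        · intro j' i'' hj'
          rw [Function.comp_apply, Equiv.swap_apply_of_ne_of_ne] <;> simp <;> omega
    · intro j' i hj'
      rw [Function.comp_apply, swapRows_some, Equiv.swap_apply_of_ne_of_ne] <;> omega
  · intro j' i h1 h2
    rw [Function.comp_apply, swapRows_some, Equiv.swap_apply_of_ne_of_ne] <;> omega

/-- In the innermost bracket u is itself an entry and may be exchanged with the others, so a single
use of the Jacobi identity gives a stronger relation. -/
theorem combValue_eq_swapRows_zero {B : L [⋀^Fin (n + 1)]→ₗ[F] L} (hB : IsFilippov B)
    (a : Option (ℕ × Fin n) → L) {k : ℕ} (hk : 2 ≤ k) :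
    combValue B a k = combValue B (a ∘ swapRows n 0) k -
      ∑ i, combValue B ((a ∘ Equiv.swap none (some (0, i))) ∘ swapRows n 0) k := by
  obtain ⟨Φ, hΦ⟩ := exists_combValue_eq B a hk
  rw [hΦ a (fun _ _ _ _ => rfl), hΦ (a ∘ swapRows n 0)]
  · have : ∀ i, combValue B ((a ∘ Equiv.swap none (some (0, i))) ∘ swapRows n 0) k =
        Φ (combValue B ((a ∘ Equiv.swap none (some (0, i))) ∘ swapRows n 0) 2) := by
      intro i
      refine hΦ _ fun j' i'' h1 h2 => ?_
      rw [Function.comp_apply, Function.comp_apply, swapRows_some,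
        Equiv.swap_apply_of_ne_of_ne (show j' ≠ 0 by omega) (show j' ≠ 0 + 1 by omega),
        Equiv.swap_apply_of_ne_of_ne] <;> simp
      omega
    simp only [this, ← map_sum, ← map_sub]
    congr 1
    have h2 := bracket_bracket_eq hB (a none) (fun i => a (some (0, i)))
      (fun i => a (some (1, i)))
    refine h2.trans ?_
    congr 1
    refine Finset.sum_congr rfl fun i _ => ?_
    simp only [combValue]
    congr 2
    · ext i'
      rw [Function.comp_apply, Function.comp_apply, swapRows_some]
      rcases eq_or_ne i' i with rfl | h
      · simp
      · rw [Equiv.swap_apply_right, Equiv.swap_apply_of_ne_of_ne, Function.update_of_ne h] <;>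
          simp [h]
  · intro j' i h1 h2
    rw [Function.comp_apply, swapRows_some, Equiv.swap_apply_of_ne_of_ne] <;> omega

theorem combValue_swap_none (B : L [⋀^Fin (n + 1)]→ₗ[F] L) (a : Option (ℕ × Fin n) → L) {k : ℕ}
    (hk : 1 ≤ k) (i : Fin n) :
    combValue B (a ∘ Equiv.swap none (some (0, i))) k = - combValue B a k := by
  obtain ⟨Φ, hΦ⟩ := exists_combValue_eq B a hk
  rw [hΦ a (fun _ _ _ _ => rfl), hΦ, ← map_neg]
  · congr 1
    simp only [combValue]
    rw [show (fun i' => (a ∘ Equiv.swap none (some (0, i))) (some (0, i'))) =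
      Function.update (fun i' => a (some (0, i'))) i (a none) from ?_, map_cons_update]
    · simp
    · ext i'
      rcases eq_or_ne i' i with rfl | h
      · simp
      · rw [Function.comp_apply, Equiv.swap_apply_of_ne_of_ne, Function.update_of_ne h] <;> simp [h]
  · intro j' i' h1 h2
    rw [Function.comp_apply, Equiv.swap_apply_of_ne_of_ne] <;> simp
    omega

theorem combValue_swap_row (B : L [⋀^Fin (n + 1)]→ₗ[F] L) (a : Option (ℕ × Fin n) → L) {j k : ℕ}
    (hk : j < k) {i i' : Fin n} (hi : i ≠ i') :
    combValue B (a ∘ Equiv.swap (some (j, i)) (some (j, i'))) k = - combValue B a k := by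
  obtain ⟨Φ, hΦ⟩ := exists_combValue_eq B a hk
  rw [hΦ a (fun _ _ _ _ => rfl), hΦ, ← map_neg]
  · congr 1
    rw [combValue, combValue_congr (a := a)]
    · rw [combValue, ← B.map_swap _ (fun h => hi (Fin.succ_injective _ h) : i.succ ≠ i'.succ)]
      congr 1
      ext l
      refine Fin.cases ?_ (fun l => ?_) l
      · rw [Function.comp_apply, Equiv.swap_apply_of_ne_of_ne (Fin.succ_ne_zero _).symm
          (Fin.succ_ne_zero _).symm]
        rfl
      · rw [Function.comp_apply]
        rcases eq_or_ne l i with rfl | h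
        · simp
        rcases eq_or_ne l i' with rfl | h'
        · simp
        rw [Fin.cons_succ, Function.comp_apply, Equiv.swap_apply_of_ne_of_ne,
          Equiv.swap_apply_of_ne_of_ne, Fin.cons_succ] <;> simp [h, h']
    · rw [Function.comp_apply, Equiv.swap_apply_of_ne_of_ne] <;> simp
    · intro j' i' h1
      rw [Function.comp_apply, Equiv.swap_apply_of_ne_of_ne] <;> simp <;> omega
  · intro j' i' h1 h2
    rw [Function.comp_apply, Equiv.swap_apply_of_ne_of_ne] <;> simp <;> omega

end CombValue

/-! ### Action of matrix units on functions of colorings -/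

section Colorings

variable {F : Type*} [Field F] {X : Type*} [Fintype X] [DecidableEq X] {V : Type*}
  [AddCommGroup V] [Module F V]

/-- The action of the matrix unit `E_{ab}` on `V`-valued functions of the colorings of `X`. -/
def colorMove (F : Type*) [Field F] {X : Type*} [Fintype X] [DecidableEq X] (V : Type*)
    [AddCommGroup V] [Module F V] (a b : ℕ) : Module.End F ((X → ℕ) → V) where
  toFun ψ g := ∑ x, if g x = a then ψ (Function.update g x b) else 0
  map_add' ψ χ := by
    ext g
    simp only [Pi.add_apply, ← Finset.sum_add_distrib]
    refine Finset.sum_congr rfl fun x _ => ?_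
    split_ifs <;> simp
  map_smul' r ψ := by
    ext g
    simp only [Pi.smul_apply, Finset.smul_sum, RingHom.id_apply]
    refine Finset.sum_congr rfl fun x _ => ?_
    split_ifs <;> simp

theorem colorMove_apply (a b : ℕ) (ψ : (X → ℕ) → V) (g : X → ℕ) :
    colorMove F V a b ψ g = ∑ x, if g x = a then ψ (Function.update g x b) else 0 := rfl

theorem colorMove_self_apply (a : ℕ) (ψ : (X → ℕ) → V) (g : X → ℕ) :
    colorMove F V a a ψ g = ((Finset.univ.filter fun x => g x = a).card : F) • ψ g := by
  rw [colorMove_apply, ← Finset.sum_filter, Finset.sum_congr rfl (g := fun _ => ψ g)]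
  · simp [Nat.cast_smul_eq_nsmul]
  · intro x hx
    rw [← (Finset.mem_filter.1 hx).2, Function.update_eq_self]

theorem colorMove_mul_aux (a b c d : ℕ) (ψ : (X → ℕ) → V) (g : X → ℕ) :
    (colorMove F V a b * colorMove F V c d : Module.End F ((X → ℕ) → V)) ψ g =
      (∑ x, ∑ y, if x ≠ y ∧ g x = a ∧ g y = c then
        ψ (Function.update (Function.update g x b) y d) else 0) +
      (if b = c then colorMove F V a d else 0) ψ g := by
  have h1 : (if b = c then colorMove F V a d else 0) ψ g =
      ∑ x, if g x = a ∧ b = c then ψ (Function.update g x d) else 0 := by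
    split_ifs with h
    · simp [colorMove_apply, h]
    · simp [h]
  rw [h1, ← Finset.sum_add_distrib, Module.End.mul_apply, colorMove_apply]
  refine Finset.sum_congr rfl fun x _ => ?_
  by_cases hx : g x = a
  · rw [if_pos hx, colorMove_apply, ← Finset.add_sum_erase _ _ (Finset.mem_univ x),
      ← Finset.add_sum_erase _ _ (Finset.mem_univ x), add_comm]
    simp only [Function.update_self, Function.update_idem, ne_eq, not_true_eq_false, false_and,
      if_false, zero_add, hx, true_and]
    congr 1
    refine Finset.sum_congr rfl fun y hy => ?_
    have hy := (Finset.mem_erase.1 hy).1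
    rw [Function.update_of_ne hy]
    simp [hy.symm]
  · simp [hx]

/-- The commutator relation of gl. The part of the product that recolors two distinct letters is
symmetric in the two operators; only recoloring the same letter twice contributes to the commutator.
-/
theorem colorMove_mul (a b c d : ℕ) :
    (colorMove F V a b * colorMove F V c d : Module.End F ((X → ℕ) → V)) =
      colorMove F V c d * colorMove F V a b + (if b = c then colorMove F V a d else 0) -
        (if d = a then colorMove F V c b else 0) := by
  ext ψ g
  simp only [LinearMap.sub_apply, LinearMap.add_apply, Pi.add_apply, Pi.sub_apply]
  rw [colorMove_mul_aux, colorMove_mul_aux c d a b]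
  rw [Finset.sum_comm]
  have : ∀ x y, (if y ≠ x ∧ g y = a ∧ g x = c then
      ψ (Function.update (Function.update g y b) x d) else 0) = if x ≠ y ∧ g x = c ∧ g y = a then
        ψ (Function.update (Function.update g x d) y b) else 0 := by
    intro x y
    by_cases h : x = y
    · simp [h]
    · simp only [ne_eq, h, Ne.symm h, not_false_eq_true, true_and, and_comm,
        Function.update_comm h]
  simp only [this]
  abel

/-- `ψ` is a simultaneous eigenvector of the operators `E_{aa}`. -/
def HasWeight (F : Type*) [Field F] {X : Type*} [Fintype X] [DecidableEq X] {V : Type*}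
    [AddCommGroup V] [Module F V] (c : ℕ → ℤ) (ψ : (X → ℕ) → V) : Prop :=
  ∀ a, colorMove F V a a ψ = (c a : F) • ψ

theorem HasWeight.colorMove {c : ℕ → ℤ} {ψ : (X → ℕ) → V} (h : HasWeight F c ψ) (a b : ℕ) :
    HasWeight F (c + Pi.single a 1 - Pi.single b 1) (colorMove F V a b ψ) := by
  intro d
  rw [← Module.End.mul_apply, colorMove_mul]
  simp only [LinearMap.sub_apply, LinearMap.add_apply, Module.End.mul_apply, h d, map_smul]
  simp only [Pi.sub_apply, Pi.add_apply, Pi.single_apply, eq_comm (a := b) (b := d)]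
  split_ifs with h1 h2 h2 <;> subst_vars <;> simp [add_smul, sub_smul]

/-- E_{aa} multiplies ψ g by the number of letters of color a, so in characteristic 0 the weight is
the color count of every coloring in the support. -/
theorem HasWeight.card_eq [CharZero F] {c : ℕ → ℤ} {ψ : (X → ℕ) → V} (h : HasWeight F c ψ)
    {g : X → ℕ} (hg : ψ g ≠ 0) (a : ℕ) : ((Finset.univ.filter fun x => g x = a).card : ℤ) = c a := by
  have := congrFun (h a) g
  rw [colorMove_self_apply, Pi.smul_apply] at this
  exact_mod_cast smul_left_injective F hg this

theorem HasWeight.eq_zero [CharZero F] {c : ℕ → ℤ} {ψ : (X → ℕ) → V} (h : HasWeight F c ψ) {a : ℕ}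
    (ha : c a < 0) : ψ = 0 := by
  by_contra hψ
  obtain ⟨g, hg⟩ := Function.ne_iff.1 hψ
  have := h.card_eq hg a
  omega

/-- The sl₂ computation for a vector annihilated by E_{ba}, by induction on r. -/
theorem colorMove_pow_mul {c : ℕ → ℤ} {ψ : (X → ℕ) → V} (h : HasWeight F c ψ) {a b : ℕ}
    (hab : a ≠ b) (h0 : colorMove F V b a ψ = 0) (r : ℕ) :
    HasWeight F (c + (r : ℤ) • (Pi.single a 1 - Pi.single b 1)) ((colorMove F V a b ^ r) ψ) ∧
    colorMove F V b a ((colorMove F V a b ^ (r + 1)) ψ) =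
      (-(((r + 1 : ℕ) : ℤ) * (c a - c b + r) : ℤ) : F) • (colorMove F V a b ^ r) ψ := by
  induction r with
  | zero =>
    refine ⟨by simpa using h, ?_⟩
    rw [zero_add, pow_one, ← Module.End.mul_apply, colorMove_mul]
    simp [h0, h a, h b]
    module
  | succ r ih =>
    have hw : HasWeight F (c + ((r + 1 : ℕ) : ℤ) • (Pi.single a 1 - Pi.single b 1))
        ((colorMove F V a b ^ (r + 1)) ψ) := by
      convert ih.1.colorMove a b using 1
      · push_cast
        module
      · rw [pow_succ', Module.End.mul_apply]
    refine ⟨hw, ?_⟩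
    rw [pow_succ' _ (r + 1), Module.End.mul_apply, ← Module.End.mul_apply (colorMove F V b a),
      colorMove_mul]
    have ha := hw a
    have hb := hw b
    simp [hab, hab.symm] at ha hb
    simp only [LinearMap.sub_apply, LinearMap.add_apply, Module.End.mul_apply, ih.2, if_true, ha,
      hb, map_smul]
    rw [← Module.End.mul_apply, ← pow_succ']
    push_cast
    module

/-- A vector killed by the raising operator E_{ba} cannot have negative sl₂-weight c b - c a: the
scalars in `colorMove_pow_mul` never vanish, while high powers of E_{ab} kill ψ. -/
theorem HasWeight.eq_zero_of_colorMove_eq_zero [CharZero F] {c : ℕ → ℤ} {ψ : (X → ℕ) → V}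
    (h : HasWeight F c ψ) {a b : ℕ} (hab : a ≠ b) (hc : c b < c a)
    (h0 : Filippov.colorMove F V b a ψ = 0) : ψ = 0 := by
  have key : ∀ r : ℕ, (Filippov.colorMove F V a b ^ r) ψ = 0 → ψ = 0 := by
    intro r
    induction r with
    | zero => simp
    | succ r ih =>
      intro hr
      have h2 := (colorMove_pow_mul h hab h0 r).2
      rw [hr, map_zero, eq_comm, smul_eq_zero] at h2
      refine ih (h2.resolve_left ?_)
      rw [neg_eq_zero]
      exact_mod_cast mul_ne_zero (show ((r + 1 : ℕ) : ℤ) ≠ 0 by omega)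
        (show c a - c b + r ≠ 0 by omega)
  -- Each application of E_{ab} lowers the count of color b by one; after this many applications the
  -- count would be negative.
  refine key ((c b).toNat + 1) ((colorMove_pow_mul h hab h0 _).1.eq_zero (a := b) ?_)
  simp [hab.symm]
  omega

/-- Precomposition with a relabelling of the colors. -/
def relabel (F : Type*) [Field F] (X : Type*) (V : Type*) [AddCommGroup V] [Module F V]
    (s : Equiv.Perm ℕ) : Module.End F ((X → ℕ) → V) :=
  LinearMap.funLeft F V fun g => s ∘ g

omit [Fintype X] [DecidableEq X] in
theorem relabel_apply (s : Equiv.Perm ℕ) (ψ : (X → ℕ) → V) (g : X → ℕ) :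
    relabel F X V s ψ g = ψ (s ∘ g) := rfl

theorem relabel_colorMove (s : Equiv.Perm ℕ) (a b : ℕ) (ψ : (X → ℕ) → V) :
    relabel F X V s (colorMove F V (s a) (s b) ψ) = colorMove F V a b (relabel F X V s ψ) := by
  ext g
  simp only [relabel_apply, colorMove_apply, Function.comp_apply, EmbeddingLike.apply_eq_iff_eq,
    Function.comp_update]

theorem HasWeight.relabel {c : ℕ → ℤ} {ψ : (X → ℕ) → V} (h : HasWeight F c ψ)
    (s : Equiv.Perm ℕ) : HasWeight F (c ∘ s) (relabel F X V s ψ) := by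
  intro a
  rw [← relabel_colorMove, h, map_smul]
  rfl

end Colorings

/-! ### Three operators with [e, y] = x and x commuting with both -/

section Products

variable {F : Type*} [Field F] {M : Type*} [AddCommGroup M] [Module F M]
  {e x y : Module.End F M}

theorem mul_pow_of_mul_eq_add (hey : e * y = y * e + x) (hxy : Commute x y) (c : ℕ) :
    e * y ^ c = y ^ c * e + (c : F) • (x * y ^ (c - 1)) := by
  induction c with
  | zero => simp
  | succ c ih =>
    rw [pow_succ', ← mul_assoc, hey, add_mul, mul_assoc, ih, mul_add, mul_smul_comm,
      ← mul_assoc y x, ← hxy.eq, mul_assoc x, mul_assoc y, Nat.add_sub_cancel]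
    rcases c with _ | c
    · simp
    · rw [Nat.add_sub_cancel, ← pow_succ', ← mul_assoc, ← pow_succ']
      push_cast
      module

theorem apply_pow_mul_pow (hey : e * y = y * e + x) (hxy : Commute x y) (hex : Commute e x)
    (s c : ℕ) (v : M) :
    e ((x ^ s * y ^ c) v) = (x ^ s * y ^ c) (e v) + (c : F) • (x ^ (s + 1) * y ^ (c - 1)) v := by
  rw [← Module.End.mul_apply, ← mul_assoc, (hex.pow_right s).eq, mul_assoc,
    mul_pow_of_mul_eq_add hey hxy, mul_add, mul_smul_comm, ← mul_assoc, ← mul_assoc, ← pow_succ]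
  rfl

variable [CharZero F]

/-- Apply e repeatedly to y^(s+t) v = 0. Each application turns one y into x or acts on v, the
latter at most once because e² v = 0; the common nonzero factor is divided out at each step. -/
theorem pow_mul_pow_apply_add_eq_zero (hey : e * y = y * e + x) (hxy : Commute x y)
    (hex : Commute e x) {v : M} (he : e (e v) = 0) (s t : ℕ) (h0 : (y ^ (s + t)) v = 0) :
    (t : F) • (x ^ (s + 1) * y ^ (t - 1)) v + (s + 1 : F) • (x ^ s * y ^ t) (e v) = 0 := by
  induction s generalizing t with
  | zero =>
    have := apply_pow_mul_pow hey hxy hex 0 t v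
    rw [zero_add] at h0
    rw [pow_zero, one_mul, h0, map_zero, zero_add] at this
    rw [this]
    simp [add_comm]
  | succ s ih =>
    have h1 := congrArg e (ih (t + 1) (by rw [← h0]; congr 2; omega))
    rw [map_zero, map_add, map_smul, map_smul, apply_pow_mul_pow hey hxy hex,
      apply_pow_mul_pow hey hxy hex, he, Nat.add_sub_cancel, map_zero, zero_add] at h1
    have h2 : (t + 1 : F) ≠ 0 := by exact_mod_cast Nat.succ_ne_zero t
    refine (smul_eq_zero.1 (?_ : (t + 1 : F) • (_ : M) = 0)).resolve_left h2
    rw [← h1]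
    push_cast
    module

/-- Besides y^d v = 0 also y^(d+1) v = 0. The preceding relation for exponent d + 1, and y times the
one for exponent d, have the same term in e v; their difference is the claim. -/
theorem pow_mul_pow_apply_eq_zero_of_sq (hey : e * y = y * e + x) (hxy : Commute x y)
    (hex : Commute e x) {v : M} (he : e (e v) = 0) {d s t : ℕ} (h0 : (y ^ d) v = 0)
    (hst : s + t = d + 1) : (x ^ s * y ^ t) v = 0 := by
  have h0' : (y ^ (d + 1)) v = 0 := by rw [pow_succ', Module.End.mul_apply, h0, map_zero]
  rcases s with _ | s
  · rw [pow_zero, one_mul, show t = d + 1 by omega, h0']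
  have h1 := pow_mul_pow_apply_add_eq_zero hey hxy hex he s (t + 1) (by
    rw [← h0']; congr 2; omega)
  have h2 := congrArg y (pow_mul_pow_apply_add_eq_zero hey hxy hex he s t (by
    rw [← h0]; congr 2; omega))
  have h3 : ∀ a b w, y ((x ^ a * y ^ b) w) = (x ^ a * y ^ (b + 1)) w := by
    intro a b w
    rw [← Module.End.mul_apply, ← mul_assoc, ((hxy.symm).pow_right a).eq, mul_assoc, ← pow_succ']
  rw [map_zero, map_add, map_smul, map_smul, h3, h3] at h2
  rw [Nat.add_sub_cancel] at h1
  have h4 : (t : F) • (x ^ (s + 1) * y ^ (t - 1 + 1)) v = (t : F) • (x ^ (s + 1) * y ^ t) v := by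
    rcases t with _ | t
    · simp
    · rfl
  rw [h4] at h2
  rw [← sub_eq_zero.2 (h1.trans h2.symm)]
  push_cast
  module

/-- When e v = 0, each application of e to a vanishing x^s y^(t+1) v turns one y into x, up to the
nonzero factor t + 1. -/
theorem pow_mul_pow_apply_eq_zero (hey : e * y = y * e + x) (hxy : Commute x y)
    (hex : Commute e x) {v : M} (he : e v = 0) (s t : ℕ) (h0 : (y ^ (s + t)) v = 0) :
    (x ^ s * y ^ t) v = 0 := by
  induction s generalizing t with
  | zero => simpa using h0
  | succ s ih =>
    have h1 := congrArg e (ih (t + 1) (by rw [← h0]; congr 2; omega))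
    rw [map_zero, apply_pow_mul_pow hey hxy hex, he, map_zero, zero_add, Nat.add_sub_cancel] at h1
    refine (smul_eq_zero.1 h1).resolve_left ?_
    exact_mod_cast Nat.succ_ne_zero t

end Products

/-! ### Products of operators moving colors to the last one -/

section MoveProducts

variable {F : Type*} [Field F] {X : Type*} [Fintype X] [DecidableEq X] {V : Type*}
  [AddCommGroup V] [Module F V]

/-- The products of `d` operators `E_{lq}` with `j ≤ l < q`. -/
inductive IsMoveProd {F : Type*} [Field F] {X : Type*} [Fintype X] [DecidableEq X] {V : Type*}
    [AddCommGroup V] [Module F V] (q j : ℕ) : ℕ → Module.End F ((X → ℕ) → V) → Prop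
  | one : IsMoveProd q j 0 1
  | mul {d : ℕ} {r : Module.End F ((X → ℕ) → V)} (l : ℕ) (hj : j ≤ l) (hl : l < q)
      (hr : IsMoveProd q j d r) : IsMoveProd q j (d + 1) (colorMove F V l q * r)

theorem colorMove_commute {a b c d : ℕ} (hbc : b ≠ c) (hda : d ≠ a) :
    Commute (colorMove F V a b : Module.End F ((X → ℕ) → V)) (colorMove F V c d) := by
  rw [commute_iff_eq, colorMove_mul, if_neg hbc, if_neg hda, add_zero, sub_zero]

theorem IsMoveProd.mono {q j j' d : ℕ} {r : Module.End F ((X → ℕ) → V)} (hj : j' ≤ j)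
    (hr : IsMoveProd q j d r) : IsMoveProd q j' d r := by
  induction hr with
  | one => exact .one
  | mul l h hl _ ih => exact .mul l (hj.trans h) hl ih

theorem IsMoveProd.pow_mul {q j d : ℕ} {r : Module.End F ((X → ℕ) → V)}
    (hr : IsMoveProd q j d r) {l : ℕ} (hj : j ≤ l) (hl : l < q) (c : ℕ) :
    IsMoveProd q j (c + d) (colorMove F V l q ^ c * r) := by
  induction c with
  | zero => simpa using hr
  | succ c ih =>
    rw [pow_succ', mul_assoc, show c + 1 + d = c + d + 1 by omega]
    exact .mul l hj hl ih

theorem IsMoveProd.commute {q j d : ℕ} {r : Module.End F ((X → ℕ) → V)}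
    (hr : IsMoveProd q j d r) {a b : ℕ} (hb : b < j) (ha : a < j) :
    Commute (colorMove F V a b) r := by
  induction hr with
  | one => exact Commute.one_right _
  | mul l h hl _ ih => exact (colorMove_commute (by omega) (by omega)).mul_right ih

/-- The factors E_{lq} with l < q commute, so those with l = j and l = j + 1 can be collected in
front. -/
theorem IsMoveProd.exists_eq {q j d : ℕ} {r : Module.End F ((X → ℕ) → V)}
    (hr : IsMoveProd q j d r) : ∃ (s t d' : ℕ) (r' : Module.End F ((X → ℕ) → V)),
      d = s + t + d' ∧ IsMoveProd q (j + 2) d' r' ∧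
        r = colorMove F V j q ^ s * colorMove F V (j + 1) q ^ t * r' := by
  induction hr with
  | one => exact ⟨0, 0, 0, 1, rfl, .one, by simp⟩
  | mul l h hl _ ih =>
    obtain ⟨s, t, d', r', rfl, hr', rfl⟩ := ih
    have hc : ∀ l', l' < q →
        Commute (colorMove F V l q : Module.End F ((X → ℕ) → V)) (colorMove F V l' q) :=
      fun l' hl' => colorMove_commute (by omega) (by omega)
    by_cases h0 : l = j
    · subst h0
      exact ⟨s + 1, t, d', r', by omega, hr', by rw [pow_succ']; simp only [mul_assoc]⟩
    by_cases h1 : l = j + 1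
    · subst h1
      refine ⟨s, t + 1, d', r', by omega, hr', ?_⟩
      rw [← mul_assoc, ← mul_assoc, ((hc j (by omega)).pow_right s).eq, pow_succ']
      simp only [mul_assoc]
    · refine ⟨s, t, d' + 1, _, by omega, .mul l (by omega) hl hr', ?_⟩
      rw [← mul_assoc, ← mul_assoc, ((hc j (by omega)).pow_right s).eq,
        mul_assoc (colorMove F V j q ^ s), ((hc (j + 1) (by omega)).pow_right t).eq]
      simp only [mul_assoc]

/-- The relations between the operators which move the colors `j` and `j + 1` to `q`. -/
theorem colorMove_succ_relations {q j : ℕ} (hj : j + 1 < q) :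
    (colorMove F V j (j + 1) * colorMove F V (j + 1) q : Module.End F ((X → ℕ) → V)) =
      colorMove F V (j + 1) q * colorMove F V j (j + 1) + colorMove F V j q ∧
    Commute (colorMove F V j q : Module.End F ((X → ℕ) → V)) (colorMove F V (j + 1) q) ∧
    Commute (colorMove F V j (j + 1) : Module.End F ((X → ℕ) → V)) (colorMove F V j q) := by
  refine ⟨?_, colorMove_commute (by omega) (by omega), colorMove_commute (by omega) (by omega)⟩
  rw [colorMove_mul, if_pos rfl, if_neg (by omega), sub_zero]

variable [CharZero F]

/-- Downward induction on j. With e = E_{j,j+1}, y = E_{j+1,q} and x = E_{jq} one has [e, y] = x, so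
the algebra of e, x, y transfers the vanishing of products starting at j + 1 to products starting at
j, at the cost of one more factor. -/
theorem IsMoveProd.apply_eq_zero_of_sq {q : ℕ} {φ : (X → ℕ) → V}
    (h2 : ∀ j, 1 ≤ j → j < q → colorMove F V j (j + 1) (colorMove F V j (j + 1) φ) = 0)
    (i : ℕ) : ∀ {j : ℕ}, 1 ≤ j → j + i = q → ∀ {r : Module.End F ((X → ℕ) → V)},
      IsMoveProd q j (i + 1) r → r φ = 0 := by
  induction i with
  | zero =>
    intro j _ hi r hr
    cases hr with
    | mul l hj hl => omega
  | succ i ih =>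
    intro j hj hi r hr
    rcases i with _ | i
    -- Only l = j is available, and the product is the square assumed to kill φ.
    · have hq : q = j + 1 := by omega
      subst hq
      cases hr with
      | mul l hj' hl hr =>
        cases hr with
        | mul l' hj'' hl' hr =>
          cases hr
          obtain rfl : l = j := by omega
          obtain rfl : l' = l := by omega
          simpa using h2 l' hj (by omega)
    · obtain ⟨s, t, d', r', hd, hr', rfl⟩ := hr.exists_eq
      obtain ⟨hey, hxy, hex⟩ := colorMove_succ_relations (F := F) (X := X) (V := V)
        (show j + 1 < q by omega)
      -- Such a product has i + 2 factors, all with l ≥ j + 1, so the induction hypothesis applies.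
      have hk : ∀ c, c + d' = i + 2 → (colorMove F V (j + 1) q ^ c) (r' φ) = 0 := by
        intro c hc
        rw [← Module.End.mul_apply]
        refine ih (j := j + 1) (by omega) (by omega) ?_
        rw [show i + 1 + 1 = c + d' by omega]
        exact (hr'.mono (by omega)).pow_mul le_rfl (by omega) c
      rw [Module.End.mul_apply]
      have he : Commute (colorMove F V j (j + 1)) r' := hr'.commute (by omega) (by omega)
      rcases Nat.eq_zero_or_pos (s + t) with h0 | h0
      -- No factor has l = j or j + 1. Dropping the first factor leaves i + 2 factors, which already
      -- kill φ.
      · obtain ⟨rfl, rfl⟩ : s = 0 ∧ t = 0 := by omega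
        cases hr' with
        | one => omega
        | @mul d _ l hl hlq hr'' =>
          rw [pow_zero, pow_zero, one_mul, Module.End.one_apply, Module.End.mul_apply,
            ih (j := j + 1) (by omega) (by omega), map_zero]
          obtain rfl : d = i + 1 + 1 := by omega
          exact hr''.mono (by omega)
      · refine pow_mul_pow_apply_eq_zero_of_sq hey hxy hex ?_ (hk (s + t - 1) (by omega)) (by omega)
        rw [← Module.End.mul_apply _ r', he.eq, Module.End.mul_apply, ← Module.End.mul_apply _ r',
          he.eq, Module.End.mul_apply, h2 j hj (by omega), map_zero]

/-- The last step, from colors l ≥ 1 to l ≥ 0, costs no further factor, because E_{01} itself and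
not merely its square kills φ. This saved factor makes the bound k ≤ n sufficient. -/
theorem IsMoveProd.apply_eq_zero {q : ℕ} (hq : 1 ≤ q) {φ : (X → ℕ) → V}
    (h1 : colorMove F V 0 1 φ = 0)
    (h2 : ∀ j, 1 ≤ j → j < q → colorMove F V j (j + 1) (colorMove F V j (j + 1) φ) = 0)
    {r : Module.End F ((X → ℕ) → V)} (hr : IsMoveProd q 0 q r) : r φ = 0 := by
  obtain ⟨q, rfl⟩ : ∃ q', q = q' + 1 := ⟨q - 1, by omega⟩
  rcases q with _ | q
  · cases hr with
    | mul l hj hl hr =>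
      cases hr
      obtain rfl : l = 0 := by omega
      simpa using h1
  · obtain ⟨s, t, d', r', hd, hr', rfl⟩ := hr.exists_eq
    obtain ⟨hey, hxy, hex⟩ := colorMove_succ_relations (F := F) (X := X) (V := V)
      (show 0 + 1 < q + 1 + 1 by omega)
    rw [Module.End.mul_apply]
    refine pow_mul_pow_apply_eq_zero hey hxy hex ?_ s t ?_
    · rw [← Module.End.mul_apply, (hr'.commute (by omega) (by omega)).eq, Module.End.mul_apply, h1,
        map_zero]
    · rw [← Module.End.mul_apply]
      refine IsMoveProd.apply_eq_zero_of_sq (q := q + 1 + 1) h2 (q + 1) (j := 1) le_rfl (by omega) ?_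
      have h3 := (hr'.mono (j' := 1) (by omega)).pow_mul le_rfl (show 1 < q + 1 + 1 by omega) (s + t)
      rwa [← hd] at h3

end MoveProducts

/-! ### Highest weight vectors and vanishing symmetrizers -/

section HighestWeight

variable {F : Type*} [Field F] {X : Type} [Fintype X] [DecidableEq X] {V : Type*}
  [AddCommGroup V] [Module F V]

/-- Coset decomposition: each σ is uniquely τ (x y) with y = σ⁻¹ x and τ fixing x. -/
theorem sum_permsOn_insert {M : Type*} [AddCommMonoid M] {T : Finset X} {x : X} (hx : x ∉ T)
    (f : Equiv.Perm X → M) : ∑ σ ∈ permsOn (insert x T), f σ =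
      ∑ y ∈ insert x T, ∑ τ ∈ permsOn T, f (τ * Equiv.swap x y) := by
  rw [← Finset.sum_product']
  refine Finset.sum_bij' (fun σ _ => (σ⁻¹ x, σ * Equiv.swap x (σ⁻¹ x)))
    (fun p _ => p.2 * Equiv.swap x p.1) ?_ ?_ ?_ ?_ ?_
  · intro σ hσ
    have hσ' := mem_permsOn.1 hσ
    have h1 : σ⁻¹ x ∈ insert x T := by
      by_contra h1
      have := hσ' _ h1
      rw [show σ (σ⁻¹ x) = x by simp] at this
      exact h1 (this ▸ Finset.mem_insert_self x T)
    refine Finset.mem_product.2 ⟨h1, mem_permsOn.2 fun z hz => ?_⟩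
    rcases eq_or_ne z x with rfl | hzx
    · simp
    · rw [Equiv.Perm.mul_apply, Equiv.swap_apply_of_ne_of_ne hzx]
      · exact hσ' z (by simp [hzx, hz])
      · rintro rfl
        exact (Finset.mem_insert.1 h1).elim hzx hz
  · intro p hp
    obtain ⟨h1, h2⟩ := Finset.mem_product.1 hp
    rw [mem_permsOn] at h2 ⊢
    intro z hz
    have hz' := Finset.mem_insert.not.1 hz
    push Not at hz'
    rw [Equiv.Perm.mul_apply, Equiv.swap_apply_of_ne_of_ne hz'.1, h2 z hz'.2]
    rintro rfl
    exact hz h1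
  · intro σ _
    rw [mul_assoc, Equiv.swap_mul_self, mul_one]
  · intro p hp
    obtain ⟨_, h2⟩ := Finset.mem_product.1 hp
    have h3 : p.2.symm x = x := by
      rw [Equiv.symm_apply_eq, mem_permsOn.1 h2 x hx]
    have h4 : (p.2 * Equiv.swap x p.1)⁻¹ x = p.1 := by simp [h3]
    ext1
    · exact h4
    · simp only [h4]
      rw [mul_assoc, Equiv.swap_mul_self, mul_one]
  · intro σ _
    simp only
    rw [mul_assoc, Equiv.swap_mul_self, mul_one]

omit [Fintype X] in
theorem add_sum_swap (ρ : Representation F (Equiv.Perm X) V) {T : Finset X} {x : X}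
    (hx : x ∉ T) (v : V) :
    v + ∑ y ∈ T, ρ (Equiv.swap x y) v = ∑ y ∈ insert x T, ρ (Equiv.swap x y) v := by
  rw [Finset.sum_insert hx, Equiv.swap_self, show Equiv.refl X = 1 from rfl, map_one,
    Module.End.one_apply]

theorem symmetrizer_insert (ρ : Representation F (Equiv.Perm X) V) {T : Finset X} {x : X}
    (hx : x ∉ T) (v : V) : symmetrizer ρ (insert x T) v =
      symmetrizer ρ T (v + ∑ y ∈ T, ρ (Equiv.swap x y) v) := by
  rw [add_sum_swap ρ hx, map_sum]
  simp only [symmetrizer_apply]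
  rw [sum_permsOn_insert hx]
  simp only [map_mul, Module.End.mul_apply]

/-- Functions of the colorings which are equivariant up to the sign. -/
def IsSignEquivariant (ρ : Representation F (Equiv.Perm X) V) (ψ : (X → ℕ) → V) : Prop :=
  ∀ (π : Equiv.Perm X) g, ρ π (ψ (g ∘ π)) = ((Equiv.Perm.sign π : ℤ) : F) • ψ g

theorem IsSignEquivariant.colorMove {ρ : Representation F (Equiv.Perm X) V} {ψ : (X → ℕ) → V}
    (h : IsSignEquivariant ρ ψ) (a b : ℕ) : IsSignEquivariant ρ (colorMove F V a b ψ) := by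
  intro π g
  rw [colorMove_apply, colorMove_apply, map_sum, Finset.smul_sum,
    ← Equiv.sum_comp π fun x => ((Equiv.Perm.sign π : ℤ) : F) •
      (if g x = a then ψ (Function.update g x b) else 0)]
  refine Finset.sum_congr rfl fun x _ => ?_
  simp only [Function.comp_apply]
  split_ifs
  · rw [← h, Function.update_comp_equiv, Equiv.symm_apply_apply]
  · simp

theorem IsMoveProd.hasWeight {q j d : ℕ} {r : Module.End F ((X → ℕ) → V)}
    (hr : IsMoveProd q j d r) {c : ℕ → ℤ} {ψ : (X → ℕ) → V} (hψ : HasWeight F c ψ) :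
    ∃ c', HasWeight F c' (r ψ) ∧ c' q = c q - d ∧ ∀ a, q < a → c' a = c a := by
  induction hr with
  | one => exact ⟨c, hψ, by simp, fun _ _ => rfl⟩
  | mul l h hl _ ih =>
    obtain ⟨c', h1, h2, h3⟩ := ih
    refine ⟨_, h1.colorMove l q, ?_, fun a ha => ?_⟩
    · simp [h2, hl.ne]
      ring
    · simp [h3 a ha, ha.ne', (hl.trans ha).ne']

theorem IsMoveProd.isSignEquivariant {ρ : Representation F (Equiv.Perm X) V} {q j d : ℕ}
    {r : Module.End F ((X → ℕ) → V)} (hr : IsMoveProd q j d r) {ψ : (X → ℕ) → V}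
    (hψ : IsSignEquivariant ρ ψ) : IsSignEquivariant ρ (r ψ) := by
  induction hr with
  | one => exact hψ
  | mul l h hl _ ih => exact ih.colorMove l _

/-- Otherwise any nonzero product with fewer than q factors could be prolonged without becoming zero
on φ, up to q factors. -/
theorem exists_isMoveProd {q : ℕ} {φ : (X → ℕ) → V} (hφ : φ ≠ 0)
    (h : ∀ r : Module.End F ((X → ℕ) → V), IsMoveProd q 0 q r → r φ = 0) :
    ∃ (d : ℕ) (r : Module.End F ((X → ℕ) → V)), d < q ∧ IsMoveProd q 0 d r ∧ r φ ≠ 0 ∧ ∀ l < q, colorMove F V l q (r φ) = 0 := by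
  by_contra hcon
  push Not at hcon
  have : ∀ d ≤ q, ∃ r : Module.End F ((X → ℕ) → V), IsMoveProd q 0 d r ∧ r φ ≠ 0 := by
    intro d
    induction d with
    | zero => exact fun _ => ⟨1, .one, hφ⟩
    | succ d ih =>
      intro hd
      obtain ⟨r, hr, h0⟩ := ih (by omega)
      obtain ⟨l, hl, h1⟩ := hcon d r hd hr h0
      exact ⟨_, .mul l (Nat.zero_le l) hl hr, h1⟩
  obtain ⟨r, hr, h0⟩ := this q le_rfl
  exact h0 (h r hr)

variable [CharZero F]

/-- Operators E_{ij} with i < j < q are applied as long as the result is nonzero. They lower the sum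
of a · c a over a < q, which is nonnegative on nonzero vectors, so the process stops; the count of
color q never changes. -/
theorem exists_highestWeight (ρ : Representation F (Equiv.Perm X) V) (q : ℕ) (N : ℕ)
    {c : ℕ → ℤ} {ψ : (X → ℕ) → V} (hψ : ψ ≠ 0) (hc : HasWeight F c ψ)
    (he : IsSignEquivariant ρ ψ) (hq : 1 ≤ c q) (hbig : ∀ a, q < a → c a = 0)
    (hl : ∀ l < q, colorMove F V l q ψ = 0)
    (hN : ∑ a ∈ Finset.range q, (a : ℤ) * c a ≤ N) :
    ∃ (χ : (X → ℕ) → V) (c' : ℕ → ℤ), χ ≠ 0 ∧ HasWeight F c' χ ∧ IsSignEquivariant ρ χ ∧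
      1 ≤ c' q ∧ (∀ a, q < a → c' a = 0) ∧ ∀ i j, i < j → j ≤ q → colorMove F V i j χ = 0 := by
  induction N using Nat.strong_induction_on generalizing c ψ with
  | _ N ih =>
  by_cases hcon : ∀ i j, i < j → j < q → Filippov.colorMove F V i j ψ = 0
  · refine ⟨ψ, c, hψ, hc, he, hq, hbig, fun i j hij hj => ?_⟩
    rcases hj.lt_or_eq with hj | rfl
    · exact hcon i j hij hj
    · exact hl i hij
  push Not at hcon
  obtain ⟨i, j, hij, hj, h0⟩ := hcon
  have hc' := hc.colorMove i j
  have hsum : ∑ a ∈ Finset.range q, (a : ℤ) * (c + Pi.single i 1 - Pi.single j 1 : ℕ → ℤ) a =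
      ∑ a ∈ Finset.range q, (a : ℤ) * c a + i - j := by
    simp only [Pi.add_apply, Pi.sub_apply, mul_add, mul_sub, Finset.sum_add_distrib,
      Finset.sum_sub_distrib]
    congr 2
    · simp [Pi.single_apply, hij.trans hj]
    · simp [Pi.single_apply, hj]
  have hpos : 0 ≤ ∑ a ∈ Finset.range q, (a : ℤ) * (c + Pi.single i 1 - Pi.single j 1 : ℕ → ℤ) a :=
    Finset.sum_nonneg fun a _ => mul_nonneg (Int.natCast_nonneg a)
      (not_lt.1 fun h => h0 (hc'.eq_zero h))
  refine ih (N - 1) (by omega) h0 hc' (he.colorMove i j) ?_ (fun a ha => ?_) (fun l hlq => ?_)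
    (by omega)
  · simp [hj.ne', (hij.trans hj).ne', hq]
  · simp [hbig a ha, (hj.trans ha).ne', (hij.trans (hj.trans ha)).ne']
  -- The commutator of E_{lq} and E_{ij} is zero or -E_{iq}, so annihilation by all E_{lq} persists.
  · rw [← Module.End.mul_apply, colorMove_mul, if_neg (by omega)]
    simp only [LinearMap.sub_apply, add_zero, Module.End.mul_apply, hl l hlq, map_zero]
    split_ifs with h
    · simp [hl i (by omega)]
    · simp

/-- A descending Garnir-type argument. Symmetrizers of q + 1 letters vanish, and the highest weight
equations remove one letter at a time, working through colors 0 to q, until the empty symmetrizer,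
the identity, kills χ g. -/
theorem eq_zero_of_highestWeight {ρ : Representation F (Equiv.Perm X) V} {q : ℕ}
    (hρ : ∀ T : Finset X, T.card = q + 1 → symmetrizer ρ T = 0)
    {χ : (X → ℕ) → V} {c : ℕ → ℤ} (hc : HasWeight F c χ) (he : IsSignEquivariant ρ χ)
    (hq : 1 ≤ c q) (hbig : ∀ a, q < a → c a = 0)
    (hl : ∀ i j, i < j → j ≤ q → colorMove F V i j χ = 0) : χ = 0 := by
  by_contra hχ
  obtain ⟨g, hg⟩ := Function.ne_iff.1 hχ
  have hswap : ∀ i y, i < g y → χ g = ∑ x ∈ Finset.univ.filter (fun x => g x = i),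
      ρ (Equiv.swap x y) (χ g) := by
    intro i y hi
    have hy : g y ≤ q := by
      by_contra hy
      have h1 := hc.card_eq hg (g y)
      rw [hbig _ (by omega)] at h1
      simp only [Nat.cast_eq_zero, Finset.card_eq_zero, Finset.filter_eq_empty_iff] at h1
      exact h1 (Finset.mem_univ y) rfl
    -- E_{i, g y} χ = 0 is evaluated at the coloring with y recolored to i. Recoloring y back gives
    -- χ g; recoloring another letter x of color i gives g composed with the exchange of x and y,
    -- and sign-equivariance applies.
    have h1 := congrFun (hl i (g y) hi hy) (Function.update g y i)
    rw [colorMove_apply, ← Finset.add_sum_erase _ _ (Finset.mem_univ y), Function.update_self,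
      if_pos rfl, Function.update_idem, Function.update_eq_self, Pi.zero_apply] at h1
    refine (eq_neg_of_add_eq_zero_left h1).trans ?_
    rw [← Finset.sum_neg_distrib, Finset.sum_filter,
      ← Finset.add_sum_erase _ _ (Finset.mem_univ y), if_neg hi.ne', zero_add]
    refine Finset.sum_congr rfl fun x hx => ?_
    have hxy := (Finset.mem_erase.1 hx).1
    rw [Function.update_of_ne hxy]
    split_ifs with h2
    · have h3 : Function.update (Function.update g y i) x (g y) = g ∘ Equiv.swap x y := by
        ext z
        rcases eq_or_ne z x with rfl | hzx
        · simp
        rcases eq_or_ne z y with rfl | hzy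
        · simp [hzx, h2]
        · simp [hzx, hzy, Equiv.swap_apply_of_ne_of_ne hzx hzy]
      rw [h3]
      have h4 := he (Equiv.swap x y) (g ∘ Equiv.swap x y)
      rw [Function.comp_assoc, ← Equiv.coe_trans, Equiv.swap_swap, Equiv.Perm.sign_swap hxy] at h4
      rw [Equiv.coe_refl, Function.comp_id] at h4
      rw [h4]
      simp
    · simp
  have key : ∀ i ≤ q + 1, ∀ T : Finset X, (∀ x ∈ T, i ≤ g x) → T.card = q + 1 - i →
      symmetrizer ρ T (χ g) = 0 := by
    intro i
    induction i with
    | zero =>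
      intro _ T _ hT
      rw [hρ T hT, LinearMap.zero_apply]
    | succ i ih =>
      intro hi T hT hcard
      have h1 : ∀ x ∈ Finset.univ.filter (fun x => g x = i),
          symmetrizer ρ T (χ g + ∑ y ∈ T, ρ (Equiv.swap x y) (χ g)) = 0 := by
        intro x hx
        have hx' := (Finset.mem_filter.1 hx).2
        have hxT : x ∉ T := fun h => by
          have := hT x h
          omega
        rw [← symmetrizer_insert ρ hxT]
        refine ih (by omega) _ (fun z hz => ?_) ?_
        · rcases Finset.mem_insert.1 hz with rfl | hz
          · exact hx'.ge
          · exact (Nat.le_succ i).trans (hT z hz)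
        · rw [Finset.card_insert_of_notMem hxT, hcard]
          omega
      have h2 := Finset.sum_eq_zero h1
      rw [← map_sum, Finset.sum_add_distrib, Finset.sum_comm,
        Finset.sum_congr rfl fun y hy => (hswap i y (hT y hy)).symm, Finset.sum_const,
        Finset.sum_const, ← add_smul, map_nsmul, ← Nat.cast_smul_eq_nsmul F, smul_eq_zero] at h2
      -- The scalar is |T| plus the number of letters of color i. For i < q the set T is nonempty;
      -- for i = q it is empty, and c q ≥ 1 is needed.
      refine h2.resolve_left ?_
      rw [Nat.cast_eq_zero]
      have h3 := hc.card_eq hg i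
      rcases (Nat.lt_succ_iff.1 hi).lt_or_eq with h | rfl
      · omega
      · omega
  have := key (q + 1) le_rfl ∅ (by simp) (by simp)
  rw [symmetrizer_apply, show permsOn (∅ : Finset X) = {1} from ?_] at this
  · simp at this
    exact hg this
  · ext σ
    simp [mem_permsOn, Equiv.ext_iff]

end HighestWeight

/-! ### From exchange relations to vanishing of all fillings -/

section Straightening

/-- The positions of the letters in a left-normed bracket with `k` brackets of arity `n + 1`. -/
abbrev Pos (k n : ℕ) : Type := Option (Fin k × Fin n)

/-- The number of the row of a position; the initial position belongs to row zero. -/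
def rowOf {k n : ℕ} : Pos k n → ℕ
  | none => 0
  | some p => p.1

/-- The exchange of two rows of positions. -/
def rowSwap {k : ℕ} (n : ℕ) (j j' : Fin k) : Equiv.Perm (Pos k n) :=
  ((Equiv.swap j j').prodCongr (Equiv.refl (Fin n))).optionCongr

@[simp]
theorem rowSwap_none {k n : ℕ} (j j' : Fin k) : rowSwap n j j' none = none := rfl

@[simp]
theorem rowSwap_some {k n : ℕ} (j j' : Fin k) (p : Fin k × Fin n) :
    rowSwap n j j' (some p) = some (Equiv.swap j j' p.1, p.2) := rfl

theorem rowSwap_symm {k n : ℕ} (j j' : Fin k) : (rowSwap n j j').symm = rowSwap n j j' := by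
  ext p : 1
  rcases p with _ | p
  · rfl
  · rw [Equiv.symm_apply_eq]
    simp

theorem sum_rowOf {k n : ℕ} {M : Type*} [AddCommMonoid M] (j : Fin k) (f : Pos k n → M) :
    ∑ p, (if rowOf p = j then f p else 0) =
      (if (j : ℕ) = 0 then f none else 0) + ∑ i, f (some (j, i)) := by
  rw [Fintype.sum_option, Fintype.sum_prod_type, Finset.sum_eq_single_of_mem j (Finset.mem_univ j)]
  · simp [rowOf, eq_comm]
  · intro j' _ hj'
    refine Finset.sum_eq_zero fun i _ => if_neg ?_
    simpa [rowOf, Fin.val_inj] using hj'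

theorem card_rowOf {k n : ℕ} (j : Fin k) :
    (Finset.univ.filter fun p : Pos k n => rowOf p = j).card = (if (j : ℕ) = 0 then 1 else 0) + n := by
  rw [Finset.card_filter, sum_rowOf]
  simp

theorem rowOf_lt {k n : ℕ} (hk : 1 ≤ k) (p : Pos k n) : rowOf p < k := by
  rcases p with _ | p
  · exact hk
  · exact p.1.2

variable {F : Type*} [Field F] {X : Type} [Fintype X] [DecidableEq X] {V : Type*}
  [AddCommGroup V] [Module F V] {k n : ℕ}

/-- The sign of a filling of the positions relative to a fixed one. -/
def fillSign (F : Type*) [Field F] (e : X ≃ Pos k n) (σ : Pos k n ≃ X) : F :=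
  ((Equiv.Perm.sign (σ.trans e) : ℤ) : F)

omit [Fintype X] [DecidableEq X] in
theorem fillSign_trans_left (e : X ≃ Pos k n) (p : Equiv.Perm (Pos k n)) (σ : Pos k n ≃ X) :
    fillSign F e (p.trans σ) = ((Equiv.Perm.sign p : ℤ) : F) * fillSign F e σ := by
  rw [fillSign, fillSign, show (p.trans σ).trans e = (σ.trans e) * p from rfl,
    Equiv.Perm.sign_mul, mul_comm]
  push_cast
  rfl

theorem fillSign_trans_right (e : X ≃ Pos k n) (π : Equiv.Perm X) (σ : Pos k n ≃ X) :
    fillSign F e (σ.trans π) = ((Equiv.Perm.sign π : ℤ) : F) * fillSign F e σ := by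
  rw [fillSign, fillSign, show (σ.trans π).trans e = ((e.symm.trans π).trans e) * (σ.trans e) from ?_,
    Equiv.Perm.sign_mul, Equiv.Perm.sign_symm_trans_trans]
  · push_cast
    rfl
  · ext p : 1
    simp

theorem sign_mul_self_cast {Y : Type*} [Fintype Y] [DecidableEq Y] (π : Equiv.Perm Y) :
    ((Equiv.Perm.sign π : ℤ) : F) * ((Equiv.Perm.sign π : ℤ) : F) = 1 := by
  rcases Int.units_eq_one_or (Equiv.Perm.sign π) with h | h <;> simp [h]

omit [Fintype X] [DecidableEq X] in
theorem fillSign_mul_self (e : X ≃ Pos k n) (σ : Pos k n ≃ X) :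
    fillSign F e σ * fillSign F e σ = 1 := sign_mul_self_cast _

variable {C : (Pos k n ≃ X) → V}

omit [Fintype X] [DecidableEq X] in
-- Row-preserving permutations are products of exchanges within rows, each changing both signs; the
-- induction is on the support. Hence the signed value depends only on the coloring by rows.
theorem fillSign_smul_trans_of_rowOf (e : X ≃ Pos k n)
    (halt : ∀ (σ : Pos k n ≃ X) p p', p ≠ p' → rowOf p = rowOf p' →
      C ((Equiv.swap p p').trans σ) = - C σ) (N : ℕ) :
    ∀ (p : Equiv.Perm (Pos k n)) (σ : Pos k n ≃ X), (∀ x, rowOf (p x) = rowOf x) →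
      p.support.card ≤ N → fillSign F e (p.trans σ) • C (p.trans σ) = fillSign F e σ • C σ := by
  induction N with
  | zero =>
    intro p σ _ hN
    rw [Nat.le_zero, Finset.card_eq_zero, Equiv.Perm.support_eq_empty_iff] at hN
    subst hN
    rfl
  | succ N ih =>
    intro p σ hp hN
    by_cases h1 : p = 1
    · subst h1
      rfl
    · obtain ⟨x, hx⟩ : ∃ x, p x ≠ x := by
        by_contra h
        push Not at h
        exact h1 (Equiv.ext h)
      have h2 := ih (Equiv.swap x (p x) * p) ((Equiv.swap x (p x)).trans σ) (fun z => by
        rw [Equiv.Perm.mul_apply, ← hp z]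
        generalize p z = y
        rcases eq_or_ne y x with rfl | h3
        · simp [hp]
        rcases eq_or_ne y (p x) with rfl | h4
        · simp [hp]
        · rw [Equiv.swap_apply_of_ne_of_ne h3 h4])
        (by have := Equiv.Perm.card_support_swap_mul hx; omega)
      have h3 : (Equiv.swap x (p x) * p).trans ((Equiv.swap x (p x)).trans σ) = p.trans σ := by
        ext z
        simp
      rw [h3, halt σ x (p x) hx.symm (hp x).symm, fillSign_trans_left e (Equiv.swap x (p x)),
        Equiv.Perm.sign_swap hx.symm] at h2
      rw [h2]
      simp

/-- The function of the colorings determined by an alternating function of the fillings. -/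
noncomputable def fillingFunction (F : Type*) [Field F] {V : Type*} [AddCommGroup V] [Module F V]
    (e : X ≃ Pos k n) (C : (Pos k n ≃ X) → V) (g : X → ℕ) : V :=
  open Classical in if h : ∃ σ : Pos k n ≃ X, g = rowOf ∘ σ.symm then
    fillSign F e h.choose • C h.choose else 0

theorem fillingFunction_apply (e : X ≃ Pos k n)
    (halt : ∀ (σ : Pos k n ≃ X) p p', p ≠ p' → rowOf p = rowOf p' →
      C ((Equiv.swap p p').trans σ) = - C σ) (σ : Pos k n ≃ X) {g : X → ℕ}
    (hg : g = rowOf ∘ σ.symm) :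
    fillingFunction F e C g = fillSign F e σ • C σ := by
  have h : ∃ σ : Pos k n ≃ X, g = rowOf ∘ σ.symm := ⟨σ, hg⟩
  rw [fillingFunction, dif_pos h]
  have h1 := h.choose_spec
  set σ' := h.choose
  have h2 := fillSign_smul_trans_of_rowOf (F := F) e halt _ (σ'.trans σ.symm) σ (fun x => by
    have h3 := congrFun (hg.symm.trans h1) (σ' x)
    simpa using h3) le_rfl
  rwa [show (σ'.trans σ.symm).trans σ = σ' from by ext; simp] at h2

omit [DecidableEq X] in
theorem exists_filling {g : X → ℕ}
    (hg : ∀ a, (Finset.univ.filter fun x => g x = a).card =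
      (Finset.univ.filter fun p : Pos k n => rowOf p = a).card) :
    ∃ σ : Pos k n ≃ X, g = rowOf ∘ σ.symm := by
  let f : ∀ a, {p : Pos k n // rowOf p = a} ≃ {x // g x = a} := fun a =>
    Fintype.equivOfCardEq (by rw [Fintype.card_subtype, Fintype.card_subtype, hg a])
  refine ⟨Equiv.ofFiberEquiv f, ?_⟩
  ext x
  obtain ⟨p, rfl⟩ := (Equiv.ofFiberEquiv f).surjective x
  rw [Function.comp_apply, Equiv.symm_apply_apply]
  exact Equiv.ofFiberEquiv_map f p

/-- The numbers of positions in the rows. -/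
def rowWeight (k n : ℕ) (a : ℕ) : ℤ := (if a = 0 then 1 else 0) + if a < k then (n : ℤ) else 0

theorem card_rowOf_eq_rowWeight (hk : 1 ≤ k) (a : ℕ) :
    ((Finset.univ.filter fun p : Pos k n => rowOf p = a).card : ℤ) = rowWeight k n a := by
  by_cases ha : a < k
  · rw [card_rowOf ⟨a, ha⟩]
    simp [rowWeight, ha]
  · rw [rowWeight, if_neg ha, if_neg (by omega), add_zero, Nat.cast_eq_zero, Finset.card_eq_zero,
      Finset.filter_eq_empty_iff]
    intro p _ h
    exact ha (h ▸ rowOf_lt hk p)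

theorem hasWeight_fillingFunction (hk : 1 ≤ k) (e : X ≃ Pos k n) (C : (Pos k n ≃ X) → V) :
    HasWeight F (rowWeight k n) (fillingFunction F e C) := by
  intro a
  ext g
  rw [colorMove_self_apply, Pi.smul_apply]
  by_cases h : ∃ σ : Pos k n ≃ X, g = rowOf ∘ σ.symm
  · obtain ⟨σ, rfl⟩ := h
    congr 1
    rw [← card_rowOf_eq_rowWeight hk a, Int.cast_natCast, Finset.card_filter, Finset.card_filter,
      ← Equiv.sum_comp σ]
    simp
  · rw [fillingFunction, dif_neg h, smul_zero, smul_zero]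

theorem isSignEquivariant_fillingFunction {ρ : Representation F (Equiv.Perm X) V} (e : X ≃ Pos k n)
    (halt : ∀ (σ : Pos k n ≃ X) p p', p ≠ p' → rowOf p = rowOf p' →
      C ((Equiv.swap p p').trans σ) = - C σ)
    (hC : ∀ (σ : Pos k n ≃ X) (π : Equiv.Perm X), C (σ.trans π) = ρ π (C σ)) :
    IsSignEquivariant ρ (fillingFunction F e C) := by
  intro π g
  by_cases h : ∃ σ : Pos k n ≃ X, g = rowOf ∘ σ.symm
  · obtain ⟨σ, rfl⟩ := h
    rw [fillingFunction_apply e halt σ rfl,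
      fillingFunction_apply e halt (σ.trans π.symm) (g := (rowOf ∘ σ.symm) ∘ π) rfl, map_smul, ← hC, fillSign_trans_right, Equiv.trans_assoc, Equiv.symm_trans_self,
      Equiv.trans_refl, Equiv.Perm.sign_symm, mul_smul]
  · rw [fillingFunction, dif_neg, map_zero, fillingFunction, dif_neg h, smul_zero]
    rintro ⟨σ, hσ⟩
    refine h ⟨σ.trans π, ?_⟩
    ext x
    have := congrFun hσ (π.symm x)
    simpa using this

variable [CharZero F]

/-- A function of this weight vanishes on every coloring with other color counts, and colorings with
the right counts come from fillings. -/
theorem HasWeight.ext_fillings (hk : 1 ≤ k) {φ χ : (X → ℕ) → V}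
    (hφ : HasWeight F (rowWeight k n) φ) (hχ : HasWeight F (rowWeight k n) χ)
    (h : ∀ σ : Pos k n ≃ X, φ (rowOf ∘ σ.symm) = χ (rowOf ∘ σ.symm)) : φ = χ := by
  ext g
  by_cases h1 : ∃ σ : Pos k n ≃ X, g = rowOf ∘ σ.symm
  · obtain ⟨σ, rfl⟩ := h1
    exact h σ
  · have h2 : ∀ ψ : (X → ℕ) → V, HasWeight F (rowWeight k n) ψ → ψ g = 0 := by
      intro ψ hψ
      by_contra h3
      refine h1 (exists_filling fun a => ?_)
      have := hψ.card_eq h3 a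
      rw [← card_rowOf_eq_rowWeight hk] at this
      exact_mod_cast this
    rw [h2 φ hφ, h2 χ hχ]

section Relations

variable (e : X ≃ Pos k n)
    (halt : ∀ (σ : Pos k n ≃ X) p p', p ≠ p' → rowOf p = rowOf p' →
      C ((Equiv.swap p p').trans σ) = - C σ)

include halt

/-- The relation says that φ equals, up to the sign ε of the row exchange, E_{10} φ with colors 0
and 1 interchanged. Using it twice gives φ = E_{01} E_{10} φ, and weights then force E_{01} φ = 0.
-/
theorem colorMove_fillingFunction_eq_zero (hk : 2 ≤ k)
    (h1 : ∀ σ : Pos k n ≃ X, C σ = C ((rowSwap n ⟨0, by omega⟩ ⟨1, by omega⟩).trans σ) -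
      ∑ i, C (((rowSwap n ⟨0, by omega⟩ ⟨1, by omega⟩).trans
        (Equiv.swap none (some (⟨0, by omega⟩, i)))).trans σ)) :
    colorMove F V 0 1 (fillingFunction F e C) = 0 := by
  set φ := fillingFunction F e C with hφdef
  have hφ : HasWeight F (rowWeight k n) φ := hasWeight_fillingFunction (by omega) e C
  set s : Equiv.Perm ℕ := Equiv.swap 0 1 with hs
  set p0 : Equiv.Perm (Pos k n) := rowSwap n ⟨0, by omega⟩ ⟨1, by omega⟩ with hp0
  set ε : F := ((Equiv.Perm.sign p0 : ℤ) : F)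
  have hεε : ε * ε = 1 := sign_mul_self_cast p0
  have hF := hφ.colorMove 1 0
  have key : φ = ε • relabel F X V s (colorMove F V 1 0 φ) := by
    refine HasWeight.ext_fillings (F := F) (k := k) (n := n) (by omega) hφ (fun a => ?_) fun σ => ?_
    · have hw : (rowWeight k n + Pi.single 1 1 - Pi.single 0 1) ∘ s = rowWeight k n := by
        ext a
        simp only [Function.comp_apply, Pi.add_apply, Pi.sub_apply, Pi.single_apply, rowWeight, hs]
        rcases a with _ | _ | a
        · simp [show 0 < k by omega, show 1 < k by omega, add_comm]
        · simp [show 0 < k by omega, show 1 < k by omega]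
        · rw [Equiv.swap_apply_of_ne_of_ne (by omega) (by omega)]
          simp
      have h3 := hF.relabel s a
      rw [hw] at h3
      rw [map_smul, h3, smul_comm]
    · rw [Pi.smul_apply, relabel_apply, colorMove_apply, ← Equiv.sum_comp σ]
      have h2 : ∀ p : Pos k n, (if (s ∘ rowOf ∘ σ.symm) (σ p) = 1 then
          φ (Function.update (s ∘ rowOf ∘ σ.symm) (σ p) 0) else 0) =
          if rowOf p = ((⟨0, by omega⟩ : Fin k) : ℕ) then
            φ (Function.update (s ∘ rowOf) p 0 ∘ σ.symm) else 0 := by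
        intro p
        rw [Function.update_comp_equiv]
        refine if_congr ?_ rfl rfl
        rw [Function.comp_apply, Function.comp_apply, Equiv.symm_apply_apply, hs,
          Equiv.swap_apply_eq_iff, Equiv.swap_apply_right]
      rw [Finset.sum_congr rfl fun p _ => h2 p, sum_rowOf, if_pos rfl]
      have h3 : ∀ p : Pos k n, rowOf (p0 p) = s (rowOf p) ∨ p = none := by
        intro p
        rcases p with _ | ⟨j, i⟩
        · exact Or.inr rfl
        · left
          rw [hp0, rowSwap_some]
          simp only [rowOf, hs]
          simp only [Equiv.swap_apply_def, Fin.ext_iff]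
          split_ifs <;> rfl
      have h4 : Function.update (s ∘ rowOf) none 0 = rowOf ∘ p0.symm := by
        ext p
        rw [hp0, rowSwap_symm, ← hp0]
        rcases p with _ | p
        · simp [hp0, rowOf]
        · rw [Function.update_of_ne (by simp)]
          exact ((h3 (some p)).resolve_right (by simp)).symm
      have h5 : ∀ i, Function.update (s ∘ rowOf) (some (⟨0, by omega⟩, i)) 0 =
          rowOf ∘ (p0.trans (Equiv.swap none (some (⟨0, by omega⟩, i)))).symm := by
        intro i
        ext p
        change _ = rowOf (p0.symm ((Equiv.swap none (some (⟨0, by omega⟩, i))).symm p))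
        rw [Equiv.symm_swap, hp0, rowSwap_symm]
        rcases eq_or_ne p (some (⟨0, by omega⟩, i)) with rfl | hp
        · simp [rowOf]
        rw [Function.update_of_ne hp]
        rcases eq_or_ne p none with rfl | hp'
        · simp [rowOf, hs]
        · rw [Equiv.swap_apply_of_ne_of_ne hp' hp]
          exact ((h3 p).resolve_right hp').symm
      rw [h4, hφdef, fillingFunction_apply e halt (p0.trans σ) (g := (rowOf ∘ p0.symm) ∘ σ.symm) rfl,
        fillingFunction_apply e halt σ rfl, ← hφdef]
      simp only [h5]
      have h6 : ∀ i, φ ((rowOf ∘ (p0.trans (Equiv.swap none (some (⟨0, by omega⟩, i)))).symm) ∘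
          σ.symm) = - (ε * fillSign F e σ) • C ((p0.trans
            (Equiv.swap none (some (⟨0, by omega⟩, i)))).trans σ) := by
        intro i
        rw [hφdef, fillingFunction_apply e halt
          ((p0.trans (Equiv.swap none (some (⟨0, by omega⟩, i)))).trans σ)
          (g := (rowOf ∘ (p0.trans (Equiv.swap none (some (⟨0, by omega⟩, i)))).symm) ∘ σ.symm) rfl,
          Equiv.trans_assoc, fillSign_trans_left, fillSign_trans_left,
          Equiv.Perm.sign_swap (by simp)]
        simp [ε]
      simp only [h6, fillSign_trans_left]
      rw [← Finset.smul_sum, neg_smul, ← sub_eq_add_neg, ← smul_sub, ← h1 σ, smul_smul, ← mul_assoc,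
        hεε, one_mul]
  have h2 : φ = colorMove F V 0 1 (colorMove F V 1 0 φ) := by
    have h3 : relabel F X V s φ = ε • colorMove F V 1 0 φ := by
      rw [key, map_smul, ← key]
      congr 1
      ext g
      rw [relabel_apply, relabel_apply, ← Function.comp_assoc, ← Equiv.Perm.coe_mul, hs,
        Equiv.swap_mul_self]
      rfl
    nth_rw 1 [key]
    have := relabel_colorMove (F := F) (V := V) s 0 1 φ
    rw [show s 0 = 1 from Equiv.swap_apply_left _ _, show s 1 = 0 from Equiv.swap_apply_right _ _]
      at this
    rw [this, h3, map_smul, smul_smul, hεε, one_smul]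
  -- Row 0 has one position more than row 1, so the commutator of E_{01} and E_{10} acts on φ as 1.
  have h7 : colorMove F V 1 0 (colorMove F V 0 1 φ) = 0 := by
    have h8 : colorMove F V 0 1 (colorMove F V 1 0 φ) = colorMove F V 1 0 (colorMove F V 0 1 φ) + φ := by
      rw [← Module.End.mul_apply, colorMove_mul]
      simp only [if_true, LinearMap.sub_apply, LinearMap.add_apply, Module.End.mul_apply]
      rw [hφ 0, hφ 1]
      simp [rowWeight, show 0 < k by omega, show 1 < k by omega]
      module
    rw [← h2] at h8
    simpa using h8
  refine (hφ.colorMove 0 1).eq_zero_of_colorMove_eq_zero (a := 0) (b := 1) (by simp) ?_ h7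
  simp [rowWeight, show 0 < k by omega, show 1 < k by omega]
  omega

/-- Put E = E_{j,j+1} and G = E_{j+1,j}. The relation expresses the interchange of the two colors as
ε(1 - EG) on φ. Since the interchange is an involution, (1 - GE)(1 - EG) fixes φ; the two rows have
equal length, so EG = GE on φ, and this reduces to G² E² φ = 0. Two weight arguments remove G². -/
theorem colorMove_colorMove_fillingFunction_eq_zero {j : ℕ} (hj : 1 ≤ j) (hjk : j + 1 < k)
    (h2 : ∀ σ : Pos k n ≃ X, C ((rowSwap n ⟨j, by omega⟩ ⟨j + 1, hjk⟩).trans σ) =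
      C σ - n • C σ + ∑ i, ∑ i', C ((Equiv.swap (some (⟨j, by omega⟩, i))
        (some (⟨j + 1, hjk⟩, i'))).trans σ)) :
    colorMove F V j (j + 1) (colorMove F V j (j + 1) (fillingFunction F e C)) = 0 := by
  set φ := fillingFunction F e C with hφdef
  have hφ : HasWeight F (rowWeight k n) φ := hasWeight_fillingFunction (by omega) e C
  set s : Equiv.Perm ℕ := Equiv.swap j (j + 1) with hs
  set p0 : Equiv.Perm (Pos k n) := rowSwap n ⟨j, by omega⟩ ⟨j + 1, hjk⟩ with hp0
  set ε : F := ((Equiv.Perm.sign p0 : ℤ) : F)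
  have hεε : ε * ε = 1 := sign_mul_self_cast p0
  have hwj : rowWeight k n j = n := by simp [rowWeight, show j ≠ 0 by omega, show j < k by omega]
  have hwj' : rowWeight k n (j + 1) = n := by simp [rowWeight, hjk]
  have key : relabel F X V s φ = ε • (φ - colorMove F V j (j + 1) (colorMove F V (j + 1) j φ)) := by
    refine HasWeight.ext_fillings (F := F) (k := k) (n := n) (by omega) ?_ ?_ fun σ => ?_
    · convert hφ.relabel s using 1
      ext a
      rw [Function.comp_apply]
      by_cases h3 : a = j
      · rw [h3, hs, Equiv.swap_apply_left, hwj, hwj']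
      by_cases h4 : a = j + 1
      · rw [h4, hs, Equiv.swap_apply_right, hwj, hwj']
      · rw [hs, Equiv.swap_apply_of_ne_of_ne h3 h4]
    · intro a
      have h3 := (hφ.colorMove (j + 1) j).colorMove j (j + 1) a
      rw [map_smul, map_sub, h3, hφ a, smul_comm, smul_sub]
      simp only [add_sub_cancel_right, sub_add_cancel]
      rw [smul_sub, smul_sub]
    · have h3 : relabel F X V s φ (rowOf ∘ σ.symm) = ε • (fillSign F e σ • C (p0.trans σ)) := by
        rw [relabel_apply, hφdef, fillingFunction_apply e halt (p0.trans σ), fillSign_trans_left,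
          mul_smul]
        ext x
        change s (rowOf (σ.symm x)) = rowOf (p0.symm (σ.symm x))
        rw [hp0, rowSwap_symm]
        generalize σ.symm x = p
        rcases p with _ | ⟨l, i⟩
        · exact Equiv.swap_apply_of_ne_of_ne (show 0 ≠ j by omega) (show 0 ≠ j + 1 by omega)
        · simp only [rowSwap_some, rowOf, hs, Equiv.swap_apply_def, Fin.ext_iff]
          split_ifs <;> rfl
      have h4 : ∀ p p' : Pos k n, (if σ p ≠ σ p' ∧ (rowOf ∘ σ.symm) (σ p) = j ∧
          (rowOf ∘ σ.symm) (σ p') = j + 1 then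
          φ (Function.update (Function.update (rowOf ∘ σ.symm) (σ p) (j + 1)) (σ p') j) else 0) =
          if rowOf p = ((⟨j, by omega⟩ : Fin k) : ℕ) then
            (if rowOf p' = ((⟨j + 1, hjk⟩ : Fin k) : ℕ) then
              - (fillSign F e σ • C ((Equiv.swap p p').trans σ)) else 0) else 0 := by
        intro p p'
        simp only [Function.comp_apply, Equiv.symm_apply_apply]
        by_cases h5 : rowOf p = j
        · by_cases h6 : rowOf p' = j + 1
          · have h7 : p ≠ p' := by
              rintro rfl
              omega
            rw [if_pos ⟨fun h => h7 (σ.injective h), h5, h6⟩, if_pos h5, if_pos h6, hφdef,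
              fillingFunction_apply e halt ((Equiv.swap p p').trans σ), fillSign_trans_left,
              Equiv.Perm.sign_swap h7]
            · simp
            · ext x
              obtain ⟨z, rfl⟩ := σ.surjective x
              change _ = rowOf ((Equiv.swap p p').symm (σ.symm (σ z)))
              rw [Equiv.symm_swap, Equiv.symm_apply_apply]
              rcases eq_or_ne z p' with rfl | hz'
              · simp [h5]
              rw [Function.update_of_ne (fun h => hz' (σ.injective h))]
              rcases eq_or_ne z p with rfl | hz
              · simp [h6]
              rw [Function.update_of_ne (fun h => hz (σ.injective h)),
                Equiv.swap_apply_of_ne_of_ne hz hz', Function.comp_apply, Equiv.symm_apply_apply]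
          · rw [if_neg fun h => h6 h.2.2, if_pos h5, if_neg h6]
        · rw [if_neg fun h => h5 h.2.1, if_neg h5]
      rw [h3, h2 σ, Pi.smul_apply, Pi.sub_apply, ← Module.End.mul_apply, colorMove_mul_aux,
        if_pos rfl, hφ j, hwj, ← Equiv.sum_comp σ]
      simp only [← Equiv.sum_comp σ (fun y => ite (_ ≠ y ∧ _ ∧ _) _ _), h4]
      have h5 : ∀ p : Pos k n, ∑ p' : Pos k n,
          (if rowOf p = ((⟨j, by omega⟩ : Fin k) : ℕ) then
            (if rowOf p' = ((⟨j + 1, hjk⟩ : Fin k) : ℕ) then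
              - (fillSign F e σ • C ((Equiv.swap p p').trans σ)) else 0) else 0) =
          if rowOf p = ((⟨j, by omega⟩ : Fin k) : ℕ) then
            ∑ i', - (fillSign F e σ • C ((Equiv.swap p (some (⟨j + 1, hjk⟩, i'))).trans σ))
            else 0 := by
        intro p
        split_ifs
        · rw [sum_rowOf, if_neg (by simp), zero_add]
        · simp
      rw [Finset.sum_congr rfl fun p _ => h5 p]
      rw [sum_rowOf, if_neg (by simp; omega), zero_add, Pi.smul_apply, hφdef,
        fillingFunction_apply e halt σ rfl]
      simp only [Finset.sum_neg_distrib, ← Finset.smul_sum]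
      rw [Int.cast_natCast, ← Nat.cast_smul_eq_nsmul F n]
      module
  have key2 : φ = ε • (relabel F X V s φ -
      colorMove F V (j + 1) j (colorMove F V j (j + 1) (relabel F X V s φ))) := by
    have h3 := congrArg (relabel F X V s) key
    have h4 : relabel F X V s (relabel F X V s φ) = φ := by
      ext g
      rw [relabel_apply, relabel_apply, ← Function.comp_assoc, ← Equiv.Perm.coe_mul, hs,
        Equiv.swap_mul_self]
      rfl
    have h5 := relabel_colorMove (F := F) (V := V) s (j + 1) j (colorMove F V (j + 1) j φ)
    have h6 := relabel_colorMove (F := F) (V := V) s j (j + 1) φ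
    rw [show s j = j + 1 from Equiv.swap_apply_left _ _,
      show s (j + 1) = j from Equiv.swap_apply_right _ _] at h5 h6
    rw [h4, map_smul, map_sub, h5, h6] at h3
    exact h3
  have hcomm : colorMove F V j (j + 1) (colorMove F V (j + 1) j φ) =
      colorMove F V (j + 1) j (colorMove F V j (j + 1) φ) := by
    rw [← Module.End.mul_apply, colorMove_mul]
    simp only [if_true, LinearMap.sub_apply, LinearMap.add_apply, Module.End.mul_apply]
    rw [hφ j, hφ (j + 1), hwj, hwj', add_sub_cancel_right]
  have hw1 := hφ.colorMove j (j + 1)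
  have hw2 := hw1.colorMove j (j + 1)
  -- E φ has one letter more in row j and one fewer in row j + 1, which gives the commutator
  -- eigenvalue 2.
  have hcomm2 : colorMove F V j (j + 1) (colorMove F V (j + 1) j (colorMove F V j (j + 1) φ)) =
      colorMove F V (j + 1) j (colorMove F V j (j + 1) (colorMove F V j (j + 1) φ)) +
        (2 : F) • colorMove F V j (j + 1) φ := by
    rw [← Module.End.mul_apply, colorMove_mul]
    simp only [if_true, LinearMap.sub_apply, LinearMap.add_apply, Module.End.mul_apply]
    rw [hw1 j, hw1 (j + 1)]
    simp [hwj, hwj']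
    module
  rw [key, map_smul, map_smul, ← smul_sub, smul_smul, hεε, one_smul, map_sub, map_sub, hcomm, hcomm2,
    map_add, map_smul] at key2
  set A := colorMove F V (j + 1) j (colorMove F V j (j + 1) φ) with hA
  have h8 : colorMove F V (j + 1) j (colorMove F V (j + 1) j
      (colorMove F V j (j + 1) (colorMove F V j (j + 1) φ))) = 0 := by
    have : φ - A - (A - (colorMove F V (j + 1) j (colorMove F V (j + 1) j
      (colorMove F V j (j + 1) (colorMove F V j (j + 1) φ))) + (2 : F) • A)) - φ = 0 :=
      sub_eq_zero.2 key2.symm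
    rw [← this]
    module
  have h9 := (hw2.colorMove (j + 1) j).eq_zero_of_colorMove_eq_zero (a := j) (b := j + 1)
    (by omega) (by simp [hwj, hwj']) h8
  exact hw2.eq_zero_of_colorMove_eq_zero (a := j) (b := j + 1) (by omega)
    (by simp [hwj, hwj']; omega) h9

end Relations

/-- A nonzero φ would survive some product of d < q operators E_{lq} and give a vector annihilated
by them all. Row q ≥ 1 had n letters and has lost d ≤ q - 1 of them, so k = q + 1 ≤ n + 1 leaves at
least one, and the highest weight argument applies. For q = 0 no operators are needed. -/
theorem eq_zero_of_straightening {ρ : Representation F (Equiv.Perm X) V} (hk : 1 ≤ k)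
    (hkn : k ≤ n + 1) (e : X ≃ Pos k n)
    (hρ : ∀ T : Finset X, T.card = k → symmetrizer ρ T = 0)
    (hC : ∀ (σ : Pos k n ≃ X) (π : Equiv.Perm X), C (σ.trans π) = ρ π (C σ))
    (halt : ∀ (σ : Pos k n ≃ X) p p', p ≠ p' → rowOf p = rowOf p' →
      C ((Equiv.swap p p').trans σ) = - C σ)
    (h1 : ∀ (hk : 2 ≤ k) (σ : Pos k n ≃ X), C σ =
      C ((rowSwap n ⟨0, by omega⟩ ⟨1, by omega⟩).trans σ) -
      ∑ i, C (((rowSwap n ⟨0, by omega⟩ ⟨1, by omega⟩).trans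
        (Equiv.swap none (some (⟨0, by omega⟩, i)))).trans σ))
    (h2 : ∀ (j : ℕ) (hjk : j + 1 < k), 1 ≤ j →
      ∀ σ : Pos k n ≃ X, C ((rowSwap n ⟨j, by omega⟩ ⟨j + 1, hjk⟩).trans σ) =
      C σ - n • C σ + ∑ i, ∑ i', C ((Equiv.swap (some (⟨j, by omega⟩, i))
        (some (⟨j + 1, hjk⟩, i'))).trans σ)) (σ : Pos k n ≃ X) : C σ = 0 := by
  obtain ⟨q, rfl⟩ : ∃ q, k = q + 1 := ⟨k - 1, by omega⟩
  set φ := fillingFunction F e C with hφdef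
  have hφ : HasWeight F (rowWeight (q + 1) n) φ := hasWeight_fillingFunction hk e C
  have hφe : IsSignEquivariant ρ φ := isSignEquivariant_fillingFunction e halt hC
  have hbig : ∀ a, q < a → rowWeight (q + 1) n a = 0 := by
    intro a ha
    simp [rowWeight, show a ≠ 0 by omega, show ¬ a ≤ q by omega]
  suffices hφ0 : φ = 0 by
    have h3 := congrFun hφ0 (rowOf ∘ σ.symm)
    rw [hφdef, fillingFunction_apply e halt σ rfl, Pi.zero_apply, smul_eq_zero] at h3
    refine h3.resolve_left fun h4 => ?_
    have := fillSign_mul_self (F := F) e σ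
    simp [h4] at this
  by_contra hφ0
  rcases Nat.eq_zero_or_pos q with rfl | hq
  · exact hφ0 (eq_zero_of_highestWeight hρ hφ hφe (by simp [rowWeight]) hbig
      fun i j h3 h4 => by omega)
  obtain ⟨d, r, hd, hr, hr0, hl⟩ := exists_isMoveProd hφ0 fun r hr => hr.apply_eq_zero hq
    (colorMove_fillingFunction_eq_zero e halt (by omega) (h1 (by omega)))
    fun j hj hjq => colorMove_colorMove_fillingFunction_eq_zero e halt hj (by omega)
      (h2 j (by omega) hj)
  obtain ⟨c, hc, hcq, hca⟩ := hr.hasWeight hφ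
  have hcq' : 1 ≤ c q := by
    rw [hcq]
    simp [rowWeight, show q ≠ 0 by omega]
    omega
  obtain ⟨χ, c', hχ0, hc', he', hq', hbig', hl'⟩ := exists_highestWeight ρ q _ hr0 hc
    (hr.isSignEquivariant hφe) hcq' (fun a ha => (hca a ha).trans (hbig a ha)) hl
    (Int.self_le_toNat _)
  exact hχ0 (eq_zero_of_highestWeight hρ hc' he' hq' hbig' hl')

end Straightening

/-! ### Left-normed brackets indexed by finitely many positions -/

section CombOf

variable {F : Type*} [Field F] {n k : ℕ} {L : Type*} [AddCommGroup L] [Module F L]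

/-- The inclusion of the positions in `k` rows into the positions in infinitely many rows. -/
def posIncl (k n : ℕ) : Pos k n → Option (ℕ × Fin n) := Option.map (Prod.map Fin.val id)

theorem posIncl_injective (k n : ℕ) : Function.Injective (posIncl k n) :=
  Option.map_injective (Fin.val_injective.prodMap Function.injective_id)

@[simp]
theorem posIncl_none : posIncl k n none = none := rfl

@[simp]
theorem posIncl_some (j : Fin k) (i : Fin n) :
    posIncl k n (some (j, i)) = some ((j : ℕ), i) := rfl

/-- The left-normed bracket with `k` brackets of the given elements. -/
noncomputable def combOf (B : L [⋀^Fin (n + 1)]→ₗ[F] L) (f : Pos k n → L) : L :=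
  combValue B (Function.extend (posIncl k n) f 0) k

theorem combValue_eq_combOf (B : L [⋀^Fin (n + 1)]→ₗ[F] L) {a : Option (ℕ × Fin n) → L}
    {f : Pos k n → L} (h : ∀ p, a (posIncl k n p) = f p) : combValue B a k = combOf B f := by
  have h2 : ∀ p, Function.extend (posIncl k n) f 0 (posIncl k n p) = f p :=
    (posIncl_injective k n).extend_apply f 0
  refine combValue_congr B ?_ fun j i hj => ?_
  · exact (h none).trans (h2 none).symm
  · exact (h (some (⟨j, hj⟩, i))).trans (h2 (some (⟨j, hj⟩, i))).symm

theorem extend_comp_eq (f : Pos k n → L) {P : Equiv.Perm (Option (ℕ × Fin n))}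
    {P' : Equiv.Perm (Pos k n)} (h : ∀ p, P (posIncl k n p) = posIncl k n (P' p)) (p : Pos k n) :
    (Function.extend (posIncl k n) f 0 ∘ P) (posIncl k n p) = (f ∘ P') p := by
  rw [Function.comp_apply, h, (posIncl_injective k n).extend_apply, Function.comp_apply]

theorem swap_posIncl (p p' q : Pos k n) : Equiv.swap (posIncl k n p) (posIncl k n p')
    (posIncl k n q) = posIncl k n (Equiv.swap p p' q) :=
  ((posIncl_injective k n).map_swap p p' q).symm

theorem swapRows_posIncl {j : ℕ} (hj : j + 1 < k) (p : Pos k n) :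
    swapRows n j (posIncl k n p) = posIncl k n (rowSwap n ⟨j, by omega⟩ ⟨j + 1, hj⟩ p) := by
  rcases p with _ | ⟨l, i⟩
  · rfl
  · rw [posIncl_some, swapRows_some, rowSwap_some, posIncl_some]
    congr 2
    simp only [Equiv.swap_apply_def, Fin.ext_iff]
    split_ifs <;> rfl

variable {B : L [⋀^Fin (n + 1)]→ₗ[F] L}

theorem combOf_comp_swap_none (f : Pos k n → L) (hk : 1 ≤ k) (i : Fin n) :
    combOf B (f ∘ Equiv.swap none (some (⟨0, hk⟩, i))) = - combOf B f := by
  rw [← combValue_eq_combOf B (extend_comp_eq f (swap_posIncl _ _))]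
  exact combValue_swap_none B _ hk i

theorem combOf_comp_swap (f : Pos k n → L) {p p' : Pos k n} (hp : p ≠ p')
    (h : rowOf p = rowOf p') : combOf B (f ∘ Equiv.swap p p') = - combOf B f := by
  rcases p with _ | ⟨j, i⟩
  · rcases p' with _ | ⟨j', i'⟩
    · exact absurd rfl hp
    · have hk : 0 < k := by have := j'.2; omega
      obtain rfl : j' = ⟨0, hk⟩ := Fin.ext h.symm
      exact combOf_comp_swap_none f hk i'
  · rcases p' with _ | ⟨j', i'⟩
    · have hk : 0 < k := by have := j.2; omega
      obtain rfl : j = ⟨0, hk⟩ := Fin.ext h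
      rw [Equiv.swap_comm]
      exact combOf_comp_swap_none f hk i
    · obtain rfl : j = j' := Fin.ext h
      rw [← combValue_eq_combOf B (extend_comp_eq f (swap_posIncl _ _))]
      exact combValue_swap_row B _ j.2 (fun h : i = i' => hp (by rw [h]))

theorem combOf_comp_rowSwap (hB : IsFilippov B) (f : Pos k n → L) {j : ℕ} (hj : j + 1 < k) :
    combOf B (f ∘ rowSwap n ⟨j, by omega⟩ ⟨j + 1, hj⟩) = combOf B f - n • combOf B f +
      ∑ i, ∑ i', combOf B (f ∘ Equiv.swap (some (⟨j, by omega⟩, i)) (some (⟨j + 1, hj⟩, i'))) := by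
  rw [← combValue_eq_combOf B (extend_comp_eq f (swapRows_posIncl hj)), combValue_swapRows hB _ hj]
  congr 1
  refine Finset.sum_congr rfl fun i _ => Finset.sum_congr rfl fun i' _ => ?_
  exact combValue_eq_combOf B (extend_comp_eq f (swap_posIncl (some (⟨j, by omega⟩, i))
    (some (⟨j + 1, hj⟩, i'))))

theorem combOf_eq_rowSwap_zero (hB : IsFilippov B) (f : Pos k n → L) (hk : 2 ≤ k) :
    combOf B f = combOf B (f ∘ rowSwap n ⟨0, by omega⟩ ⟨1, hk⟩) -
      ∑ i, combOf B (f ∘ ((rowSwap n ⟨0, by omega⟩ ⟨1, hk⟩).trans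
        (Equiv.swap none (some (⟨0, by omega⟩, i))))) := by
  conv_lhs => rw [combOf]
  rw [combValue_eq_swapRows_zero hB _ hk]
  congr 1
  · exact combValue_eq_combOf B (extend_comp_eq f (swapRows_posIncl (show 0 + 1 < k from hk)))
  · refine Finset.sum_congr rfl fun i _ => combValue_eq_combOf B ?_
    rw [Function.comp_assoc, ← Equiv.coe_trans]
    refine extend_comp_eq f fun p => ?_
    rw [Equiv.trans_apply, Equiv.trans_apply, swapRows_posIncl (show 0 + 1 < k from hk)]
    exact swap_posIncl none (some (⟨0, by omega⟩, i)) _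

theorem map_combOf {L₁ : Type*} [AddCommGroup L₁] [Module F L₁] {B₁ : L₁ [⋀^Fin (n + 1)]→ₗ[F] L₁}
    {φ : L →ₗ[F] L₁} (hφ : ∀ x, φ (B x) = B₁ fun i => φ (x i)) (f : Pos k n → L) :
    φ (combOf B f) = combOf B₁ (φ ∘ f) := by
  have h : ∀ (a : Option (ℕ × Fin n) → L) (j : ℕ),
      φ (combValue B a j) = combValue B₁ (φ ∘ a) j := by
    intro a j
    induction j with
    | zero => rfl
    | succ j ih =>
      rw [combValue, hφ, combValue, ← ih]
      congr 1
      ext i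
      refine Fin.cases ?_ (fun i => ?_) i <;> simp
  rw [combOf, h]
  refine combValue_eq_combOf B₁ fun p => ?_
  rw [Function.comp_apply, (posIncl_injective k n).extend_apply, Function.comp_apply]

end CombOf

/-! ### Fillings of the positions span the multilinear component -/

section CombSpan

variable {F : Type*} [Field F] [CharZero F] {n : ℕ} {X : Type}

theorem exists_word_combValue (a : Option (ℕ × Fin n) → X) (j : ℕ) :
    ∃ w : Word (n + 1) X, wordClass F w =
      combValue (freeBracket F (n + 1) X) (fun p => wordClass F (.letter (a p))) j ∧
      w.letters = {a none} + ∑ l ∈ Finset.range j, ∑ i, {a (some (l, i))} ∧ w.numBrackets = j := by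
  induction j with
  | zero => exact ⟨.letter (a none), rfl, by simp [Word.letters], rfl⟩
  | succ j ih =>
    obtain ⟨w, h1, h2, h3⟩ := ih
    refine ⟨.bracket (Fin.cons w fun i => .letter (a (some (j, i)))), ?_, ?_, ?_⟩
    · rw [combValue, ← h1, ← freeBracket_wordClass]
      congr 1
      ext i : 1
      refine Fin.cases ?_ (fun i => ?_) i <;> simp
    · simp only [Word.letters, Fin.sum_univ_succ, Fin.cons_zero, Fin.cons_succ, h2,
        Finset.sum_range_succ, add_assoc]
    · simp only [Word.numBrackets, Fin.sum_univ_succ, Fin.cons_zero, Fin.cons_succ, h3,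
        Finset.sum_const_zero]
      omega

theorem IsComb.exists_combValue {w : Word (n + 1) X} (hw : IsComb w) :
    ∃ a : Option (ℕ × Fin n) → X, wordClass F w =
      combValue (freeBracket F (n + 1) X) (fun p => wordClass F (.letter (a p))) w.numBrackets ∧
      w.letters = {a none} + ∑ l ∈ Finset.range w.numBrackets, ∑ i, {a (some (l, i))} := by
  induction hw with
  | letter x => exact ⟨fun _ => x, rfl, by simp [Word.letters, Word.numBrackets]⟩
  | bracket u hu y ih =>
    obtain ⟨a, h1, h2⟩ := ih
    have h3 : (Word.bracket (Fin.cons u fun i => .letter (y i)) : Word (n + 1) X).numBrackets =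
        u.numBrackets + 1 := by
      simp only [Word.numBrackets, Fin.sum_univ_succ, Fin.cons_zero, Fin.cons_succ,
        Finset.sum_const_zero]
      omega
    let b : Option (ℕ × Fin n) → X := fun p =>
      p.elim (a none) fun q => if q.1 = u.numBrackets then y q.2 else a (some q)
    have hb : ∀ i, b (some (u.numBrackets, i)) = y i := fun i => if_pos rfl
    have hb' : ∀ l i, l < u.numBrackets → b (some (l, i)) = a (some (l, i)) :=
      fun l i h => if_neg h.ne
    refine ⟨b, ?_, ?_⟩
    · rw [h3, combValue, combValue_congr (a := fun p => wordClass F (.letter (a p)))]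
      · rw [← h1, ← freeBracket_wordClass]
        congr 1
        ext i : 1
        refine Fin.cases ?_ (fun i => ?_) i <;> simp [hb]
      · rfl
      · intro l i hl
        rw [hb' l i hl]
    · rw [h3, Finset.sum_range_succ, ← add_assoc]
      simp only [Word.letters, Fin.sum_univ_succ, Fin.cons_zero, Fin.cons_succ, h2, hb]
      congr 2
      exact Finset.sum_congr rfl fun l hl => Finset.sum_congr rfl fun i _ => by
        rw [hb' l i (Finset.mem_range.1 hl)]

theorem sum_posIncl {M : Type*} [AddCommMonoid M] (k : ℕ) (f : Option (ℕ × Fin n) → M) :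
    f none + ∑ l ∈ Finset.range k, ∑ i, f (some (l, i)) = ∑ p, f (posIncl k n p) := by
  rw [Fintype.sum_option, Fintype.sum_prod_type, Finset.sum_range]
  rfl

variable [Fintype X]

theorem combOf_mem_multilinearPart {k : ℕ} (σ : Pos k n ≃ X) :
    combOf (freeBracket F (n + 1) X) (fun p => wordClass F (.letter (σ p))) ∈
      multilinearPart F (n + 1) k X := by
  obtain ⟨w, h1, h2, h3⟩ := exists_word_combValue (F := F)
    (Function.extend (posIncl k n) σ fun _ => σ none) k
  have h4 : ∀ p, Function.extend (posIncl k n) σ (fun _ => σ none) (posIncl k n p) = σ p :=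
    (posIncl_injective k n).extend_apply σ _
  rw [← combValue_eq_combOf (freeBracket F (n + 1) X) (a := fun q => wordClass F
    (.letter (Function.extend (posIncl k n) σ (fun _ => σ none) q))) fun p => by rw [h4], ← h1]
  refine Submodule.subset_span ⟨w, ⟨?_, h3⟩, rfl⟩
  rw [Word.IsBracketedPerm, h2, sum_posIncl k fun q =>
    ({Function.extend (posIncl k n) σ (fun _ => σ none) q} : Multiset X)]
  simp only [h4]
  rw [Equiv.sum_comp σ fun x => ({x} : Multiset X)]
  exact Finset.sum_multiset_singleton _

/-- In a left-normed word using each letter once, the map from positions to letters is a bijection,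
so the word is the bracket of a filling. -/
theorem multilinearPart_le_span_combOf {k : ℕ} : multilinearPart F (n + 1) k X ≤
    Submodule.span F (Set.range fun σ : Pos k n ≃ X =>
      combOf (freeBracket F (n + 1) X) fun p => wordClass F (.letter (σ p))) := by
  classical
  refine Submodule.span_le.2 ?_
  rintro _ ⟨w, ⟨hw, rfl⟩, rfl⟩
  have h := wordClass_mem_combSpan (F := F) w
  refine Submodule.span_mono ?_ h
  rintro _ ⟨v, ⟨hv, hvl, hvn⟩, rfl⟩
  obtain ⟨a, h1, h2⟩ := hv.exists_combValue (F := F)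
  rw [hvn] at h1 h2
  rw [hvl, hw, sum_posIncl _ fun q => ({a q} : Multiset X)] at h2
  have h3 : (Finset.univ : Finset X).val =
      (Finset.univ : Finset (Pos w.numBrackets n)).val.map fun p => a (posIncl _ n p) := by
    rw [h2]
    exact Multiset.bind_singleton _ _
  have hbij : Function.Bijective fun p => a (posIncl w.numBrackets n p) := by
    constructor
    · have h4 := (h3 ▸ Finset.univ.nodup :
        ((Finset.univ : Finset (Pos w.numBrackets n)).val.map fun p => a (posIncl _ n p)).Nodup)
      intro p q hpq
      exact Multiset.inj_on_of_nodup_map h4 p (Finset.mem_univ p) q (Finset.mem_univ q) hpq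
    · intro x
      have h4 : x ∈ (Finset.univ : Finset X).val := Finset.mem_univ x
      rw [h3, Multiset.mem_map] at h4
      obtain ⟨p, _, hp⟩ := h4
      exact ⟨p, hp⟩
  refine ⟨Equiv.ofBijective _ hbij, ?_⟩
  rw [h1]
  exact (combValue_eq_combOf (freeBracket F (n + 1) X)
    (a := fun p => wordClass F (.letter (a p))) fun p => rfl).symm

end CombSpan

/-! ### Symmetrizations over k letters generate -/

section Generation

variable (F : Type*) [Field F] (n k : ℕ) (X : Type) [Fintype X]

/-- The representation on the multilinear component of the free Filippov algebra. -/
noncomputable def multilinearRep : Representation F (Equiv.Perm X) (multilinearPart F n k X) :=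
  (freeFilippovRep F n X).subrepresentation _ (multilinearPart_le_comap F n k X)

variable {F n k X} [DecidableEq X]

theorem symmetrizer_conj {V : Type*} [AddCommGroup V] [Module F V]
    (ρ : Representation F (Equiv.Perm X) V) (π : Equiv.Perm X) (T : Finset X) (v : V) :
    symmetrizer ρ (T.map π.toEmbedding) v = ρ π (symmetrizer ρ T (ρ π⁻¹ v)) := by
  rw [symmetrizer_apply, symmetrizer_apply, map_sum]
  refine Finset.sum_bij' (fun σ _ => π⁻¹ * σ * π) (fun σ _ => π * σ * π⁻¹) ?_ ?_ ?_ ?_ ?_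
  · intro σ hσ
    rw [mem_permsOn] at hσ ⊢
    intro x hx
    simp [hσ (π x) (by simpa using hx)]
  · intro σ hσ
    rw [mem_permsOn] at hσ ⊢
    intro x hx
    have : π⁻¹ x ∉ T := fun h => hx (Finset.mem_map.2 ⟨_, h, by simp⟩)
    simp only [Equiv.Perm.mul_apply, hσ _ this]
    simp
  · intro σ _
    group
  · intro σ _
    group
  · intro σ _
    simp only [← Module.End.mul_apply, ← map_mul]
    congr 2
    group

theorem map_symmetrizer {V W : Type*} [AddCommGroup V] [Module F V] [AddCommGroup W] [Module F W]
    {ρ : Representation F (Equiv.Perm X) V} {ρ' : Representation F (Equiv.Perm X) W}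
    {φ : V →ₗ[F] W} (hφ : ∀ π v, φ (ρ π v) = ρ' π (φ v)) (T : Finset X) (v : V) :
    φ (symmetrizer ρ T v) = symmetrizer ρ' T (φ v) := by
  simp only [symmetrizer_apply, map_sum, hφ]

theorem exists_map_perm_eq {K T : Finset X} (h : K.card = T.card) :
    ∃ π : Equiv.Perm X, K.map π.toEmbedding = T := by
  obtain ⟨e⟩ : Nonempty (K ≃ T) := ⟨Finset.equivOfCardEq h⟩
  refine ⟨e.extendSubtype, ?_⟩
  refine Finset.eq_of_subset_of_card_le ?_ (by rw [Finset.card_map, h])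
  intro x hx
  obtain ⟨y, hy, rfl⟩ := Finset.mem_map.1 hx
  exact e.extendSubtype_mem y hy

variable [CharZero F]

/-- In the quotient by U the symmetrizer of K vanishes, and by conjugation so does that of every set
of k letters. The classes of the left-normed brackets satisfy the straightening relations, hence
vanish, and they span. -/
theorem eq_top_of_symmetrizer_mem (hk : 1 ≤ k) (hkn : k ≤ n + 1)
    (hX : Fintype.card X = k * n + 1) {K : Finset X} (hK : K.card = k)
    (U : Submodule F (multilinearPart F (n + 1) k X))
    (hU : ∀ π, U ≤ U.comap (multilinearRep F (n + 1) k X π))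
    (hKU : ∀ v, symmetrizer (multilinearRep F (n + 1) k X) K v ∈ U) : U = ⊤ := by
  set ρ := multilinearRep F (n + 1) k X with hρdef
  let e : X ≃ Pos k n := Fintype.equivOfCardEq (by simp [hX])
  let C : (Pos k n ≃ X) → multilinearPart F (n + 1) k X ⧸ U := fun σ =>
    U.mkQ ⟨_, combOf_mem_multilinearPart (F := F) σ⟩
  have hB := isFilippov_freeBracket F n X
  have hC0 : ∀ σ, C σ = 0 := by
    refine eq_zero_of_straightening (ρ := ρ.quotient U hU) hk hkn e ?_ ?_ ?_ ?_ ?_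
    · intro T hT
      obtain ⟨π, rfl⟩ := exists_map_perm_eq (hK.trans hT.symm)
      refine LinearMap.ext fun v => ?_
      obtain ⟨v, rfl⟩ := U.mkQ_surjective v
      rw [← map_symmetrizer (ρ := ρ) (fun _ _ => rfl), symmetrizer_conj]
      exact (Submodule.Quotient.mk_eq_zero U).2 (hU π (hKU _))
    · intro σ π
      change _ = U.mkQ (ρ π _)
      simp only [C]
      congr 1
      ext1
      refine Eq.trans ?_ (map_combOf (freeFilippovRep_freeBracket π) _).symm
      refine congrArg (combOf (freeBracket F (n + 1) X)) (funext fun p => ?_)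
      rw [Function.comp_apply, freeFilippovRep_wordClass]
      rfl
    · intro σ p p' hp hpp
      simp only [C]
      rw [← map_neg]
      congr 1
      ext1
      exact combOf_comp_swap (fun p => wordClass F (.letter (σ p))) hp hpp
    · intro hk2 σ
      simp only [C]
      rw [← map_sum, ← map_sub]
      congr 1
      ext1
      rw [Submodule.coe_sub, Submodule.coe_sum]
      exact combOf_eq_rowSwap_zero hB (fun p => wordClass F (.letter (σ p))) hk2
    · intro j hjk hj σ
      simp only [C]
      simp only [← map_sum, ← map_sub, ← map_nsmul, ← map_add]
      congr 1
      ext1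
      simp only [Submodule.coe_add, Submodule.coe_sub, Submodule.coe_sum]
      exact combOf_comp_rowSwap hB (fun p => wordClass F (.letter (σ p))) hjk
  rw [eq_top_iff]
  rintro ⟨v, hv⟩ -
  have h1 := multilinearPart_le_span_combOf hv
  have h2 : Submodule.span F (Set.range fun σ : Pos k n ≃ X =>
      combOf (freeBracket F (n + 1) X) fun p => wordClass F (.letter (σ p))) ≤
      U.map (multilinearPart F (n + 1) k X).subtype := by
    refine Submodule.span_le.2 ?_
    rintro _ ⟨σ, rfl⟩
    refine ⟨⟨_, combOf_mem_multilinearPart (F := F) σ⟩, ?_, rfl⟩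
    exact (Submodule.Quotient.mk_eq_zero U).1 (hC0 σ)
  obtain ⟨u, hu, huv⟩ := h2 h1
  rwa [← show u = ⟨v, hv⟩ from Subtype.ext huv]

end Generation

/-! ### Combinatorics of rows and columns of Young diagrams -/

section Diagrams

variable {μ ν : YoungDiagram}

/-- The number of cells of `μ` in row `i` and in the columns before `j`. -/
def rowCount (μ : YoungDiagram) (i j : ℕ) : ℕ :=
  (Finset.univ.filter fun c : μ.cells => c.1.1 = i ∧ c.1.2 < j).card

theorem rowCount_eq_min (μ : YoungDiagram) (i j : ℕ) : rowCount μ i j = min (μ.rowLen i) j := by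
  rw [← Finset.card_range (min (μ.rowLen i) j), rowCount]
  refine Finset.card_bij' (fun c _ => c.1.2) (fun l hl => ⟨(i, l), ?_⟩) ?_ ?_ ?_ ?_
  · rw [YoungDiagram.mem_cells, YoungDiagram.mem_iff_lt_rowLen]
    rw [Finset.mem_range] at hl
    omega
  · intro c hc
    obtain ⟨-, h1, h2⟩ := Finset.mem_filter.1 hc
    have h3 := YoungDiagram.mem_iff_lt_rowLen.1 ((YoungDiagram.mem_cells _).1 c.2)
    rw [h1] at h3
    exact Finset.mem_range.2 (lt_min h3 h2)
  · intro l hl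
    rw [Finset.mem_range] at hl
    simp
    omega
  · intro c hc
    obtain ⟨-, h1, h2⟩ := Finset.mem_filter.1 hc
    ext1
    exact Prod.ext h1.symm rfl
  · intro l hl
    rfl

theorem sum_rowCount (μ : YoungDiagram) (j : ℕ) {N : ℕ} (hN : ∀ c ∈ μ, c.1 < N) :
    ∑ i ∈ Finset.range N, rowCount μ i j =
      (Finset.univ.filter fun c : μ.cells => c.1.2 < j).card := by
  rw [Finset.card_eq_sum_card_fiberwise (f := fun c : μ.cells => c.1.1) (t := Finset.range N)]
  · refine Finset.sum_congr rfl fun i _ => ?_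
    rw [rowCount, Finset.filter_filter]
    simp only [and_comm]
  · intro c _
    exact Finset.mem_coe.2 (Finset.mem_range.2 (hN c.1 c.2))

theorem exists_row_bound (μ : YoungDiagram) : ∃ N, ∀ c ∈ μ, c.1 < N :=
  ⟨μ.cells.sup Prod.fst + 1, fun c hc =>
    Nat.lt_succ_of_le (Finset.le_sup (f := Prod.fst) ((YoungDiagram.mem_cells c).2 hc))⟩

/-- Cells of row i have images in distinct columns, so at most j of them land before column j, and
there are no more than the row has cells. -/
theorem card_filter_le_rowCount (x : μ.cells ≃ ν.cells)
    (hx : Function.Injective fun c : μ.cells => (c.1.1, (x c).1.2)) (i j : ℕ) :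
    (Finset.univ.filter fun c : μ.cells => c.1.1 = i ∧ (x c).1.2 < j).card ≤ rowCount μ i j := by
  rw [rowCount_eq_min]
  refine le_min ?_ ?_
  · rw [show μ.rowLen i = min (μ.rowLen i) (μ.rowLen i) by simp, ← rowCount_eq_min, rowCount]
    refine Finset.card_le_card fun c hc => ?_
    obtain ⟨-, h1, h2⟩ := Finset.mem_filter.1 hc
    have h3 := YoungDiagram.mem_iff_lt_rowLen.1 ((YoungDiagram.mem_cells _).1 c.2)
    rw [h1] at h3
    exact Finset.mem_filter.2 ⟨Finset.mem_univ c, h1, h3⟩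
  · refine (Finset.card_le_card_of_injOn (fun c => (x c).1.2) (t := Finset.range j) ?_ ?_).trans_eq
      (Finset.card_range j)
    · intro c hc
      exact Finset.mem_coe.2 (Finset.mem_range.2 (Finset.mem_filter.1 (Finset.mem_coe.1 hc)).2.2)
    · intro c hc d hd h
      have h1 := (Finset.mem_filter.1 (Finset.mem_coe.1 hc)).2.1
      have h2 := (Finset.mem_filter.1 (Finset.mem_coe.1 hd)).2.1
      exact hx (Prod.ext (h1.trans h2.symm) h)

theorem sum_card_filter (x : μ.cells ≃ ν.cells) (j : ℕ) {N : ℕ} (hN : ∀ c ∈ μ, c.1 < N) :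
    ∑ i ∈ Finset.range N,
      (Finset.univ.filter fun c : μ.cells => c.1.1 = i ∧ (x c).1.2 < j).card =
      (Finset.univ.filter fun c : ν.cells => c.1.2 < j).card := by
  rw [← Finset.card_map x.toEmbedding (s := Finset.univ.filter fun c : μ.cells => (x c).1.2 < j) |>.symm.trans
    (congrArg Finset.card (show _ = Finset.univ.filter fun c : ν.cells => c.1.2 < j from ?_)),
    Finset.card_eq_sum_card_fiberwise (f := fun c : μ.cells => c.1.1) (t := Finset.range N)]
  · refine Finset.sum_congr rfl fun i _ => ?_
    rw [Finset.filter_filter]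
    simp only [and_comm]
  · intro c _
    exact Finset.mem_coe.2 (Finset.mem_range.2 (hN c.1 c.2))
  · ext c
    obtain ⟨d, rfl⟩ := x.surjective c
    simp

/-- A bijection of diagrams which maps cells in the same row to different columns can exist only if
the columns of the source are at least as long, in the dominance order. -/
theorem card_cols_le (x : μ.cells ≃ ν.cells)
    (hx : Function.Injective fun c : μ.cells => (c.1.1, (x c).1.2)) (j : ℕ) :
    (Finset.univ.filter fun c : ν.cells => c.1.2 < j).card ≤
      (Finset.univ.filter fun c : μ.cells => c.1.2 < j).card := by
  obtain ⟨N, hN⟩ := exists_row_bound μ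
  rw [← sum_card_filter x j hN, ← sum_rowCount μ j hN]
  exact Finset.sum_le_sum fun i _ => card_filter_le_rowCount x hx i j

theorem eq_of_card_cols_eq (h : ∀ j, (Finset.univ.filter fun c : ν.cells => c.1.2 < j).card =
    (Finset.univ.filter fun c : μ.cells => c.1.2 < j).card) : μ = ν := by
  have h1 : ∀ (μ : YoungDiagram) (j : ℕ),
      (Finset.univ.filter fun c : μ.cells => c.1.2 < j + 1).card =
        (Finset.univ.filter fun c : μ.cells => c.1.2 < j).card + μ.colLen j := by
    intro μ j
    have h2 : μ.colLen j = (Finset.univ.filter fun c : μ.cells => c.1.2 = j).card := by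
      rw [YoungDiagram.colLen_eq_card, YoungDiagram.col, ← Finset.card_map (Function.Embedding.subtype _)]
      congr 1
      ext c
      simp only [Finset.mem_filter, Finset.mem_map, Finset.mem_univ, true_and, YoungDiagram.mem_cells,
        Function.Embedding.subtype_apply, Subtype.exists, exists_and_left, exists_prop, exists_eq_right_right]
      exact and_comm
    rw [h2, ← Finset.card_union_of_disjoint]
    · congr 1
      ext c
      simp [le_iff_lt_or_eq]
    · rw [Finset.disjoint_filter]
      intro c _ h3 h4
      omega
  ext ⟨i, j⟩
  rw [YoungDiagram.mem_cells, YoungDiagram.mem_cells, YoungDiagram.mem_iff_lt_colLen,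
    YoungDiagram.mem_iff_lt_colLen]
  have h3 := h1 μ j
  have h4 := h1 ν j
  have h5 := h j
  have h6 := h (j + 1)
  omega

/-- The combinatorial lemma behind the Young symmetrizers. -/
theorem mem_of_injective (x : Equiv.Perm μ.cells)
    (hx : Function.Injective fun c : μ.cells => (c.1.1, (x c).1.2)) (c : μ.cells) :
    (c.1.1, (x c).1.2) ∈ μ := by
  obtain ⟨N, hN⟩ := exists_row_bound μ
  have key : ∀ i < N, ∀ j,
      (Finset.univ.filter fun c : μ.cells => c.1.1 = i ∧ (x c).1.2 < j).card =
        min (μ.rowLen i) j := by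
    intro i hi j
    have h1 := (sum_card_filter x j hN).trans (sum_rowCount μ j hN).symm
    rw [Finset.sum_eq_sum_iff_of_le fun i _ => card_filter_le_rowCount x hx i j] at h1
    rw [h1 i (Finset.mem_range.2 hi), rowCount_eq_min]
  rw [YoungDiagram.mem_iff_lt_rowLen]
  by_contra hlt
  push Not at hlt
  have h1 := key c.1.1 (hN _ c.2) (x c).1.2
  have h2 := key c.1.1 (hN _ c.2) ((x c).1.2 + 1)
  have h3 : (Finset.univ.filter fun d : μ.cells => d.1.1 = c.1.1 ∧ (x d).1.2 < (x c).1.2).card <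
      (Finset.univ.filter fun d : μ.cells => d.1.1 = c.1.1 ∧ (x d).1.2 < (x c).1.2 + 1).card := by
    refine Finset.card_lt_card ?_
    rw [Finset.ssubset_iff_of_subset]
    · exact ⟨c, by simp, by simp⟩
    · intro d hd
      simp only [Finset.mem_filter] at hd ⊢
      exact ⟨hd.1, hd.2.1, hd.2.2.trans (Nat.lt_succ_self _)⟩
  rw [h1, h2, min_eq_left hlt, min_eq_left (by omega)] at h3
  exact lt_irrefl _ h3

/-- The row permutation p sends c to the cell in the row of c and the column of `x c`, which lies in
μ by `mem_of_injective`; then `x * p⁻¹` preserves columns. -/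
theorem exists_col_mul_row (x : Equiv.Perm μ.cells)
    (hx : Function.Injective fun c : μ.cells => (c.1.1, (x c).1.2)) :
    ∃ q ∈ colPerms μ, ∃ p ∈ rowPerms μ, x = q * p := by
  let f : μ.cells → μ.cells := fun c => ⟨(c.1.1, (x c).1.2), mem_of_injective x hx c⟩
  have hf : Function.Injective f := fun c d h => hx (congrArg Subtype.val h)
  let p : Equiv.Perm μ.cells := Equiv.ofBijective f (Finite.injective_iff_bijective.1 hf)
  refine ⟨x * p⁻¹, ?_, p, ?_, by group⟩
  · simp only [colPerms, Finset.mem_filter, Finset.mem_univ, true_and]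
    intro c
    obtain ⟨d, rfl⟩ := p.surjective c
    simp [p, f]
  · simp [rowPerms, p, f]

end Diagrams

/-! ### Row and column operators of tableaux -/

section YoungOperators

variable {F : Type*} [Field F] {m : ℕ} {V : Type*} [AddCommGroup V] [Module F V]
  (ρ : Representation F (Equiv.Perm (Fin m)) V) {μ ν : YoungDiagram}

theorem mem_rowPerms {p : Equiv.Perm μ.cells} : p ∈ rowPerms μ ↔ ∀ c, (p c).1.1 = c.1.1 := by
  simp [rowPerms]

theorem mem_colPerms {p : Equiv.Perm μ.cells} : p ∈ colPerms μ ↔ ∀ c, (p c).1.2 = c.1.2 := by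
  simp [colPerms]

/-- The sum of the row permutations of a tableau. -/
noncomputable def rowOp (t : Tableau m μ) : Module.End F V := ∑ p ∈ rowPerms μ, ρ (t.permCongr p)

/-- The alternating sum of the column permutations of a tableau. -/
noncomputable def colOp (t : Tableau m μ) : Module.End F V :=
  ∑ q ∈ colPerms μ, ((Equiv.Perm.sign q : ℤ) : F) • ρ (t.permCongr q)

theorem permCongr_mul (t : Tableau m μ) (p q : Equiv.Perm μ.cells) :
    t.permCongr (p * q) = t.permCongr p * t.permCongr q := by
  ext x
  simp [Equiv.permCongr_apply]

variable {ρ}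

theorem rowOp_mul {t : Tableau m μ} {p : Equiv.Perm μ.cells} (hp : p ∈ rowPerms μ) :
    rowOp ρ t * ρ (t.permCongr p) = rowOp ρ t := by
  rw [rowOp, Finset.sum_mul]
  simp only [← map_mul, ← permCongr_mul]
  rw [mem_rowPerms] at hp
  refine Finset.sum_bij' (fun q _ => q * p) (fun q _ => q * p⁻¹) ?_ ?_ ?_ ?_ ?_
  · intro q hq
    rw [mem_rowPerms] at hq ⊢
    intro c
    rw [Equiv.Perm.mul_apply, hq, hp]
  · intro q hq
    rw [mem_rowPerms] at hq ⊢
    intro c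
    rw [Equiv.Perm.mul_apply, hq, ← hp (p⁻¹ c)]
    simp
  · intro q _
    simp
  · intro q _
    simp
  · intro q _
    rfl

theorem mul_rowOp {t : Tableau m μ} {p : Equiv.Perm μ.cells} (hp : p ∈ rowPerms μ) :
    ρ (t.permCongr p) * rowOp ρ t = rowOp ρ t := by
  rw [rowOp, Finset.mul_sum]
  simp only [← map_mul, ← permCongr_mul]
  rw [mem_rowPerms] at hp
  refine Finset.sum_bij' (fun q _ => p * q) (fun q _ => p⁻¹ * q) ?_ ?_ ?_ ?_ ?_
  · intro q hq
    rw [mem_rowPerms] at hq ⊢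
    intro c
    rw [Equiv.Perm.mul_apply, hp, hq]
  · intro q hq
    rw [mem_rowPerms] at hq ⊢
    intro c
    rw [Equiv.Perm.mul_apply, ← hp (p⁻¹ _), ← hq c]
    simp
  · intro q _
    simp
  · intro q _
    simp
  · intro q _
    rfl

theorem colOp_mul {t : Tableau m μ} {p : Equiv.Perm μ.cells} (hp : p ∈ colPerms μ) :
    colOp ρ t * ρ (t.permCongr p) = ((Equiv.Perm.sign p : ℤ) : F) • colOp ρ t := by
  rw [colOp, Finset.sum_mul, Finset.smul_sum]
  simp only [smul_mul_assoc, ← map_mul, ← permCongr_mul]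
  rw [mem_colPerms] at hp
  refine Finset.sum_bij' (fun q _ => q * p) (fun q _ => q * p⁻¹) ?_ ?_ ?_ ?_ ?_
  · intro q hq
    rw [mem_colPerms] at hq ⊢
    intro c
    rw [Equiv.Perm.mul_apply, hq, hp]
  · intro q hq
    rw [mem_colPerms] at hq ⊢
    intro c
    rw [Equiv.Perm.mul_apply, hq, ← hp (p⁻¹ c)]
    simp
  · intro q _
    simp
  · intro q _
    simp
  · intro q _
    rw [Equiv.Perm.sign_mul, smul_smul]
    push_cast
    rw [mul_comm (_ : F), mul_assoc, sign_mul_self_cast, mul_one]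

theorem mul_colOp {t : Tableau m μ} {p : Equiv.Perm μ.cells} (hp : p ∈ colPerms μ) :
    ρ (t.permCongr p) * colOp ρ t = ((Equiv.Perm.sign p : ℤ) : F) • colOp ρ t := by
  rw [colOp, Finset.mul_sum, Finset.smul_sum]
  simp only [mul_smul_comm, ← map_mul, ← permCongr_mul]
  rw [mem_colPerms] at hp
  refine Finset.sum_bij' (fun q _ => p * q) (fun q _ => p⁻¹ * q) ?_ ?_ ?_ ?_ ?_
  · intro q hq
    rw [mem_colPerms] at hq ⊢
    intro c
    rw [Equiv.Perm.mul_apply, hp, hq]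
  · intro q hq
    rw [mem_colPerms] at hq ⊢
    intro c
    rw [Equiv.Perm.mul_apply, ← hp (p⁻¹ _), ← hq c]
    simp
  · intro q _
    simp
  · intro q _
    simp
  · intro q _
    rw [Equiv.Perm.sign_mul, smul_smul]
    push_cast
    rw [← mul_assoc, sign_mul_self_cast, one_mul]

theorem swap_mem_rowPerms {a b : μ.cells} (h : a.1.1 = b.1.1) : Equiv.swap a b ∈ rowPerms μ := by
  rw [mem_rowPerms]
  intro c
  rw [Equiv.swap_apply_def]
  split_ifs with h1 h2
  · rw [h1, h]
  · rw [h2, h]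
  · rfl

theorem swap_mem_colPerms {a b : μ.cells} (h : a.1.2 = b.1.2) : Equiv.swap a b ∈ colPerms μ := by
  rw [mem_colPerms]
  intro c
  rw [Equiv.swap_apply_def]
  split_ifs with h1 h2
  · rw [h1, h]
  · rw [h2, h]
  · rfl

theorem permCongr_swap (t : Tableau m μ) (a b : μ.cells) :
    t.permCongr (Equiv.swap a b) = Equiv.swap (t a) (t b) := by
  ext x : 1
  rw [Equiv.permCongr_apply]
  obtain ⟨c, rfl⟩ := t.surjective x
  rw [Equiv.symm_apply_apply, t.injective.map_swap]

variable [CharZero F]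

theorem eq_zero_of_eq_neg (F : Type*) [Field F] [CharZero F] {V : Type*} [AddCommGroup V] [Module F V] {v : V} (h : v = -v) : v = 0 := by
  have h2 : (2 : F) • v = 0 := by
    rw [two_smul]
    nth_rw 1 [h]
    simp
  exact (smul_eq_zero.1 h2).resolve_left two_ne_zero

/-- The exchange of two letters that share a row of t and a column of s is absorbed on the left with
sign 1 and on the right with sign -1. -/
theorem rowOp_mul_colOp_eq_zero {t : Tableau m μ} {s : Tableau m ν} {a b : μ.cells} (hab : a ≠ b)
    (hrow : a.1.1 = b.1.1) (hcol : (s.symm (t a)).1.2 = (s.symm (t b)).1.2) :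
    rowOp ρ t * colOp ρ s = 0 := by
  have h1 := rowOp_mul (ρ := ρ) (t := t) (swap_mem_rowPerms hrow)
  have h2 := mul_colOp (ρ := ρ) (t := s) (swap_mem_colPerms hcol)
  have h3 : s.symm (t a) ≠ s.symm (t b) := fun h => hab (t.injective (s.symm.injective h))
  rw [permCongr_swap] at h1 h2
  rw [Equiv.apply_symm_apply, Equiv.apply_symm_apply, Equiv.Perm.sign_swap h3] at h2
  refine eq_zero_of_eq_neg F ?_
  nth_rw 1 [← h1]
  rw [mul_assoc, h2]
  simp

theorem colOp_mul_rowOp_eq_zero {t : Tableau m μ} {s : Tableau m ν} {a b : μ.cells} (hab : a ≠ b)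
    (hrow : a.1.1 = b.1.1) (hcol : (s.symm (t a)).1.2 = (s.symm (t b)).1.2) :
    colOp ρ s * rowOp ρ t = 0 := by
  have h1 := mul_rowOp (ρ := ρ) (t := t) (swap_mem_rowPerms hrow)
  have h2 := colOp_mul (ρ := ρ) (t := s) (swap_mem_colPerms hcol)
  have h3 : s.symm (t a) ≠ s.symm (t b) := fun h => hab (t.injective (s.symm.injective h))
  rw [permCongr_swap] at h1 h2
  rw [Equiv.apply_symm_apply, Equiv.apply_symm_apply, Equiv.Perm.sign_swap h3] at h2
  refine eq_zero_of_eq_neg F ?_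
  nth_rw 1 [← h1]
  rw [← mul_assoc, h2]
  simp

theorem injective_or_exists (x : μ.cells ≃ ν.cells) :
    (Function.Injective fun c : μ.cells => (c.1.1, (x c).1.2)) ∨
      ∃ a b, a ≠ b ∧ a.1.1 = b.1.1 ∧ (x a).1.2 = (x b).1.2 := by
  by_contra! h
  obtain ⟨h1, h2⟩ := h
  refine h1 fun a b hab => ?_
  by_contra hne
  exact h2 a b hne (Prod.ext_iff.1 hab).1 (Prod.ext_iff.1 hab).2

omit [CharZero F] in
theorem mul_rowOp_eq (σ : Equiv.Perm (Fin m)) (t : Tableau m μ) :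
    ρ σ * rowOp ρ t = rowOp ρ (t.trans σ) * ρ σ := by
  rw [rowOp, rowOp, Finset.mul_sum, Finset.sum_mul]
  refine Finset.sum_congr rfl fun p _ => ?_
  rw [← map_mul, ← map_mul]
  congr 1
  ext x
  simp [Equiv.permCongr_apply]

/-- Von Neumann's lemma: the operators `C ρ(σ) R` are multiples of `C R`. -/
theorem exists_colOp_mul_mul_rowOp (σ : Equiv.Perm (Fin m)) (t : Tableau m μ) :
    ∃ ε : F, colOp ρ t * ρ σ * rowOp ρ t = ε • (colOp ρ t * rowOp ρ t) := by
  rcases injective_or_exists ((t.trans σ).trans t.symm) with h | ⟨a, b, hab, hrow, hcol⟩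
  · obtain ⟨q, hq, p, hp, hx⟩ := exists_col_mul_row _ h
    have hσ : σ = t.permCongr q * t.permCongr p := by
      rw [← permCongr_mul, ← hx]
      ext x
      simp [Equiv.permCongr_apply]
    refine ⟨((Equiv.Perm.sign q : ℤ) : F), ?_⟩
    rw [hσ, map_mul, ← mul_assoc, colOp_mul hq, smul_mul_assoc, smul_mul_assoc, mul_assoc,
      mul_rowOp hp]
  · refine ⟨0, ?_⟩
    rw [mul_assoc, mul_rowOp_eq, ← mul_assoc,
      colOp_mul_rowOp_eq_zero (t := t.trans σ) (s := t) hab hrow hcol, zero_mul, zero_smul]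

/-- The Young symmetrizer of a tableau. -/
noncomputable def youngSym (ρ : Representation F (Equiv.Perm (Fin m)) V) (t : Tableau m μ) :
    Module.End F V := colOp ρ t * rowOp ρ t

/-- The inner part R ρ(σ) C is a combination of group elements, so von Neumann's lemma applies to
each term. -/
theorem exists_youngSym_mul_mul (σ : Equiv.Perm (Fin m)) (t : Tableau m μ) :
    ∃ ε : F, youngSym ρ t * ρ σ * youngSym ρ t = ε • youngSym ρ t := by
  have h1 : rowOp ρ t * ρ σ * colOp ρ t = ∑ p ∈ rowPerms μ, ∑ q ∈ colPerms μ,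
      ((Equiv.Perm.sign q : ℤ) : F) • ρ (t.permCongr p * σ * t.permCongr q) := by
    simp only [rowOp, colOp, Finset.sum_mul, Finset.mul_sum, map_mul, mul_smul_comm, Finset.smul_sum]
    rw [Finset.sum_comm]
  choose ε hε using fun σ : Equiv.Perm (Fin m) => exists_colOp_mul_mul_rowOp (ρ := ρ) σ t
  refine ⟨∑ p ∈ rowPerms μ, ∑ q ∈ colPerms μ,
      ((Equiv.Perm.sign q : ℤ) : F) • ε (t.permCongr p * σ * t.permCongr q), ?_⟩
  rw [youngSym, show colOp ρ t * rowOp ρ t * ρ σ * (colOp ρ t * rowOp ρ t) =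
    colOp ρ t * (rowOp ρ t * ρ σ * colOp ρ t) * rowOp ρ t by simp only [mul_assoc], h1]
  simp only [Finset.mul_sum, Finset.sum_mul, mul_smul_comm, smul_mul_assoc, hε, Finset.sum_smul,
    smul_assoc]

end YoungOperators

/-! ### Young symmetrizers on Specht modules; simplicity -/

section Specht

variable {F : Type*} [Field F] {m : ℕ} {μ ν : YoungDiagram}

theorem tableauRep_single (σ : Equiv.Perm (Fin m)) (t : Tableau m μ) (a : F) :
    tableauRep F m μ σ (Finsupp.single t a) = Finsupp.single (t.trans σ) a := by
  simp [tableauRep, Finsupp.mapDomain_single]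

theorem youngSym_single (t : Tableau m μ) :
    youngSym (tableauRep F m μ) t (Finsupp.single t 1) = polytabloid F t := by
  rw [youngSym, colOp, rowOp, Finset.sum_mul, polytabloid, LinearMap.sum_apply]
  refine Finset.sum_congr rfl fun q _ => ?_
  rw [Finset.mul_sum, LinearMap.sum_apply]
  refine Finset.sum_congr rfl fun p _ => ?_
  rw [smul_mul_assoc, ← map_mul, LinearMap.smul_apply, tableauRep_single]
  congr 2
  ext c
  simp [Equiv.permCongr_apply]

theorem map_rowOp {V W : Type*} [AddCommGroup V] [Module F V] [AddCommGroup W] [Module F W]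
    {ρ : Representation F (Equiv.Perm (Fin m)) V} {ρ' : Representation F (Equiv.Perm (Fin m)) W}
    {φ : V →ₗ[F] W} (hφ : ∀ σ v, φ (ρ σ v) = ρ' σ (φ v)) (t : Tableau m μ) (v : V) :
    φ (rowOp ρ t v) = rowOp ρ' t (φ v) := by
  simp only [rowOp, LinearMap.sum_apply, map_sum, hφ]

theorem map_colOp {V W : Type*} [AddCommGroup V] [Module F V] [AddCommGroup W] [Module F W]
    {ρ : Representation F (Equiv.Perm (Fin m)) V} {ρ' : Representation F (Equiv.Perm (Fin m)) W}
    {φ : V →ₗ[F] W} (hφ : ∀ σ v, φ (ρ σ v) = ρ' σ (φ v)) (t : Tableau m μ) (v : V) :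
    φ (colOp ρ t v) = colOp ρ' t (φ v) := by
  simp only [colOp, LinearMap.sum_apply, map_sum, LinearMap.smul_apply, map_smul, hφ]

theorem map_youngSym {V W : Type*} [AddCommGroup V] [Module F V] [AddCommGroup W] [Module F W]
    {ρ : Representation F (Equiv.Perm (Fin m)) V} {ρ' : Representation F (Equiv.Perm (Fin m)) W}
    {φ : V →ₗ[F] W} (hφ : ∀ σ v, φ (ρ σ v) = ρ' σ (φ v)) (t : Tableau m μ) (v : V) :
    φ (youngSym ρ t v) = youngSym ρ' t (φ v) := by
  rw [youngSym, youngSym, Module.End.mul_apply, Module.End.mul_apply, map_colOp hφ, map_rowOp hφ]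

theorem exists_trans_eq (s t : Tableau m μ) : ∃ σ : Equiv.Perm (Fin m), t.trans σ = s :=
  ⟨t.symm.trans s, by ext; simp⟩

/-- The polytabloid of `t` as an element of the Specht module. -/
noncomputable def spechtVec (F : Type*) [Field F] (t : Tableau m μ) : spechtSpace F m μ :=
  ⟨polytabloid F t, Submodule.subset_span ⟨t, rfl⟩⟩

theorem specht_spechtVec (σ : Equiv.Perm (Fin m)) (t : Tableau m μ) :
    specht F m μ σ (spechtVec F t) = spechtVec F (t.trans σ) :=
  Subtype.ext (tableauRep_polytabloid F σ t)

theorem span_spechtVec : Submodule.span F (Set.range (spechtVec F (m := m) (μ := μ))) = ⊤ := by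
  rw [eq_top_iff]
  rintro ⟨v, hv⟩ -
  have h : spechtSpace F m μ ≤ (Submodule.span F (Set.range (spechtVec F (m := m) (μ := μ)))).map
      (spechtSpace F m μ).subtype := by
    refine Submodule.span_le.2 ?_
    rintro _ ⟨t, rfl⟩
    exact ⟨spechtVec F t, Submodule.subset_span ⟨t, rfl⟩, rfl⟩
  obtain ⟨u, hu, huv⟩ := h hv
  rwa [← show u = ⟨v, hv⟩ from Subtype.ext huv]

theorem eq_top_of_spechtVec_mem {U : Submodule F (spechtSpace F m μ)}
    (hU : ∀ σ, ∀ v ∈ U, specht F m μ σ v ∈ U) {t : Tableau m μ} (ht : spechtVec F t ∈ U) :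
    U = ⊤ := by
  rw [eq_top_iff, ← span_spechtVec]
  refine Submodule.span_le.2 ?_
  rintro _ ⟨s, rfl⟩
  obtain ⟨σ, rfl⟩ := exists_trans_eq s t
  rw [← specht_spechtVec]
  exact hU σ _ ht

/-- Only the pair of identities contributes: if q p = 1, then p preserves columns as well as rows
and is trivial. -/
theorem polytabloid_apply_self (t : Tableau m μ) : polytabloid F t t = 1 := by
  rw [polytabloid, Finsupp.finsetSum_apply, Finset.sum_eq_single 1]
  · rw [Finsupp.finsetSum_apply, Finset.sum_eq_single 1]
    · simp [Equiv.Perm.one_def]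
    · intro p _ hp
      rw [Finsupp.smul_apply, Finsupp.single_eq_of_ne, smul_zero]
      intro h
      refine hp (Equiv.ext fun c => ?_)
      have := congrArg (fun e : Tableau m μ => e c) h
      simpa using this.symm
    · intro h
      exact absurd (mem_rowPerms.2 fun c => rfl) h
  · intro q hq hq1
    rw [Finsupp.finsetSum_apply]
    refine Finset.sum_eq_zero fun p hp => ?_
    rw [Finsupp.smul_apply, Finsupp.single_eq_of_ne, smul_zero]
    intro h
    refine hq1 (Equiv.ext fun c => ?_)
    have h1 : ∀ d, q (p d) = d := fun d => by
      have := congrArg (fun e : Tableau m μ => e d) h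
      simpa using this.symm
    obtain ⟨d, rfl⟩ := p.surjective c
    have h2 : p d = d := by
      refine Subtype.ext (Prod.ext (mem_rowPerms.1 hp d) ?_)
      rw [← mem_colPerms.1 hq (p d), h1]
    rw [h1, h2]
    rfl
  · intro h
    exact absurd (mem_colPerms.2 fun c => rfl) h

/-- The equivariant projection onto the Specht module, up to a scalar. -/
noncomputable def polytabloidMap (F : Type*) [Field F] (m : ℕ) (μ : YoungDiagram) :
    (Tableau m μ →₀ F) →ₗ[F] (Tableau m μ →₀ F) :=
  Finsupp.linearCombination F (polytabloid F)

theorem polytabloidMap_single (t : Tableau m μ) :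
    polytabloidMap F m μ (Finsupp.single t 1) = polytabloid F t := by
  simp [polytabloidMap]

variable [CharZero F]

omit [CharZero F] in
theorem polytabloidMap_tableauRep (σ : Equiv.Perm (Fin m)) (v : Tableau m μ →₀ F) :
    polytabloidMap F m μ (tableauRep F m μ σ v) = tableauRep F m μ σ (polytabloidMap F m μ v) := by
  have : polytabloidMap F m μ ∘ₗ tableauRep F m μ σ = tableauRep F m μ σ ∘ₗ polytabloidMap F m μ := by
    ext t : 2
    simp only [LinearMap.comp_apply, Finsupp.lsingle_apply]
    rw [tableauRep_single, polytabloidMap_single, polytabloidMap_single, tableauRep_polytabloid]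
  exact LinearMap.congr_fun this v

/-- A trace argument shows that the scalar is nonzero. If it were zero, the map sending each tableau
to its polytabloid would have square zero and hence trace zero; but its diagonal entries are all 1,
and the trace is the number of tableaux. -/
theorem exists_youngSym_polytabloid (t : Tableau m μ) :
    ∃ h : F, h ≠ 0 ∧ youngSym (tableauRep F m μ) t (polytabloid F t) = h • polytabloid F t := by
  obtain ⟨h, hh⟩ := exists_youngSym_mul_mul (ρ := tableauRep F m μ) 1 t
  rw [map_one, mul_one] at hh
  have h1 : youngSym (tableauRep F m μ) t (polytabloid F t) = h • polytabloid F t := by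
    have := LinearMap.congr_fun hh (Finsupp.single t 1)
    rwa [Module.End.mul_apply, youngSym_single, LinearMap.smul_apply, youngSym_single] at this
  refine ⟨h, ?_, h1⟩
  rintro rfl
  have h2 : polytabloidMap F m μ (polytabloid F t) = 0 := by
    rw [← youngSym_single, map_youngSym polytabloidMap_tableauRep, polytabloidMap_single, h1,
      zero_smul]
  have h3 : IsNilpotent (polytabloidMap F m μ) := by
    refine ⟨2, ?_⟩
    ext s : 2
    obtain ⟨σ, rfl⟩ := exists_trans_eq s t
    rw [pow_two, LinearMap.comp_apply, Finsupp.lsingle_apply, Module.End.mul_apply,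
      polytabloidMap_single, ← tableauRep_polytabloid, polytabloidMap_tableauRep, h2, map_zero]
    rfl
  have h4 := (LinearMap.isNilpotent_trace_of_isNilpotent h3).eq_zero
  rw [LinearMap.trace_eq_matrix_trace F (Finsupp.basisSingleOne)] at h4
  simp only [Matrix.trace, Matrix.diag, LinearMap.toMatrix_apply, Finsupp.coe_basisSingleOne,
    polytabloidMap_single, Finsupp.basisSingleOne_repr, LinearEquiv.refl_apply,
    polytabloid_apply_self] at h4
  rw [Finset.sum_const, nsmul_eq_mul, mul_one, Nat.cast_eq_zero, Finset.card_univ,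
    Fintype.card_eq_zero_iff] at h4
  exact h4.elim t

theorem exists_youngSym_spechtVec (t : Tableau m μ) :
    ∃ h : F, h ≠ 0 ∧ youngSym (V := spechtSpace F m μ) (specht F m μ) t (spechtVec F t) =
      h • spechtVec F t := by
  obtain ⟨h, h0, hh⟩ := exists_youngSym_polytabloid (F := F) t
  refine ⟨h, h0, Subtype.ext ?_⟩
  rw [← Submodule.subtype_apply, map_youngSym (V := spechtSpace F m μ) (ρ := specht F m μ) (ρ' := tableauRep F m μ)
      (fun _ _ => rfl)]
  exact hh

theorem youngSym_specht_mem (t : Tableau m μ) (v : spechtSpace F m μ) :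
    ∃ ε : F, youngSym (V := spechtSpace F m μ) (specht F m μ) t v = ε • spechtVec F t := by
  have h : (⊤ : Submodule F (spechtSpace F m μ)) ≤
      (Submodule.span F {spechtVec F t}).comap (youngSym (V := spechtSpace F m μ) (specht F m μ) t) := by
    rw [← span_spechtVec]
    refine Submodule.span_le.2 ?_
    rintro _ ⟨s, rfl⟩
    obtain ⟨σ, rfl⟩ := exists_trans_eq s t
    obtain ⟨ε, hε⟩ := exists_youngSym_mul_mul (ρ := tableauRep F m μ) σ t
    rw [SetLike.mem_coe, Submodule.mem_comap, Submodule.mem_span_singleton]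
    refine ⟨ε, Subtype.ext ?_⟩
    have := LinearMap.congr_fun hε (Finsupp.single t 1)
    rw [Module.End.mul_apply, Module.End.mul_apply, youngSym_single, LinearMap.smul_apply,
      youngSym_single, tableauRep_polytabloid] at this
    refine this.symm.trans ?_
    exact (map_youngSym (V := spechtSpace F m μ) (ρ := specht F m μ) (ρ' := tableauRep F m μ)
      (φ := (spechtSpace F m μ).subtype) (fun _ _ => rfl) t (spechtVec F (t.trans σ))).symm
  obtain ⟨ε, hε⟩ := Submodule.mem_span_singleton.1 (h (Submodule.mem_top (x := v)))
  exact ⟨ε, hε.symm⟩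

theorem exists_tableau (h : μ.card = m) : Nonempty (Tableau m μ) :=
  ⟨Fintype.equivFinOfCardEq (by rw [Fintype.card_coe]; exact h)⟩

instance (m : ℕ) (μ : YoungDiagram) : FiniteDimensional F (spechtSpace F m μ) :=
  FiniteDimensional.finiteDimensional_submodule _

theorem exists_invariant_compl {G V : Type*} [Group G] [Finite G] [AddCommGroup V] [Module F V]
    (ρ : Representation F G V) {U : Submodule F V} (hU : ∀ g, ∀ v ∈ U, ρ g v ∈ U) :
    ∃ U' : Submodule F V, (∀ g, ∀ v ∈ U', ρ g v ∈ U') ∧ IsCompl U U' := by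
  obtain ⟨W, hW⟩ := exists_isCompl (⟨U, fun g v hv => hU g v hv⟩ : Subrepresentation ρ)
  refine ⟨W.toSubmodule, fun g v hv => W.apply_mem_toSubmodule g hv, ?_⟩
  rw [isCompl_iff, disjoint_iff, codisjoint_iff] at hW ⊢
  exact ⟨congrArg Subrepresentation.toSubmodule hW.1, congrArg Subrepresentation.toSubmodule hW.2⟩

/-- Specht modules are simple. -/
theorem specht_eq_bot_or_eq_top {U : Submodule F (spechtSpace F m μ)}
    (hU : ∀ σ, ∀ v ∈ U, specht F m μ σ v ∈ U) : U = ⊥ ∨ U = ⊤ := by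
  rcases isEmpty_or_nonempty (Tableau m μ) with he | ⟨⟨t⟩⟩
  · left
    rw [eq_bot_iff, ← Submodule.span_empty (R := F)]
    refine le_top.trans ?_
    rw [← span_spechtVec, Set.range_eq_empty]
  obtain ⟨U', hU', hc⟩ := exists_invariant_compl (V := spechtSpace F m μ) (specht F m μ) hU
  obtain ⟨h, h0, hh⟩ := exists_youngSym_spechtVec (F := F) t
  have hmem : ∀ W : Submodule F (spechtSpace F m μ), (∀ σ, ∀ v ∈ W, specht F m μ σ v ∈ W) →
      ∀ v ∈ W, youngSym (V := spechtSpace F m μ) (specht F m μ) t v ∈ W := by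
    intro W hW v hv
    simp only [youngSym, colOp, rowOp, Module.End.mul_apply, LinearMap.sum_apply,
      LinearMap.smul_apply]
    exact Submodule.sum_mem _ fun q _ => Submodule.smul_mem _ _ (hW _ _
      (Submodule.sum_mem _ fun p _ => hW _ _ hv))
  -- The Young symmetrizer maps into the line of the polytabloid, so an invariant subspace that it
  -- does not kill contains this generator. Two complementary subspaces cannot both be killed.
  have hdich : ∀ W : Submodule F (spechtSpace F m μ), (∀ σ, ∀ v ∈ W, specht F m μ σ v ∈ W) →
      W = ⊤ ∨ ∀ v ∈ W, youngSym (V := spechtSpace F m μ) (specht F m μ) t v = 0 := by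
    intro W hW
    by_cases hz : ∀ v ∈ W, youngSym (V := spechtSpace F m μ) (specht F m μ) t v = 0
    · exact Or.inr hz
    · left
      push Not at hz
      obtain ⟨v, hv, hv0⟩ := hz
      obtain ⟨ε, hε⟩ := youngSym_specht_mem t v
      have h1 := hmem W hW v hv
      rw [hε] at h1 hv0
      refine eq_top_of_spechtVec_mem hW (t := t) ?_
      have hε0 : ε ≠ 0 := fun h => hv0 (by rw [h, zero_smul])
      have := W.smul_mem ε⁻¹ h1
      rwa [smul_smul, inv_mul_cancel₀ hε0, one_smul] at this
  rcases hdich U hU with h1 | h1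
  · exact Or.inr h1
  rcases hdich U' hU' with h2 | h2
  · left
    rw [eq_bot_iff, ← hc.inf_eq_bot, h2, inf_top_eq]
  · exfalso
    obtain ⟨u, hu, u', hu', huu⟩ := Submodule.mem_sup.1
      (hc.sup_eq_top ▸ Submodule.mem_top : spechtVec F t ∈ U ⊔ U')
    rw [← huu, map_add, h1 u hu, h2 u' hu', zero_add, huu, eq_comm, smul_eq_zero] at hh
    have h3 := congrArg (fun v => v.1 t) (hh.resolve_left h0)
    simp only [spechtVec, polytabloid_apply_self] at h3
    exact one_ne_zero h3

end Specht

/-! ### Permutations absorbed by a symmetrizer -/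

section SymmetrizerAbsorption

variable {F : Type*} [Field F] {X : Type} [Fintype X] [DecidableEq X]
  {V : Type*} [AddCommGroup V] [Module F V] (ρ : Representation F (Equiv.Perm X) V)

theorem mul_mem_permsOn {T : Finset X} {σ τ : Equiv.Perm X} (hσ : σ ∈ permsOn T)
    (hτ : τ ∈ permsOn T) : σ * τ ∈ permsOn T := by
  rw [mem_permsOn] at *
  intro x hx
  rw [Equiv.Perm.mul_apply, hτ x hx, hσ x hx]

theorem inv_mem_permsOn {T : Finset X} {σ : Equiv.Perm X} (hσ : σ ∈ permsOn T) :
    σ⁻¹ ∈ permsOn T := by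
  rw [mem_permsOn] at *
  intro x hx
  rw [Equiv.Perm.inv_eq_iff_eq, hσ x hx]

theorem swap_mem_permsOn {T : Finset X} {x y : X} (hx : x ∈ T) (hy : y ∈ T) :
    Equiv.swap x y ∈ permsOn T := by
  rw [mem_permsOn]
  intro z hz
  exact Equiv.swap_apply_of_ne_of_ne (fun h => hz (h ▸ hx)) (fun h => hz (h ▸ hy))

theorem sum_permsOn_inv {M : Type*} [AddCommMonoid M] (T : Finset X) (f : Equiv.Perm X → M) :
    ∑ σ ∈ permsOn T, f σ⁻¹ = ∑ σ ∈ permsOn T, f σ :=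
  Finset.sum_bij' (fun σ _ => σ⁻¹) (fun σ _ => σ⁻¹) (fun _ hσ => inv_mem_permsOn hσ)
    (fun _ hσ => inv_mem_permsOn hσ) (fun σ _ => inv_inv σ) (fun σ _ => inv_inv σ)
    (fun _ _ => rfl)

theorem symmetrizer_insert_eq_add_sum {T : Finset X} {x : X} (hx : x ∉ T) (v : V) :
    symmetrizer ρ (insert x T) v =
      symmetrizer ρ T v + ∑ y ∈ T, ρ (Equiv.swap x y) (symmetrizer ρ T v) := by
  rw [add_sum_swap ρ hx, symmetrizer_apply, symmetrizer_apply, ← sum_permsOn_inv,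
    sum_permsOn_insert hx]
  refine Finset.sum_congr rfl fun y _ => ?_
  rw [map_sum, ← sum_permsOn_inv]
  refine Finset.sum_congr rfl fun σ _ => ?_
  rw [← Module.End.mul_apply, ← map_mul, mul_inv_rev, inv_inv, Equiv.swap_inv]

theorem symmetrizer_apply_rep {T : Finset X} {σ : Equiv.Perm X} (hσ : σ ∈ permsOn T) (v : V) :
    symmetrizer ρ T (ρ σ v) = symmetrizer ρ T v := by
  rw [symmetrizer_apply, symmetrizer_apply]
  refine Finset.sum_bij' (fun τ _ => τ * σ) (fun τ _ => τ * σ⁻¹)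
    (fun τ hτ => mul_mem_permsOn hτ hσ) (fun τ hτ => mul_mem_permsOn hτ (inv_mem_permsOn hσ))
    (fun τ _ => by simp) (fun τ _ => by simp) (fun τ _ => by simp)

theorem rep_apply_symmetrizer {T : Finset X} {σ : Equiv.Perm X} (hσ : σ ∈ permsOn T) (v : V) :
    ρ σ (symmetrizer ρ T v) = symmetrizer ρ T v := by
  rw [symmetrizer_apply, map_sum]
  refine Finset.sum_bij' (fun τ _ => σ * τ) (fun τ _ => σ⁻¹ * τ)
    (fun τ hτ => mul_mem_permsOn hσ hτ) (fun τ hτ => mul_mem_permsOn (inv_mem_permsOn hσ) hτ)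
    (fun τ _ => by simp) (fun τ _ => by simp) (fun τ _ => by simp)

end SymmetrizerAbsorption

/-! ### Homomorphisms from Specht modules and bounds on the first row -/

section SpechtHoms

variable {F : Type*} [Field F] {m : ℕ} {μ ν : YoungDiagram}
  {V : Type*} [AddCommGroup V] [Module F V] {ρ : Representation F (Equiv.Perm (Fin m)) V}

/-- Every vector in the image of a Young symmetrizer is the image of the polytabloid under an
equivariant map. -/
theorem exists_specht_hom (t : Tableau m μ) (v : V) : ∃ φ : spechtSpace F m μ →ₗ[F] V,
    (∀ σ u, φ (specht F m μ σ u) = ρ σ (φ u)) ∧ φ (spechtVec F t) = youngSym ρ t v := by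
  let f : (Tableau m μ →₀ F) →ₗ[F] V :=
    Finsupp.linearCombination F fun s : Tableau m μ => ρ (t.symm.trans s) v
  have hf : ∀ σ u, f (tableauRep F m μ σ u) = ρ σ (f u) := by
    intro σ u
    have : f ∘ₗ tableauRep F m μ σ = ρ σ ∘ₗ f := by
      ext s : 2
      simp only [LinearMap.comp_apply, Finsupp.lsingle_apply, tableauRep_single, f,
        Finsupp.linearCombination_single, one_smul]
      rw [← Module.End.mul_apply, ← map_mul]
      rfl
    exact LinearMap.congr_fun this u
  refine ⟨f ∘ₗ (spechtSpace F m μ).subtype, fun σ u => hf σ u, ?_⟩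
  change f (polytabloid F t) = _
  rw [← youngSym_single, map_youngSym hf]
  congr 1
  simp only [f, Finsupp.linearCombination_single, one_smul]
  rw [show t.symm.trans t = 1 by ext; simp, map_one, Module.End.one_apply]

theorem spechtVec_ne_zero (t : Tableau m μ) : spechtVec F t ≠ 0 := by
  intro h
  have h1 := congrArg (fun v => v.1 t) h
  simp only [spechtVec, polytabloid_apply_self] at h1
  exact one_ne_zero h1

theorem exists_tableau_of_ne_zero {v : spechtSpace F m μ} (hv : v ≠ 0) :
    Nonempty (Tableau m μ) := by
  by_contra h
  rw [not_nonempty_iff] at h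
  have h1 := Submodule.mem_top (R := F) (x := v)
  rw [← span_spechtVec, Set.range_eq_empty, Submodule.span_empty] at h1
  exact hv ((Submodule.mem_bot F).1 h1)

variable [CharZero F]

theorem injective_of_specht_hom {φ : spechtSpace F m μ →ₗ[F] V}
    (hφ : ∀ σ u, φ (specht F m μ σ u) = ρ σ (φ u)) (h0 : φ ≠ 0) : Function.Injective φ := by
  refine (LinearMap.ker_eq_bot (M := spechtSpace F m μ)).1 ?_
  refine (specht_eq_bot_or_eq_top (U := LinearMap.ker φ) fun σ v hv => ?_).resolve_right
    fun h => h0 (LinearMap.ker_eq_top.1 h)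
  rw [LinearMap.mem_ker] at *
  rw [hφ, hv, map_zero]

theorem youngSym_ne_zero_of_injective {φ : spechtSpace F m μ →ₗ[F] V}
    (hφ : ∀ σ u, φ (specht F m μ σ u) = ρ σ (φ u)) (hi : Function.Injective φ) (t : Tableau m μ) :
    youngSym ρ t (φ (spechtVec F t)) ≠ 0 := by
  obtain ⟨h, h0, hh⟩ := exists_youngSym_spechtVec (F := F) t
  rw [← map_youngSym (V := spechtSpace F m μ) hφ, hh]
  exact fun h1 => smul_ne_zero h0 (spechtVec_ne_zero t) (hi (h1.trans (map_zero φ).symm))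

/-- If R_t C_s vanishes for every tableau s, the Young symmetrizer of t kills S^ν. So for some s the
letters of each row of t lie in different columns of s, which forces dominance. -/
theorem card_cols_le_of_youngSym_ne_zero {t : Tableau m μ} {v : spechtSpace F m ν}
    (h : youngSym (V := spechtSpace F m ν) (specht F m ν) t v ≠ 0) (j : ℕ) :
    (Finset.univ.filter fun c : ν.cells => c.1.2 < j).card ≤
      (Finset.univ.filter fun c : μ.cells => c.1.2 < j).card := by
  by_contra hlt
  refine h ?_
  have h1 : (⊤ : Submodule F (spechtSpace F m ν)) ≤
      LinearMap.ker (youngSym (V := spechtSpace F m ν) (specht F m ν) t) := by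
    rw [← span_spechtVec]
    refine Submodule.span_le.2 ?_
    rintro _ ⟨s, rfl⟩
    rw [SetLike.mem_coe, LinearMap.mem_ker]
    refine Subtype.ext ?_
    refine (map_youngSym (V := spechtSpace F m ν) (ρ := specht F m ν) (ρ' := tableauRep F m ν)
      (φ := (spechtSpace F m ν).subtype) (fun _ _ => rfl) t (spechtVec F s)).trans ?_
    change youngSym (tableauRep F m ν) t (polytabloid F s) = 0
    rw [← youngSym_single, ← Module.End.mul_apply, youngSym, youngSym,
      show colOp (tableauRep F m ν) t * rowOp (tableauRep F m ν) t *
          (colOp (tableauRep F m ν) s * rowOp (tableauRep F m ν) s) =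
        colOp (tableauRep F m ν) t * (rowOp (tableauRep F m ν) t * colOp (tableauRep F m ν) s) *
          rowOp (tableauRep F m ν) s by simp only [mul_assoc]]
    rcases injective_or_exists (t.trans s.symm) with hx | ⟨a, b, hab, hrow, hcol⟩
    · exact absurd (card_cols_le _ hx j) hlt
    · rw [rowOp_mul_colOp_eq_zero hab hrow hcol, mul_zero, zero_mul, LinearMap.zero_apply]
  exact h1 Submodule.mem_top

/-- A nonzero map is bijective by simplicity, so Young symmetrizers of each shape act nontrivially
on the other module; dominance in both directions gives equality. -/
theorem eq_of_specht_hom {φ : spechtSpace F m μ →ₗ[F] spechtSpace F m ν}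
    (hφ : ∀ σ u, φ (specht F m μ σ u) = specht F m ν σ (φ u)) (h0 : φ ≠ 0) : μ = ν := by
  have hi := injective_of_specht_hom (V := spechtSpace F m ν) hφ h0
  obtain ⟨v, hv⟩ : ∃ v, φ v ≠ 0 := by
    by_contra! h
    exact h0 (LinearMap.ext h)
  obtain ⟨t⟩ := exists_tableau_of_ne_zero (F := F) (v := v) (by rintro rfl; simp at hv)
  obtain ⟨s⟩ := exists_tableau_of_ne_zero hv
  have hs : Function.Surjective φ := by
    rw [← LinearMap.range_eq_top]
    refine (specht_eq_bot_or_eq_top (U := LinearMap.range φ) ?_).resolve_left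
      fun h => h0 (LinearMap.range_eq_bot.1 h)
    rintro σ _ ⟨u, rfl⟩
    exact ⟨_, hφ σ u⟩
  obtain ⟨u, hu⟩ := hs (spechtVec F s)
  have h1 := youngSym_ne_zero_of_injective (V := spechtSpace F m ν) hφ hi t
  have h2 : youngSym (V := spechtSpace F m μ) (specht F m μ) s u ≠ 0 := by
    obtain ⟨h, hh0, hh⟩ := exists_youngSym_spechtVec (F := F) s
    intro h3
    have h4 := map_youngSym (V := spechtSpace F m μ) (W := spechtSpace F m ν) hφ s u
    rw [h3, hu, hh, map_zero, eq_comm] at h4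
    exact smul_ne_zero hh0 (spechtVec_ne_zero s) h4
  exact eq_of_card_cols_eq fun j => le_antisymm (card_cols_le_of_youngSym_ne_zero h1 j)
    (card_cols_le_of_youngSym_ne_zero h2 j)

theorem symm_permCongr_mem_rowPerms {t : Tableau m μ} {T : Finset (Fin m)} {i : ℕ}
    (hT : ∀ x ∈ T, (t.symm x).1.1 = i) {σ : Equiv.Perm (Fin m)} (hσ : σ ∈ permsOn T) :
    t.symm.permCongr σ ∈ rowPerms μ := by
  rw [mem_rowPerms]
  intro c
  rw [Equiv.permCongr_apply, Equiv.symm_symm]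
  by_cases hc : t c ∈ T
  · have h2 : σ (t c) ∈ T := by
      rw [← image_eq_of_mem_permsOn hσ]
      exact Finset.mem_image_of_mem _ hc
    rw [hT _ h2, ← hT _ hc, Equiv.symm_apply_apply]
  · rw [mem_permsOn.1 hσ _ hc, Equiv.symm_apply_apply]

omit [CharZero F] in
theorem rowOp_symmetrizer {t : Tableau m μ} {T : Finset (Fin m)} {i : ℕ}
    (hT : ∀ x ∈ T, (t.symm x).1.1 = i) (v : V) :
    rowOp ρ t (symmetrizer ρ T v) = (permsOn T).card • rowOp ρ t v := by
  rw [symmetrizer_apply, map_sum, ← Finset.sum_const]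
  refine Finset.sum_congr rfl fun σ hσ => ?_
  have h3 := LinearMap.congr_fun (rowOp_mul (ρ := ρ) (t := t) (symm_permCongr_mem_rowPerms hT hσ)) v
  rw [Module.End.mul_apply] at h3
  rw [← h3]
  congr 3
  ext x
  simp [Equiv.permCongr_apply]

theorem symmetrizer_ne_zero {t : Tableau m μ} {T : Finset (Fin m)} {i : ℕ}
    (hT : ∀ x ∈ T, (t.symm x).1.1 = i) {v : V} (hv : youngSym ρ t v ≠ 0) :
    youngSym ρ t (symmetrizer ρ T v) ≠ 0 := by
  rw [youngSym, Module.End.mul_apply, rowOp_symmetrizer hT, map_nsmul, ← Nat.cast_smul_eq_nsmul F]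
  refine smul_ne_zero (Nat.cast_ne_zero.2 (Finset.card_ne_zero_of_mem (a := 1) ?_)) hv
  exact mem_permsOn.2 fun _ _ => rfl

/-- A symmetrizer of more letters than the length of the first row kills the Specht module. -/
theorem symmetrizer_specht_eq_zero {T : Finset (Fin m)} (hT : μ.rowLen 0 < T.card)
    (v : spechtSpace F m μ) : symmetrizer (V := spechtSpace F m μ) (specht F m μ) T v = 0 := by
  have h1 : (⊤ : Submodule F (spechtSpace F m μ)) ≤
      LinearMap.ker (symmetrizer (V := spechtSpace F m μ) (specht F m μ) T) := by
    rw [← span_spechtVec]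
    refine Submodule.span_le.2 ?_
    rintro _ ⟨s, rfl⟩
    obtain ⟨x, hx, y, hy, hxy, hc⟩ := Finset.exists_ne_map_eq_of_card_lt_of_maps_to
      (t := Finset.range (μ.rowLen 0)) (f := fun x : Fin m => (s.symm x).1.2)
      (by rwa [Finset.card_range]) (fun x _ => by
        have h2 := μ.up_left_mem (Nat.zero_le _) le_rfl
          ((YoungDiagram.mem_cells (s.symm x).1).1 (s.symm x).2)
        exact Finset.mem_coe.2 (Finset.mem_range.2 (YoungDiagram.mem_iff_lt_rowLen.1 h2)))
    rw [SetLike.mem_coe, LinearMap.mem_ker]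
    refine eq_zero_of_eq_neg F ?_
    have h3 : specht F m μ (Equiv.swap x y) (spechtVec F s) = - spechtVec F s := by
      refine Subtype.ext ?_
      change tableauRep F m μ (Equiv.swap x y) (polytabloid F s) = - polytabloid F s
      have h4 := mul_colOp (ρ := tableauRep F m μ) (t := s) (swap_mem_colPerms hc)
      rw [permCongr_swap, Equiv.apply_symm_apply, Equiv.apply_symm_apply,
        Equiv.Perm.sign_swap fun h => hxy (s.symm.injective h)] at h4
      rw [← youngSym_single, youngSym, ← Module.End.mul_apply, ← mul_assoc, h4]
      simp
    have h5 := symmetrizer_apply_rep (V := spechtSpace F m μ) (specht F m μ)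
      (swap_mem_permsOn hx hy) (spechtVec F s)
    rw [h3] at h5
    exact h5.symm.trans
      (LinearMap.map_neg (M := spechtSpace F m μ) (M₂ := spechtSpace F m μ) _ _)
  exact h1 Submodule.mem_top

/-- If the first row had k + 1 cells, symmetrizing over their letters would change the row operator
only by a nonzero factor and could not kill the module. -/
theorem rowLen_le_of_symmetrizer_eq_zero {k : ℕ} (hμ : μ.card = m)
    (h : ∀ T : Finset (Fin m), T.card = k + 1 → ∀ v : spechtSpace F m μ,
      symmetrizer (V := spechtSpace F m μ) (specht F m μ) T v = 0) : μ.rowLen 0 ≤ k := by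
  by_contra! hlt
  obtain ⟨t⟩ := exists_tableau hμ
  have hT : ∀ x ∈ (Finset.univ.filter fun c : μ.cells => c.1.1 = 0 ∧ c.1.2 < k + 1).map
      t.toEmbedding, (t.symm x).1.1 = 0 := by
    intro x hx
    obtain ⟨c, hc, rfl⟩ := Finset.mem_map.1 hx
    simpa using (Finset.mem_filter.1 hc).2.1
  have h1 := symmetrizer_ne_zero (V := spechtSpace F m μ) (ρ := specht F m μ) hT
    (youngSym_ne_zero_of_injective (V := spechtSpace F m μ) (φ := LinearMap.id) (fun _ _ => rfl)
      Function.injective_id t)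
  refine h1 ?_
  rw [h _ ?_, map_zero]
  rw [Finset.card_map]
  exact (rowCount_eq_min μ 0 (k + 1)).trans (min_eq_right hlt)

end SpechtHoms

/-! ### Character orthogonality and exhaustion by counting -/

section Characters

variable {F : Type*} [Field F] [CharZero F] {G : Type*} [Group G] [Fintype G]
  {V W : Type*} [AddCommGroup V] [Module F V] [FiniteDimensional F V]
  [AddCommGroup W] [Module F W] [FiniteDimensional F W]
  (ρ : Representation F G V) (σ : Representation F G W)

theorem card_inv_mul_sum_character :
    (Nat.card G : F)⁻¹ * ∑ g, σ.character g * ρ.character g⁻¹ =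
      Module.finrank F (ρ.IntertwiningMap σ) := by
  have h : (Nat.card G : F) ≠ 0 := Nat.cast_ne_zero.2 Nat.card_pos.ne'
  let _ := invertibleOfNonzero h
  exact Representation.card_inv_mul_sum_char_mul_char_eq_finrank ρ σ

variable {ρ σ}

theorem sum_character_eq_zero (h : ∀ f : ρ.IntertwiningMap σ, f = 0) :
    ∑ g, σ.character g * ρ.character g⁻¹ = 0 := by
  have h1 := card_inv_mul_sum_character ρ σ
  have : Subsingleton (ρ.IntertwiningMap σ) := ⟨fun f g => (h f).trans (h g).symm⟩
  rw [Module.finrank_zero_of_subsingleton, Nat.cast_zero, mul_eq_zero] at h1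
  exact h1.resolve_left (inv_ne_zero (Nat.cast_ne_zero.2 Nat.card_pos.ne'))

variable (ρ) in
theorem sum_character_self_ne_zero [Nontrivial V] :
    ∑ g, ρ.character g * ρ.character g⁻¹ ≠ 0 := by
  intro h
  have h1 := card_inv_mul_sum_character ρ ρ
  rw [h, mul_zero, eq_comm, Nat.cast_eq_zero, Module.finrank_eq_zero_iff_of_free] at h1
  obtain ⟨v, hv⟩ := exists_ne (0 : V)
  have h2 := Subsingleton.elim (Representation.IntertwiningMap.id ρ) 0
  exact hv (congrArg (fun f : ρ.IntertwiningMap ρ => f v) h2)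

omit [CharZero F] [Fintype G] [FiniteDimensional F V] in
theorem character_out (ρ : Representation F G V) (g : G) :
    ρ.character (Quotient.out (ConjClasses.mk g)) = ρ.character g := by
  obtain ⟨h, hh⟩ := isConj_iff.1 (ConjClasses.mk_eq_mk_iff_isConj.1
    (Quotient.out_eq (ConjClasses.mk g)))
  have h1 := ρ.char_conj (Quotient.out (ConjClasses.mk g)) h
  rw [hh] at h1
  exact h1.symm

/-- If as many pairwise disjoint representations as conjugacy classes are given, then every nonzero
representation has a nonzero homomorphism from one of them. -/
theorem exists_intertwiningMap_ne_zero {S : ConjClasses G → Type*} [∀ c, AddCommGroup (S c)]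
    [∀ c, Module F (S c)] [∀ c, FiniteDimensional F (S c)] [∀ c, Nontrivial (S c)]
    (σ : ∀ c, Representation F G (S c))
    (hσ : ∀ c d, c ≠ d → ∀ f : (σ c).IntertwiningMap (σ d), f = 0)
    (ρ : Representation F G V) [Nontrivial V] : ∃ c, ∃ f : (σ c).IntertwiningMap ρ, f ≠ 0 := by
  classical
  by_contra! hρ
  let Φ : (ConjClasses G → F) →ₗ[F] (ConjClasses G → F) :=
    { toFun := fun f c => ∑ g, f (ConjClasses.mk g) * (σ c).character g⁻¹
      map_add' := fun f f' => by
        ext c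
        simp [add_mul, Finset.sum_add_distrib]
      map_smul' := fun a f => by
        ext c
        simp [Finset.mul_sum, mul_assoc] }
  have hΦ : ∀ f c, Φ f c = ∑ g, f (ConjClasses.mk g) * (σ c).character g⁻¹ := fun _ _ => rfl
  have hs : Function.Surjective Φ := by
    intro y
    -- By orthogonality the characters of the given representations invert Φ explicitly.
    -- Surjectivity between spaces of equal dimension gives injectivity, so a class function
    -- orthogonal to all of them is zero.
    refine ⟨fun e => ∑ d, (y d / ∑ g, (σ d).character g * (σ d).character g⁻¹) *
      (σ d).character (Quotient.out e), ?_⟩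
    ext c
    rw [hΦ]
    simp only [character_out, Finset.sum_mul]
    rw [Finset.sum_comm, Finset.sum_eq_single c]
    · simp only [mul_assoc]
      rw [← Finset.mul_sum, div_mul_cancel₀ _ (sum_character_self_ne_zero (σ c))]
    · intro d _ hd
      simp only [mul_assoc]
      rw [← Finset.mul_sum, sum_character_eq_zero (hσ c d hd.symm), mul_zero]
    · exact fun h => absurd (Finset.mem_univ c) h
  have hi := LinearMap.injective_iff_surjective.2 hs
  have h0 : (fun c : ConjClasses G => ρ.character (Quotient.out c)) = (0 : ConjClasses G → F) := by
    refine hi ?_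
    rw [map_zero]
    ext c
    rw [hΦ]
    simp only [character_out]
    exact sum_character_eq_zero (hρ c)
  refine sum_character_self_ne_zero ρ (Finset.sum_eq_zero fun g _ => ?_)
  rw [← character_out ρ g, show ρ.character (Quotient.out (ConjClasses.mk g)) = 0 from
    congrFun h0 _, zero_mul]

end Characters

/-! ### Specht modules exhaust the irreducible representations -/

section Exhaustion

theorem sum_rowLens (μ : YoungDiagram) : μ.rowLens.sum = μ.card := by
  rw [YoungDiagram.card, Finset.card_eq_sum_card_fiberwise (f := Prod.fst)
    (t := Finset.range (μ.colLen 0))]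
  · rw [YoungDiagram.rowLens, show ((List.range (μ.colLen 0)).map μ.rowLen).sum =
      ∑ i ∈ Finset.range (μ.colLen 0), μ.rowLen i from rfl]
    exact Finset.sum_congr rfl fun i _ => μ.rowLen_eq_card
  · intro c hc
    exact Finset.mem_coe.2 (Finset.mem_range.2 (YoungDiagram.mem_iff_lt_colLen.1
      (μ.up_left_mem le_rfl (Nat.zero_le _) ((YoungDiagram.mem_cells c).1 hc))))

/-- The diagram has the cycle type, sorted decreasingly, as its rows; the cycle type determines the
conjugacy class. -/
theorem exists_diagram_of_conjClasses (m : ℕ) :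
    ∃ D : ConjClasses (Equiv.Perm (Fin m)) → YoungDiagram,
      Function.Injective D ∧ ∀ c, (D c).card = m := by
  let p : ConjClasses (Equiv.Perm (Fin m)) → (Fintype.card (Fin m)).Partition :=
    fun c => (Quotient.out c).partition
  let w : ConjClasses (Equiv.Perm (Fin m)) → List ℕ := fun c => (p c).parts.sort (· ≥ ·)
  have hw : ∀ c, (w c).SortedGE := fun c =>
    (Multiset.pairwise_sort (p c).parts (· ≥ ·)).sortedGE
  have hpos : ∀ c, ∀ x ∈ w c, 0 < x := fun c x hx =>
    (p c).parts_pos ((Multiset.mem_sort _).1 hx)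
  have hrow : ∀ c, (YoungDiagram.ofRowLens (w c) (hw c)).rowLens = w c := fun c =>
    YoungDiagram.rowLens_ofRowLens_eq_self (hpos c)
  refine ⟨fun c => YoungDiagram.ofRowLens (w c) (hw c), fun c d hcd => ?_, fun c => ?_⟩
  · have h1 : w c = w d := by rw [← hrow c, ← hrow d, show YoungDiagram.ofRowLens (w c) (hw c) = YoungDiagram.ofRowLens (w d) (hw d) from hcd]
    have h2 : p c = p d := Nat.Partition.ext (by
      rw [← Multiset.sort_eq (p c).parts (· ≥ ·), ← Multiset.sort_eq (p d).parts (· ≥ ·)]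
      exact congrArg _ h1)
    have h3 := Equiv.Perm.partition_eq_of_isConj.2 h2
    rw [← Quotient.out_eq c, ← Quotient.out_eq d]
    exact ConjClasses.mk_eq_mk_iff_isConj.2 h3
  · rw [← sum_rowLens, hrow, ← Multiset.sum_coe, Multiset.sort_eq, (p c).parts_sum,
      Fintype.card_fin]

variable {F : Type*} [Field F] [CharZero F] {m : ℕ} {V : Type*} [AddCommGroup V] [Module F V]

/-- Every nonzero representation of a symmetric group contains a Specht module. -/
theorem exists_specht_hom_injective [FiniteDimensional F V] [Nontrivial V]
    (ρ : Representation F (Equiv.Perm (Fin m)) V) :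
    ∃ μ : YoungDiagram, μ.card = m ∧ ∃ φ : spechtSpace F m μ →ₗ[F] V,
      (∀ σ u, φ (specht F m μ σ u) = ρ σ (φ u)) ∧ Function.Injective φ := by
  obtain ⟨D, hD, hDm⟩ := exists_diagram_of_conjClasses m
  have hnt : ∀ c, Nontrivial (spechtSpace F m (D c)) := fun c => by
    obtain ⟨t⟩ := exists_tableau (hDm c)
    exact ⟨⟨spechtVec F t, 0, spechtVec_ne_zero t⟩⟩
  obtain ⟨c, f, hf⟩ := exists_intertwiningMap_ne_zero
    (S := fun c => spechtSpace F m (D c)) (fun c => specht F m (D c)) (fun c d hcd f => by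
      by_contra h0
      refine hcd (hD (eq_of_specht_hom (φ := f.toLinearMap)
        (fun σ u => LinearMap.congr_fun (f.isIntertwining' σ) u) fun h => h0 ?_))
      exact Representation.IntertwiningMap.toLinearMap_injective _ _ h) ρ
  have he : ∀ σ u, f.toLinearMap (specht F m (D c) σ u) = ρ σ (f.toLinearMap u) :=
    fun σ u => LinearMap.congr_fun (f.isIntertwining' σ) u
  exact ⟨D c, hDm c, f.toLinearMap, he, injective_of_specht_hom he fun h =>
    hf (Representation.IntertwiningMap.toLinearMap_injective _ _ h)⟩

end Exhaustion

/-! ### Direct sum decompositions -/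

section Decompositions

variable {F : Type*} [Field F] {G : Type*} [Group G] {ι : Type*} [Fintype ι]
  {S : ι → Type*} [∀ i, AddCommGroup (S i)] [∀ i, Module F (S i)]
  {V : Type*} [AddCommGroup V] [Module F V]

theorem toModule_apply_eq_sum [DecidableEq ι] (φ : ∀ i, S i →ₗ[F] V) (x : DirectSum ι S) :
    DirectSum.toModule F ι V φ x = ∑ i, φ i (x i) := by
  have h1 : DirectSum.toModule F ι V φ = ∑ i, φ i ∘ₗ DirectSum.component F ι S i := by
    refine DirectSum.linearMap_ext F fun i => LinearMap.ext fun u => ?_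
    rw [LinearMap.comp_apply, LinearMap.comp_apply, DirectSum.toModule_lof, LinearMap.sum_apply,
      Finset.sum_eq_single i]
    · rw [LinearMap.comp_apply, DirectSum.component.lof_self]
    · intro j _ hj
      rw [LinearMap.comp_apply, DirectSum.component.of, dif_neg hj.symm, map_zero]
    · exact fun hi => absurd (Finset.mem_univ i) hi
  rw [h1, LinearMap.sum_apply]
  rfl

theorem injective_toModule [DecidableEq ι] {φ : ∀ i, S i →ₗ[F] V}
    (h : ∀ x : ∀ i, S i, ∑ i, φ i (x i) = 0 → x = 0) :
    Function.Injective (DirectSum.toModule F ι V φ) := by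
  rw [← LinearMap.ker_eq_bot, LinearMap.ker_eq_bot']
  intro x hx
  have h1 := h (fun i => x i) ((toModule_apply_eq_sum φ x).symm.trans hx)
  exact DFinsupp.ext fun i => congrFun h1 i

theorem card_le_of_forall_eq_zero {W : Type*} [AddCommGroup W] [Module F W] [FiniteDimensional F W]
    [Nontrivial W] [∀ i, FiniteDimensional F (S i)]
    (hS : ∀ i, Module.finrank F (S i) = Module.finrank F W) {c : ℕ}
    (p : ∀ i, DirectSum (Fin c) (fun _ => W) →ₗ[F] S i) (hp : ∀ x, (∀ i, p i x = 0) → x = 0) :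
    c ≤ Fintype.card ι := by
  have hg : Function.Injective (LinearMap.pi p) := by
    rw [← LinearMap.ker_eq_bot, LinearMap.ker_eq_bot']
    exact fun x hx => hp x fun i => congrFun hx i
  have h3 := LinearMap.finrank_le_finrank_of_injective hg
  rw [Module.finrank_directSum, Module.finrank_pi_fintype, Finset.sum_congr rfl fun i _ => hS i,
    Finset.sum_const, Finset.sum_const, Finset.card_univ, Finset.card_univ, Fintype.card_fin,
    smul_eq_mul, smul_eq_mul] at h3
  exact Nat.le_of_mul_le_mul_right h3 Module.finrank_pos

omit [Fintype ι] in
theorem toModule_comp_directSum [DecidableEq ι] {σ : ∀ i, Representation F G (S i)}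
    {ρ : Representation F G V} {φ : ∀ i, S i →ₗ[F] V} (hφ : ∀ i g u, φ i (σ i g u) = ρ g (φ i u))
    (g : G) : DirectSum.toModule F ι V φ ∘ₗ Representation.directSum σ g =
      ρ g ∘ₗ DirectSum.toModule F ι V φ := by
  refine DirectSum.linearMap_ext F fun i => LinearMap.ext fun u => ?_
  simp only [LinearMap.comp_apply, Representation.directSum_apply, DirectSum.lmap_lof,
    DirectSum.toModule_lof]
  exact hφ i g u

theorem exists_injective_intertwiningMap {σ : ∀ i, Representation F G (S i)}
    {ρ : Representation F G V} {φ : ∀ i, S i →ₗ[F] V} (hφ : ∀ i g u, φ i (σ i g u) = ρ g (φ i u))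
    (h : ∀ x : ∀ i, S i, ∑ i, φ i (x i) = 0 → x = 0) :
    ∃ f : (Representation.directSum σ).IntertwiningMap ρ, Function.Injective f := by
  classical
  exact ⟨⟨DirectSum.toModule F ι V φ, toModule_comp_directSum hφ⟩, injective_toModule h⟩

/-- The maps `φ i` exhibit `ρ` as the direct sum of the representations `σ i`. -/
structure IsDecomposition (σ : ∀ i, Representation F G (S i)) (ρ : Representation F G V)
    (φ : ∀ i, S i →ₗ[F] V) : Prop where
  map_rep : ∀ i g u, φ i (σ i g u) = ρ g (φ i u)
  eq_zero : ∀ x : ∀ i, S i, ∑ i, φ i (x i) = 0 → x = 0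
  exists_eq : ∀ v, ∃ x : ∀ i, S i, ∑ i, φ i (x i) = v

namespace IsDecomposition

variable {σ : ∀ i, Representation F G (S i)} {ρ : Representation F G V} {φ : ∀ i, S i →ₗ[F] V}

theorem injective (h : IsDecomposition σ ρ φ) (i : ι) : Function.Injective (φ i) := by
  classical
  rw [← LinearMap.ker_eq_bot, LinearMap.ker_eq_bot']
  intro u hu
  have h1 := h.eq_zero (Pi.single i u) (by
    rw [Finset.sum_eq_single i]
    · rw [Pi.single_eq_same, hu]
    · intro j _ hj
      rw [Pi.single_eq_of_ne hj, map_zero]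
    · exact fun hi => absurd (Finset.mem_univ i) hi)
  rw [← Pi.single_eq_same (M := S) i u, h1, Pi.zero_apply]

theorem reindex (h : IsDecomposition σ ρ φ) {κ : Type*} [Fintype κ] (e : κ ≃ ι) :
    IsDecomposition (fun j => σ (e j)) ρ (fun j => φ (e j)) where
  map_rep j := h.map_rep (e j)
  eq_zero x hx := by
    have h1 := h.eq_zero (e.piCongrLeft S x) (by
      rw [← e.sum_comp, ← hx]
      exact Finset.sum_congr rfl fun j _ => by rw [e.piCongrLeft_apply_apply])
    ext j
    rw [← e.piCongrLeft_apply_apply S x j, h1]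
    rfl
  exists_eq v := by
    obtain ⟨x, rfl⟩ := h.exists_eq v
    exact ⟨fun j => x (e j), e.sum_comp fun i => φ i (x i)⟩

theorem nonempty_equiv (h : IsDecomposition σ ρ φ) :
    Nonempty (ρ.Equiv (Representation.directSum σ)) := by
  classical
  have hb : Function.Bijective (DirectSum.toModule F ι V φ) := by
    constructor
    · exact injective_toModule h.eq_zero
    · intro v
      obtain ⟨x, rfl⟩ := h.exists_eq v
      refine ⟨DFinsupp.equivFunOnFintype.symm x, ?_⟩
      rw [toModule_apply_eq_sum]
      rfl
  exact ⟨(Representation.IntertwiningMap.ofBijective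
    ⟨DirectSum.toModule F ι V φ, toModule_comp_directSum h.map_rep⟩ hb).symm⟩

/-- The components of a vector with respect to a decomposition. -/
theorem exists_proj (h : IsDecomposition σ ρ φ) : ∃ p : ∀ i, V →ₗ[F] S i,
    (∀ i g v, p i (ρ g v) = σ i g (p i v)) ∧ (∀ v, ∑ i, φ i (p i v) = v) ∧
      ∀ i u, p i (φ i u) = u := by
  classical
  let f : (∀ i, S i) →ₗ[F] V := ∑ i, φ i ∘ₗ LinearMap.proj i
  have hf : ∀ x, f x = ∑ i, φ i (x i) := fun x => by simp [f]
  have hb : Function.Bijective f := by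
    constructor
    · rw [← LinearMap.ker_eq_bot, LinearMap.ker_eq_bot']
      exact fun x hx => h.eq_zero x ((hf x).symm.trans hx)
    · intro v
      obtain ⟨x, rfl⟩ := h.exists_eq v
      exact ⟨x, hf x⟩
  let e := LinearEquiv.ofBijective f hb
  have he : ∀ v, ∑ i, φ i (e.symm v i) = v := fun v => by
    rw [← hf]
    exact e.apply_symm_apply v
  refine ⟨fun i => LinearMap.proj i ∘ₗ e.symm.toLinearMap, fun i g v => ?_, he,
    fun i u => ?_⟩
  on_goal 2 =>
    have h1 : e.symm (φ i u) = Pi.single i u := by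
      rw [LinearEquiv.symm_apply_eq]
      refine Eq.trans ?_ (hf _).symm
      rw [Finset.sum_eq_single i, Pi.single_eq_same]
      · intro j _ hj
        rw [Pi.single_eq_of_ne hj, map_zero]
      · exact fun hi => absurd (Finset.mem_univ i) hi
    exact (congrFun h1 i).trans (Pi.single_eq_same i u)
  have h1 : e.symm (ρ g v) = fun i => σ i g (e.symm v i) := by
    rw [LinearEquiv.symm_apply_eq]
    refine Eq.trans ?_ (hf _).symm
    simp only [h.map_rep, ← map_sum, he]
  exact congrFun h1 i

end IsDecomposition

end Decompositions

/-! ### Complete reducibility and multiplicities -/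

section SpechtDecompositions

variable {F : Type*} [Field F] [CharZero F] {m : ℕ}

/-- Complete reducibility: every representation of a symmetric group is a direct sum of Specht
modules. -/
theorem exists_isDecomposition {V : Type*} [AddCommGroup V] [Module F V] [FiniteDimensional F V]
    (ρ : Representation F (Equiv.Perm (Fin m)) V) :
    ∃ (ι : Type) (_ : Fintype ι) (s : ι → YoungDiagram)
      (φ : ∀ i, spechtSpace F m (s i) →ₗ[F] V), (∀ i, (s i).card = m) ∧
        IsDecomposition (S := fun i => spechtSpace F m (s i)) (fun i => specht F m (s i)) ρ φ := by
  induction hd : Module.finrank F V using Nat.strong_induction_on generalizing V with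
  | _ d ih =>
  rcases subsingleton_or_nontrivial V with hV | hV
  · exact ⟨Empty, inferInstance, fun i => i.elim, fun i => i.elim, fun i => i.elim,
      fun i => i.elim, fun _ _ => funext fun i => i.elim,
      fun v => ⟨fun i => i.elim, Subsingleton.elim _ _⟩⟩
  obtain ⟨μ, hμ, ψ, hψ, hi⟩ := exists_specht_hom_injective ρ
  obtain ⟨U, hU, hc⟩ := exists_invariant_compl ρ (U := LinearMap.range ψ) (by
    rintro g _ ⟨u, rfl⟩
    exact ⟨_, hψ g u⟩)
  obtain ⟨t⟩ := exists_tableau hμ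
  have hlt : Module.finrank F U < d := by
    rw [← hd]
    refine Submodule.finrank_lt fun hU' => ?_
    have h1 := hc.inf_eq_bot
    rw [hU', inf_top_eq, LinearMap.range_eq_bot] at h1
    exact spechtVec_ne_zero t (hi (by rw [h1]; rfl))
  obtain ⟨ι, hι, s, φ, hs, h⟩ := ih _ hlt (ρ.subrepresentation U hU) rfl
  refine ⟨Option ι, inferInstance, fun i => i.elim μ s,
    fun i => match i with
      | none => ψ
      | some i => U.subtype ∘ₗ φ i, ?_, ?_, ?_, ?_⟩
  · rintro (_ | i)
    · exact hμ
    · exact hs i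
  · rintro (_ | i) g u
    · exact hψ g u
    · exact congrArg Subtype.val (h.map_rep i g u)
  · intro x hx
    rw [Fintype.sum_option] at hx
    have h1 : ∑ i, φ i (x (some i)) = 0 := by
      have h2 : (∑ i, φ i (x (some i))).1 ∈ LinearMap.range ψ := by
        have h3 : (∑ i, φ i (x (some i))).1 = - ψ (x none) := by
          rw [eq_neg_iff_add_eq_zero, add_comm, ← hx, Submodule.coe_sum]
          rfl
        rw [h3]
        exact Submodule.neg_mem _ ⟨_, rfl⟩
      have h3 : (∑ i, φ i (x (some i))).1 ∈ LinearMap.range ψ ⊓ U := ⟨h2, Subtype.prop _⟩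
      rw [hc.inf_eq_bot] at h3
      exact Subtype.ext ((Submodule.mem_bot F).1 h3)
    have h4 := h.eq_zero _ h1
    have h5 : ψ (x none) = 0 := by
      have h6 := congrArg Subtype.val h1
      rw [Submodule.coe_sum] at h6
      change ψ (x none) + ∑ i, (φ i (x (some i))).1 = 0 at hx
      rwa [h6, Submodule.coe_zero, add_zero] at hx
    ext1 i
    rcases i with _ | i
    · exact hi (h5.trans (map_zero ψ).symm)
    · exact congrFun h4 i
  · intro v
    obtain ⟨_, ⟨u, rfl⟩, w, hw, rfl⟩ := Submodule.mem_sup.1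
      (hc.sup_eq_top ▸ Submodule.mem_top : v ∈ LinearMap.range ψ ⊔ U)
    obtain ⟨x, hx⟩ := h.exists_eq ⟨w, hw⟩
    refine ⟨fun i => match i with
      | none => u
      | some i => x i, ?_⟩
    rw [Fintype.sum_option]
    have h6 := congrArg Subtype.val hx
    rw [Submodule.coe_sum] at h6
    exact congrArg (ψ u + ·) h6

/-- Specht modules of equal diagrams are equal. -/
noncomputable def spechtCast (F : Type*) [Field F] (m : ℕ) {μ ν : YoungDiagram} (h : μ = ν) :
    spechtSpace F m μ ≃ₗ[F] spechtSpace F m ν := h ▸ LinearEquiv.refl F (spechtSpace F m μ)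

omit [CharZero F] in
theorem spechtCast_specht {μ ν : YoungDiagram} (h : μ = ν) (σ : Equiv.Perm (Fin m))
    (u : spechtSpace F m μ) :
    spechtCast F m h (specht F m μ σ u) = specht F m ν σ (spechtCast F m h u) := by
  subst h
  rfl

open Classical in
-- The summands of shape μ embed together. Conversely, an embedding of c copies has zero components
-- in the other summands, so a dimension count bounds c.
theorem multiplicity_eq {V : Type*} [AddCommGroup V] [Module F V] [FiniteDimensional F V]
    {ρ : Representation F (Equiv.Perm (Fin m)) V} {ι : Type} [Fintype ι] {s : ι → YoungDiagram}
    {φ : ∀ i, spechtSpace F m (s i) →ₗ[F] V}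
    (h : IsDecomposition (S := fun i => spechtSpace F m (s i)) (fun i => specht F m (s i)) ρ φ)
    {μ : YoungDiagram} (hμ : μ.card = m) :
    multiplicity ρ μ = Fintype.card {i // s i = μ} := by
  obtain ⟨t⟩ := exists_tableau hμ
  refine IsGreatest.csSup_eq ⟨?_, ?_⟩
  · let e := (Fintype.equivFin {i // s i = μ}).symm
    let ψ : Fin (Fintype.card {i // s i = μ}) → spechtSpace F m μ →ₗ[F] V :=
      fun j => φ (e j) ∘ₗ (spechtCast F m (e j).2.symm).toLinearMap
    have hψ : ∀ j g u, ψ j (specht F m μ g u) = ρ g (ψ j u) := fun j g u =>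
      (congrArg (φ (e j)) (spechtCast_specht (e j).2.symm g u)).trans (h.map_rep (e j) g _)
    refine exists_injective_intertwiningMap (S := fun _ => spechtSpace F m μ)
      (σ := fun _ => specht F m μ) hψ fun x hx => ?_
    have h1 := h.eq_zero (fun i => if hi : s i = μ then
      spechtCast F m hi.symm (x (e.symm ⟨i, hi⟩)) else 0) (by
        rw [← hx]
        symm
        refine Finset.sum_of_injOn (fun j => (e j).1) ?_ (fun _ _ => Finset.mem_coe.2 (Finset.mem_univ _)) ?_ ?_
        · exact fun i _ j _ hij => e.injective (Subtype.ext hij)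
        · intro i _ hi
          rw [dif_neg, map_zero]
          exact fun hs => hi ⟨e.symm ⟨i, hs⟩, by simp, by simp⟩
        · intro j _
          rw [dif_pos (e j).2]
          simp [ψ])
    ext1 j
    have h2 := congrFun h1 (e j)
    simp only [dif_pos (e j).2, Subtype.coe_eta, Equiv.symm_apply_apply] at h2
    exact (spechtCast F m (e j).2.symm).map_eq_zero_iff.1 h2
  · rintro c ⟨f, hf⟩
    obtain ⟨p, hp, hφp, -⟩ := h.exists_proj
    have hzero : ∀ i, s i ≠ μ → p i ∘ₗ f.toLinearMap = 0 := by
      intro i hi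
      refine DirectSum.linearMap_ext F fun j => ?_
      by_contra h0
      refine hi (eq_of_specht_hom (φ := p i ∘ₗ f.toLinearMap ∘ₗ
        DirectSum.lof F (Fin c) (fun _ => spechtSpace F m μ) j) (fun σ u => ?_) h0).symm
      have h2 := LinearMap.congr_fun (f.isIntertwining' σ)
        (DirectSum.lof F (Fin c) (fun _ => spechtSpace F m μ) j u)
      rw [LinearMap.comp_apply, Representation.directSum_apply, DirectSum.lmap_lof] at h2
      simp only [LinearMap.comp_apply]
      rw [h2]
      exact hp i σ _
    have : Nontrivial (spechtSpace F m μ) := ⟨⟨spechtVec F t, 0, spechtVec_ne_zero t⟩⟩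
    refine card_le_of_forall_eq_zero (W := spechtSpace F m μ)
      (S := fun i : {i // s i = μ} => spechtSpace F m (s i)) (fun i => by rw [i.2])
      (fun i => p i ∘ₗ f.toLinearMap) fun x hx => hf ?_
    rw [map_zero, ← hφp (f x)]
    refine Finset.sum_eq_zero fun i _ => ?_
    by_cases hi : s i = μ
    · rw [show p i (f x) = 0 from hx ⟨i, hi⟩, map_zero]
    · rw [show p i (f x) = 0 from LinearMap.congr_fun (hzero i hi) x, map_zero]

end SpechtDecompositions

/-! ### Symmetrizations of translates of an invariant vector -/

section SymmetrizerImage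

variable {F : Type*} [Field F] [CharZero F] {X : Type} [Fintype X] [DecidableEq X]
  {V : Type*} [AddCommGroup V] [Module F V] {ρ : Representation F (Equiv.Perm X) V}

omit [CharZero F] in
theorem symmetrizer_apply_of_fixed {K : Finset X} {v : V} (hv : ∀ σ ∈ permsOn K, ρ σ v = v) :
    symmetrizer ρ K v = (permsOn K).card • v := by
  rw [symmetrizer_apply, Finset.sum_congr rfl hv, Finset.sum_const]

theorem smul_card_permsOn_eq_zero (F : Type*) [Field F] [CharZero F] {V : Type*}
    [AddCommGroup V] [Module F V] {K : Finset X} {v : V} : (permsOn K).card • v = 0 ↔ v = 0 := by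
  refine ⟨fun h => ?_, fun h => by rw [h, smul_zero]⟩
  rw [← Nat.cast_smul_eq_nsmul F, smul_eq_zero] at h
  exact h.resolve_left (Nat.cast_ne_zero.2
    (Finset.card_ne_zero_of_mem (a := 1) (mem_permsOn.2 fun _ _ => rfl)))

omit [CharZero F] in
/-- A permutation preserving `K` is the product of permutations of `K` and of its complement. -/
theorem exists_mul_eq_of_image_eq {K : Finset X} {σ : Equiv.Perm X} (h : K.image σ = K) :
    ∃ τ ∈ permsOn K, ∃ π ∈ permsOn Kᶜ, σ = τ * π := by
  have h1 : ∀ x, x ∈ K ↔ σ x ∈ K := fun x => by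
    conv_rhs => rw [← h]
    simp
  refine ⟨Equiv.Perm.ofSubtype (σ.subtypePerm fun x => (h1 x).symm), mem_permsOn.2 fun x hx =>
    Equiv.Perm.ofSubtype_apply_of_not_mem _ hx, (Equiv.Perm.ofSubtype
      (σ.subtypePerm fun x => (h1 x).symm))⁻¹ * σ, mem_permsOn.2 fun x hx => ?_, by group⟩
  rw [Finset.mem_compl, not_not] at hx
  rw [Equiv.Perm.mul_apply, Equiv.Perm.inv_eq_iff_eq, Equiv.Perm.ofSubtype_apply_of_mem _ hx]
  rfl

theorem commute_of_mem_permsOn {K : Finset X}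
    {τ π : Equiv.Perm X} (hτ : τ ∈ permsOn K) (hπ : π ∈ permsOn Kᶜ) : τ * π = π * τ := by
  refine Equiv.Perm.Disjoint.commute fun x => ?_
  by_cases hx : x ∈ K
  · exact Or.inr (mem_permsOn.1 hπ x (by simpa using hx))
  · exact Or.inl (mem_permsOn.1 hτ x hx)

/-- If the symmetrizers of `|K| + 1` letters vanish, then a subspace stable under the permutations of
the complement of `K` which contains a `K`-invariant vector `v` contains all the `K`-symmetrizations
of the translates of `v`. -/
theorem symmetrizer_rep_mem {K : Finset X}
    (hJ : ∀ T : Finset X, T.card = K.card + 1 → ∀ v, symmetrizer ρ T v = 0)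
    {U : Submodule F V} (hU : ∀ π ∈ permsOn Kᶜ, ∀ u ∈ U, ρ π u ∈ U) {v : V} (hv : v ∈ U)
    (hfix : ∀ σ ∈ permsOn K, ρ σ v = v) (σ : Equiv.Perm X) : symmetrizer ρ K (ρ σ v) ∈ U := by
  induction hd : (K.image σ \ K).card generalizing σ with
  | zero =>
    have h1 : K.image σ = K := Finset.eq_of_subset_of_card_le
      (Finset.sdiff_eq_empty_iff_subset.1 (Finset.card_eq_zero.1 hd))
      (Finset.card_image_of_injective _ σ.injective).ge
    obtain ⟨τ, hτ, π, hπ, rfl⟩ := exists_mul_eq_of_image_eq h1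
    rw [map_mul, Module.End.mul_apply, symmetrizer_apply_rep ρ hτ, symmetrizer_apply_of_fixed]
    · exact nsmul_mem (hU π hπ v hv) _
    · intro τ' hτ'
      rw [← Module.End.mul_apply, ← map_mul, commute_of_mem_permsOn hτ' hπ, map_mul,
        Module.End.mul_apply, hfix τ' hτ']
  | succ d ih =>
    set L := K.image σ with hL
    have hLK : L.card = K.card := Finset.card_image_of_injective _ σ.injective
    have hne : (K \ L).Nonempty := by
      rw [← Finset.card_pos]
      have h1 := Finset.card_sdiff_add_card_inter K L
      have h2 := Finset.card_sdiff_add_card_inter L K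
      rw [Finset.inter_comm] at h2
      omega
    obtain ⟨y, hy⟩ := hne
    rw [Finset.mem_sdiff] at hy
    have hw : ∀ τ ∈ permsOn L, ρ τ (ρ σ v) = ρ σ v := by
      intro τ hτ
      have h1 : σ⁻¹ * τ * σ ∈ permsOn K := by
        rw [mem_permsOn] at hτ ⊢
        intro x hx
        rw [Equiv.Perm.mul_apply, Equiv.Perm.mul_apply, hτ (σ x), Equiv.Perm.inv_eq_iff_eq]
        rw [hL, Finset.mem_image]
        rintro ⟨x', hx', h⟩
        exact hx (σ.injective h ▸ hx')
      nth_rw 2 [← hfix _ h1]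
      rw [← Module.End.mul_apply, ← Module.End.mul_apply, ← map_mul, ← map_mul]
      congr 2
      group
    -- The vector ρ σ v is invariant under the permutations of L, so the vanishing symmetrizer of L
    -- ∪ {y} expresses it as minus the sum of its images under the exchanges of y with elements of
    -- L.
    have h1 := hJ (insert y L) (by rw [Finset.card_insert_of_notMem hy.2, hLK]) (ρ σ v)
    rw [symmetrizer_insert_eq_add_sum ρ hy.2, symmetrizer_apply_of_fixed hw] at h1
    simp only [map_nsmul] at h1
    rw [← Finset.smul_sum, ← smul_add, smul_card_permsOn_eq_zero F] at h1
    -- For z in L ∩ K the exchange of y and z is absorbed by the symmetrizer of K; for z outside K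
    -- it brings L closer to K, and induction applies.
    have h2 := congrArg (symmetrizer ρ K) h1
    rw [map_add, map_sum, map_zero, ← Finset.sum_inter_add_sum_sdiff L K,
      Finset.sum_congr rfl (fun z hz => symmetrizer_apply_rep ρ
        (swap_mem_permsOn hy.1 (Finset.mem_inter.1 hz).2) (ρ σ v)), Finset.sum_const,
      ← add_assoc, ← succ_nsmul', add_eq_zero_iff_eq_neg] at h2
    have h3 : ((L ∩ K).card + 1) • symmetrizer ρ K (ρ σ v) ∈ U := by
      rw [h2]
      refine Submodule.neg_mem _ (Submodule.sum_mem _ fun z hz => ?_)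
      obtain ⟨hzL, hzK⟩ := Finset.mem_sdiff.1 hz
      rw [← Module.End.mul_apply (ρ _) (ρ σ), ← map_mul]
      refine ih _ ?_
      have h4 : K.image (Equiv.swap y z * σ) = insert y (L.erase z) := by
        rw [Equiv.Perm.coe_mul, ← Finset.image_image, ← hL]
        ext x
        rw [Finset.mem_image, Finset.mem_insert, Finset.mem_erase]
        constructor
        · rintro ⟨x', hx', rfl⟩
          rcases eq_or_ne x' z with rfl | hxz
          · exact Or.inl (Equiv.swap_apply_right y x')
          · right
            rw [Equiv.swap_apply_of_ne_of_ne (fun h : x' = y => hy.2 (h ▸ hx')) hxz]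
            exact ⟨hxz, hx'⟩
        · rintro (rfl | ⟨hxz, hx⟩)
          · exact ⟨z, hzL, Equiv.swap_apply_right _ _⟩
          · exact ⟨x, hx, Equiv.swap_apply_of_ne_of_ne (fun h : x = y => hy.2 (h ▸ hx)) hxz⟩
      have h5 : insert y (L.erase z) \ K = (L \ K).erase z := by
        rw [Finset.insert_sdiff_of_mem _ hy.1, Finset.erase_sdiff_comm]
      rw [h4, h5, Finset.card_erase_of_mem hz, hd, Nat.add_sub_cancel]
    rw [← Nat.cast_smul_eq_nsmul F] at h3
    exact (Submodule.smul_mem_iff _ (Nat.cast_ne_zero.2 (Nat.succ_ne_zero _))).1 h3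

end SymmetrizerImage

/-! ### Permutations of the letters outside the distinguished set -/

section LeftPerm

variable {X Y Z : Type}

/-- Permutations of the first part, as permutations of all letters. -/
def leftPerm (θ : Y ⊕ Z ≃ X) : Equiv.Perm Y →* Equiv.Perm X where
  toFun τ := θ.permCongr (Equiv.sumCongr τ 1)
  map_one' := by
    ext x
    obtain ⟨a, rfl⟩ := θ.surjective x
    rcases a with y | z <;> simp [Equiv.permCongr_apply]
  map_mul' τ τ' := by
    ext x
    obtain ⟨a, rfl⟩ := θ.surjective x
    rcases a with y | z <;> simp [Equiv.permCongr_apply]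

@[simp]
theorem leftPerm_inl (θ : Y ⊕ Z ≃ X) (τ : Equiv.Perm Y) (y : Y) :
    leftPerm θ τ (θ (.inl y)) = θ (.inl (τ y)) := by
  simp [leftPerm, Equiv.permCongr_apply]

@[simp]
theorem leftPerm_inr (θ : Y ⊕ Z ≃ X) (τ : Equiv.Perm Y) (z : Z) :
    leftPerm θ τ (θ (.inr z)) = θ (.inr z) := by
  simp [leftPerm, Equiv.permCongr_apply]

variable [Fintype X] [DecidableEq X] [Fintype Z]

theorem leftPerm_mem_permsOn (θ : Y ⊕ Z ≃ X) (τ : Equiv.Perm Y) :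
    leftPerm θ τ ∈ permsOn (rightLetters θ)ᶜ := by
  rw [mem_permsOn]
  intro x hx
  rw [Finset.mem_compl, not_not] at hx
  obtain ⟨z, -, rfl⟩ := Finset.mem_map.1 hx
  exact leftPerm_inr θ τ z

theorem exists_leftPerm_eq (θ : Y ⊕ Z ≃ X) {π : Equiv.Perm X}
    (hπ : π ∈ permsOn (rightLetters θ)ᶜ) : ∃ τ, leftPerm θ τ = π := by
  have hr : ∀ z, π (θ (.inr z)) = θ (.inr z) := fun z =>
    mem_permsOn.1 hπ _ (by simp [rightLetters])
  have hl : ∀ y, ∃ y', π (θ (.inl y)) = θ (.inl y') := by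
    intro y
    obtain ⟨a, ha⟩ := θ.surjective (π (θ (.inl y)))
    rcases a with y' | z
    · exact ⟨y', ha.symm⟩
    · rw [← hr z] at ha
      exact absurd (θ.injective (π.injective ha)) (by simp)
  choose f hf using hl
  have hfi : Function.Injective f := fun y y' h => by
    have h1 := (hf y).trans ((congrArg (fun y => θ (.inl y)) h).trans (hf y').symm)
    exact Sum.inl_injective (θ.injective (π.injective h1))
  have hfs : Function.Surjective f := by
    intro y
    obtain ⟨x, hx⟩ := π.surjective (θ (.inl y))
    obtain ⟨a, rfl⟩ := θ.surjective x
    rcases a with y' | z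
    · exact ⟨y', Sum.inl_injective (θ.injective ((hf y').symm.trans hx))⟩
    · rw [hr] at hx
      exact absurd (θ.injective hx) (by simp)
  refine ⟨Equiv.ofBijective f ⟨hfi, hfs⟩, ?_⟩
  ext x : 1
  obtain ⟨a, rfl⟩ := θ.surjective x
  rcases a with y | z
  · rw [leftPerm_inl, hf]
    rfl
  · rw [leftPerm_inr, hr]

end LeftPerm

/-! ### Adding a top row and the invariants of the Specht module -/

section TopRow

variable {μ : YoungDiagram} {k : ℕ} (h : μ.rowLen 0 ≤ k)

theorem mem_addTopRow {c : ℕ × ℕ} : c ∈ addTopRow μ k h ↔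
    (c.1 = 0 ∧ c.2 < k) ∨ ∃ d ∈ μ, (d.1 + 1, d.2) = c := by
  rw [← YoungDiagram.mem_cells, addTopRow, Finset.mem_union, Finset.mem_image, Finset.mem_image]
  refine or_congr ⟨?_, fun hc => ⟨c.2, Finset.mem_range.2 hc.2, Prod.ext hc.1.symm rfl⟩⟩ Iff.rfl
  rintro ⟨j, hj, rfl⟩
  exact ⟨rfl, Finset.mem_range.1 hj⟩

/-- The cells of a diagram with a row added on top. -/
noncomputable def topRowEquiv : μ.cells ⊕ Fin k ≃ (addTopRow μ k h).cells :=
  Equiv.ofBijective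
    (Sum.elim (fun c => ⟨(c.1.1 + 1, c.1.2), (mem_addTopRow h).2 (Or.inr ⟨c.1, c.2, rfl⟩)⟩)
      fun j => ⟨(0, j), (mem_addTopRow h).2 (Or.inl ⟨rfl, j.2⟩)⟩) (by
    constructor
    · rintro (c | j) (c' | j') heq
      · have h1 := Prod.ext_iff.1 (congrArg Subtype.val heq)
        exact congrArg Sum.inl (Subtype.ext (Prod.ext (Nat.succ_injective h1.1) h1.2))
      · exact absurd (Prod.ext_iff.1 (congrArg Subtype.val heq)).1 (Nat.succ_ne_zero _)
      · exact absurd (Prod.ext_iff.1 (congrArg Subtype.val heq)).1 (Nat.succ_ne_zero _).symm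
      · exact congrArg Sum.inr (Fin.ext (Prod.ext_iff.1 (congrArg Subtype.val heq)).2)
    · rintro ⟨c, hc⟩
      rcases (mem_addTopRow h).1 hc with ⟨h0, hk⟩ | ⟨d, hd, rfl⟩
      · exact ⟨.inr ⟨c.2, hk⟩, Subtype.ext (Prod.ext h0.symm rfl)⟩
      · exact ⟨.inl ⟨d, hd⟩, rfl⟩)

theorem topRowEquiv_inl (c : μ.cells) : (topRowEquiv h (.inl c)).1 = (c.1.1 + 1, c.1.2) := rfl

theorem topRowEquiv_inr (j : Fin k) : (topRowEquiv h (.inr j)).1 = (0, (j : ℕ)) := rfl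

theorem card_addTopRow : (addTopRow μ k h).card = μ.card + k := by
  have h1 := Fintype.card_congr (topRowEquiv h)
  rw [Fintype.card_sum, Fintype.card_fin, Fintype.card_coe, Fintype.card_coe] at h1
  exact h1.symm

theorem rowLen_addTopRow : (addTopRow μ k h).rowLen 0 = k := by
  have h1 : ∀ j, j < (addTopRow μ k h).rowLen 0 ↔ j < k := by
    intro j
    rw [← YoungDiagram.mem_iff_lt_rowLen, mem_addTopRow]
    simp
  have h2 := h1 k
  have h3 := h1 ((addTopRow μ k h).rowLen 0)
  omega

theorem exists_addTopRow_eq {ν : YoungDiagram} (hν : ν.rowLen 0 = k) :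
    ∃ (μ : YoungDiagram) (h : μ.rowLen 0 ≤ k), addTopRow μ k h = ν := by
  have hmem : ∀ i j, (i, j) ∈ (ν.cells.filter fun c => 0 < c.1).image (fun c => (c.1 - 1, c.2)) ↔
      (i + 1, j) ∈ ν := by
    intro i j
    rw [Finset.mem_image]
    constructor
    · rintro ⟨⟨a, b⟩, hc, heq⟩
      obtain ⟨h1, h2⟩ := Finset.mem_filter.1 hc
      obtain ⟨rfl, rfl⟩ := Prod.mk.inj heq
      rwa [Nat.sub_add_cancel h2]
    · exact fun hij => ⟨(i + 1, j), Finset.mem_filter.2 ⟨hij, Nat.succ_pos _⟩, rfl⟩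
  let μ : YoungDiagram :=
    { cells := (ν.cells.filter fun c => 0 < c.1).image (fun c => (c.1 - 1, c.2))
      isLowerSet := by
        rintro ⟨i, j⟩ ⟨i', j'⟩ hle hc
        obtain ⟨hi, hj⟩ := Prod.mk_le_mk.1 hle
        exact (hmem _ _).2 (ν.up_left_mem (Nat.succ_le_succ hi) hj ((hmem _ _).1 hc)) }
  have hμ : ∀ i j, (i, j) ∈ μ ↔ (i + 1, j) ∈ ν := hmem
  have hle : μ.rowLen 0 ≤ k := by
    by_contra! hlt
    have h1 := (hμ 0 k).1 (YoungDiagram.mem_iff_lt_rowLen.2 hlt)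
    have h2 := YoungDiagram.mem_iff_lt_rowLen.1 (ν.up_left_mem (Nat.zero_le _) le_rfl h1)
    omega
  refine ⟨μ, hle, ?_⟩
  ext ⟨i, j⟩
  rw [YoungDiagram.mem_cells, YoungDiagram.mem_cells, mem_addTopRow]
  rcases i with _ | i
  · rw [YoungDiagram.mem_iff_lt_rowLen, hν]
    simp
  · rw [← hμ]
    simp

variable {F : Type*} [Field F] {m m' : ℕ} {V : Type*} [AddCommGroup V] [Module F V]
  {ρ : Representation F (Equiv.Perm (Fin m)) V}

/-- The tableau with the letters of the second part in the new top row. -/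
noncomputable def topRowTableau (θ : Fin m' ⊕ Fin k ≃ Fin m) (t : Tableau m' μ) :
    Tableau m (addTopRow μ k h) :=
  ((topRowEquiv h).symm.trans (t.sumCongr (Equiv.refl _))).trans θ

/-- Extend a permutation of the cells by the identity on the new top row. -/
noncomputable def topRowPerm (p : Equiv.Perm μ.cells) : Equiv.Perm (addTopRow μ k h).cells :=
  (topRowEquiv h).permCongr (Equiv.sumCongr p 1)

theorem topRowPerm_inl (p : Equiv.Perm μ.cells) (c : μ.cells) :
    topRowPerm h p (topRowEquiv h (.inl c)) = topRowEquiv h (.inl (p c)) := by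
  simp [topRowPerm, Equiv.permCongr_apply]

theorem topRowPerm_inr (p : Equiv.Perm μ.cells) (j : Fin k) :
    topRowPerm h p (topRowEquiv h (.inr j)) = topRowEquiv h (.inr j) := by
  simp [topRowPerm, Equiv.permCongr_apply]

theorem topRowPerm_mem_rowPerms {p : Equiv.Perm μ.cells} (hp : p ∈ rowPerms μ) :
    topRowPerm h p ∈ rowPerms (addTopRow μ k h) := by
  rw [mem_rowPerms] at hp ⊢
  intro c
  obtain ⟨a, rfl⟩ := (topRowEquiv h).surjective c
  rcases a with c | j
  · rw [topRowPerm_inl, topRowEquiv_inl, topRowEquiv_inl, hp]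
  · rw [topRowPerm_inr]

theorem topRowPerm_mem_colPerms {p : Equiv.Perm μ.cells} (hp : p ∈ colPerms μ) :
    topRowPerm h p ∈ colPerms (addTopRow μ k h) := by
  rw [mem_colPerms] at hp ⊢
  intro c
  obtain ⟨a, rfl⟩ := (topRowEquiv h).surjective c
  rcases a with c | j
  · rw [topRowPerm_inl, topRowEquiv_inl, topRowEquiv_inl, hp]
  · rw [topRowPerm_inr]

theorem sign_topRowPerm (p : Equiv.Perm μ.cells) :
    Equiv.Perm.sign (topRowPerm h p) = Equiv.Perm.sign p := by
  rw [topRowPerm, Equiv.Perm.sign_permCongr, Equiv.Perm.sign_sumCongr, map_one, mul_one]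

theorem topRowTableau_permCongr (θ : Fin m' ⊕ Fin k ≃ Fin m) (t : Tableau m' μ)
    (p : Equiv.Perm μ.cells) :
    (topRowTableau h θ t).permCongr (topRowPerm h p) = leftPerm θ (t.permCongr p) := by
  ext x : 1
  obtain ⟨a, rfl⟩ := θ.surjective x
  rcases a with y | j
  · obtain ⟨c, rfl⟩ := t.surjective y
    rw [leftPerm_inl]
    simp [topRowTableau, topRowPerm, Equiv.permCongr_apply]
  · rw [leftPerm_inr]
    simp [topRowTableau, topRowPerm, Equiv.permCongr_apply]

theorem topRowTableau_symm_row (θ : Fin m' ⊕ Fin k ≃ Fin m) (t : Tableau m' μ) :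
    ∀ x ∈ rightLetters θ, ((topRowTableau h θ t).symm x).1.1 = 0 := by
  intro x hx
  obtain ⟨z, -, rfl⟩ := Finset.mem_map.1 hx
  simp [topRowTableau, topRowEquiv_inr]

theorem colOp_topRowTableau_mul (θ : Fin m' ⊕ Fin k ≃ Fin m) (t : Tableau m' μ) :
    colOp ρ (topRowTableau h θ t) * colOp (ρ.comp (leftPerm θ)) t =
      (colPerms μ).card • colOp ρ (topRowTableau h θ t) := by
  rw [colOp.eq_def (ρ.comp (leftPerm θ)), Finset.mul_sum, ← Finset.sum_const]
  refine Finset.sum_congr rfl fun q hq => ?_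
  rw [mul_smul_comm, MonoidHom.comp_apply, ← topRowTableau_permCongr h,
    colOp_mul (topRowPerm_mem_colPerms h hq), sign_topRowPerm, smul_smul, sign_mul_self_cast,
    one_smul]

theorem rowOp_mul_topRowTableau (θ : Fin m' ⊕ Fin k ≃ Fin m) (t : Tableau m' μ) :
    rowOp (ρ.comp (leftPerm θ)) t * rowOp ρ (topRowTableau h θ t) =
      (rowPerms μ).card • rowOp ρ (topRowTableau h θ t) := by
  rw [rowOp.eq_def (ρ.comp (leftPerm θ)), Finset.sum_mul, ← Finset.sum_const]
  refine Finset.sum_congr rfl fun q hq => ?_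
  rw [MonoidHom.comp_apply, ← topRowTableau_permCongr h, mul_rowOp (topRowPerm_mem_rowPerms h hq)]

variable [CharZero F]

/-- The distinguished letters fill the top row, so the row operator already gives an invariant
vector. The row and column operators of the smaller tableau are absorbed by those of the larger one
up to nonzero factors; if the result vanished, so would the larger Young symmetrizer on v. -/
theorem youngSym_symmetrizer_rowOp_ne_zero (θ : Fin m' ⊕ Fin k ≃ Fin m) (t : Tableau m' μ) {v : V}
    (hv : youngSym ρ (topRowTableau h θ t) v ≠ 0) :
    youngSym (ρ.comp (leftPerm θ)) t
      (symmetrizer ρ (rightLetters θ) (rowOp ρ (topRowTableau h θ t) v)) ≠ 0 := by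
  have h1 : symmetrizer ρ (rightLetters θ) (rowOp ρ (topRowTableau h θ t) v) =
      (permsOn (rightLetters θ)).card • rowOp ρ (topRowTableau h θ t) v := by
    refine symmetrizer_apply_of_fixed fun σ hσ => ?_
    have h2 := mul_rowOp (ρ := ρ) (t := topRowTableau h θ t)
      (symm_permCongr_mem_rowPerms (topRowTableau_symm_row h θ t) hσ)
    rw [show (topRowTableau h θ t).permCongr ((topRowTableau h θ t).symm.permCongr σ) = σ by
      ext x; simp [Equiv.permCongr_apply]] at h2
    exact LinearMap.congr_fun h2 v
  intro h0
  refine hv ?_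
  have h3 := congrArg (colOp ρ (topRowTableau h θ t)) h0
  rw [map_zero, h1, map_nsmul, map_nsmul, smul_card_permsOn_eq_zero F, youngSym,
    Module.End.mul_apply, ← Module.End.mul_apply (rowOp _ t), rowOp_mul_topRowTableau,
    ← Module.End.mul_apply (colOp ρ _), colOp_topRowTableau_mul, LinearMap.smul_apply,
    LinearMap.smul_apply, map_nsmul, ← Nat.cast_smul_eq_nsmul F, ← Nat.cast_smul_eq_nsmul F,
    smul_eq_zero, smul_eq_zero] at h3
  refine (h3.resolve_left ?_).resolve_left ?_
  · exact Nat.cast_ne_zero.2 (Finset.card_ne_zero_of_mem (a := 1) (mem_colPerms.2 fun _ => rfl))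
  · exact Nat.cast_ne_zero.2 (Finset.card_ne_zero_of_mem (a := 1) (mem_rowPerms.2 fun _ => rfl))

omit [CharZero F] in
-- Permutations of the distinguished letters commute with those of the others, so the vectors with
-- invariant image form a submodule; it contains the generating polytabloid.
theorem rep_apply_eq_of_specht_hom {θ : Fin m' ⊕ Fin k ≃ Fin m} {t : Tableau m' μ}
    {f : spechtSpace F m' μ →ₗ[F] V} (hf : ∀ τ u, f (specht F m' μ τ u) = ρ (leftPerm θ τ) (f u))
    {w : V} (hft : f (spechtVec F t) =
      youngSym (ρ.comp (leftPerm θ)) t (symmetrizer ρ (rightLetters θ) w))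
    {σ : Equiv.Perm (Fin m)} (hσ : σ ∈ permsOn (rightLetters θ)) (u : spechtSpace F m' μ) :
    ρ σ (f u) = f u := by
  have hc : ∀ τ v, ρ σ (ρ (leftPerm θ τ) v) = ρ (leftPerm θ τ) (ρ σ v) := fun τ v => by
    rw [← Module.End.mul_apply, ← Module.End.mul_apply, ← map_mul, ← map_mul,
      commute_of_mem_permsOn hσ (leftPerm_mem_permsOn θ τ)]
  have h1 : LinearMap.eqLocus (ρ σ ∘ₗ f) f = ⊤ := by
    refine eq_top_of_spechtVec_mem (t := t) (fun τ v hv => ?_) ?_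
    · rw [LinearMap.mem_eqLocus, LinearMap.comp_apply] at hv ⊢
      rw [hf, hc, hv]
    · rw [LinearMap.mem_eqLocus, LinearMap.comp_apply, hft,
        map_youngSym (ρ := ρ.comp (leftPerm θ)) (ρ' := ρ.comp (leftPerm θ)) (φ := ρ σ) hc,
        rep_apply_symmetrizer ρ hσ]
  exact h1.ge (Submodule.mem_top (x := u))

/-- A submodule of a Specht module stable under the permutations of the complement of `K` contains
all `K`-invariants as soon as it contains a nonzero `K`-invariant vector. -/
theorem range_symmetrizer_specht_le {ν : YoungDiagram} {K : Finset (Fin m)}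
    (hK : ν.rowLen 0 ≤ K.card) {U : Submodule F (spechtSpace F m ν)}
    (hU : ∀ π ∈ permsOn Kᶜ, ∀ u ∈ U, specht F m ν π u ∈ U) {v : spechtSpace F m ν} (hv : v ∈ U)
    (hv0 : v ≠ 0) (hfix : ∀ σ ∈ permsOn K, specht F m ν σ v = v) (x : spechtSpace F m ν) :
    symmetrizer (V := spechtSpace F m ν) (specht F m ν) K x ∈ U := by
  -- Vectors all of whose translates have K-symmetrization in U form a submodule. It contains v by
  -- `symmetrizer_rep_mem`, so it is everything by simplicity.
  have h1 : ⨅ σ, U.comap (symmetrizer (V := spechtSpace F m ν) (specht F m ν) K ∘ₗ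
      specht F m ν σ) = ⊤ := by
    refine (specht_eq_bot_or_eq_top (U := ⨅ σ, U.comap (symmetrizer (V := spechtSpace F m ν)
      (specht F m ν) K ∘ₗ specht F m ν σ)) fun τ y hy => ?_).resolve_left fun h0 => hv0 ?_
    · rw [Submodule.mem_iInf] at hy ⊢
      intro σ
      have h2 := hy (σ * τ)
      rw [map_mul] at h2
      exact h2
    · rw [← Submodule.mem_bot F, ← h0, Submodule.mem_iInf]
      intro σ
      exact symmetrizer_rep_mem (V := spechtSpace F m ν) (ρ := specht F m ν)
        (fun T hT => symmetrizer_specht_eq_zero (by omega)) hU hv hfix σ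
  have h2 := (Submodule.mem_iInf _).1 (h1.ge (Submodule.mem_top (x := x))) 1
  rw [map_one] at h2
  exact h2

/-- The vectors of the Specht module of a diagram with top row of length `k` which are invariant
under the permutations of `k` letters form the Specht module of the diagram without this row. -/
theorem exists_specht_hom_range_eq (θ : Fin m' ⊕ Fin k ≃ Fin m) (hμ : μ.card = m') :
    ∃ f : spechtSpace F m' μ →ₗ[F] spechtSpace F m (addTopRow μ k h),
      (∀ τ u, f (specht F m' μ τ u) = specht F m (addTopRow μ k h) (leftPerm θ τ) (f u)) ∧
      Function.Injective f ∧ LinearMap.range f = LinearMap.range (symmetrizer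
        (V := spechtSpace F m (addTopRow μ k h)) (specht F m (addTopRow μ k h))
          (rightLetters θ)) := by
  obtain ⟨t⟩ := exists_tableau hμ
  set S := spechtSpace F m (addTopRow μ k h) with hS
  set ρ : Representation F (Equiv.Perm (Fin m)) S := specht F m (addTopRow μ k h) with hρ
  set K := rightLetters θ with hK
  have h1 := youngSym_symmetrizer_rowOp_ne_zero (V := S) (ρ := ρ) h θ t
    (youngSym_ne_zero_of_injective (V := S) (φ := LinearMap.id) (fun _ _ => rfl)
      Function.injective_id (topRowTableau h θ t))
  set w : S := rowOp (V := S) ρ (topRowTableau h θ t) (spechtVec F (topRowTableau h θ t)) with hw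
  obtain ⟨f, hf, hft⟩ := exists_specht_hom (V := S) (ρ := ρ.comp (leftPerm θ)) t
    (symmetrizer (V := S) ρ K w)
  have hf0 : f ≠ 0 := by
    rintro rfl
    exact h1 hft.symm
  have hfix : ∀ u, ∀ σ ∈ permsOn K, ρ σ (f u) = f u := fun u σ hσ =>
    rep_apply_eq_of_specht_hom (V := S) (ρ := ρ) hf hft hσ u
  refine ⟨f, hf, injective_of_specht_hom (V := S) (ρ := ρ.comp (leftPerm θ)) hf hf0,
    le_antisymm ?_ ?_⟩
  · rintro _ ⟨u, rfl⟩
    refine ⟨((permsOn K).card : F)⁻¹ • f u, ?_⟩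
    rw [map_smul, symmetrizer_apply_of_fixed (V := S) (hfix u), ← Nat.cast_smul_eq_nsmul F, smul_smul,
      inv_mul_cancel₀, one_smul]
    exact Nat.cast_ne_zero.2
      (Finset.card_ne_zero_of_mem (a := 1) (mem_permsOn.2 fun _ _ => rfl))
  · rintro _ ⟨x, rfl⟩
    refine range_symmetrizer_specht_le (U := LinearMap.range f) (v := f (spechtVec F t)) ?_ ?_
      (LinearMap.mem_range_self f _) ?_ (hfix _) x
    · rw [rowLen_addTopRow, hK, card_rightLetters, Fintype.card_fin]
    · rintro π hπ _ ⟨u, rfl⟩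
      obtain ⟨τ, rfl⟩ := exists_leftPerm_eq θ hπ
      exact ⟨_, hf τ u⟩
    · rw [hft]
      exact h1

end TopRow

/-! ### Comparing decompositions with the same shapes -/

section Reindexing

variable {F : Type*} [Field F] {m : ℕ} {V : Type*} [AddCommGroup V] [Module F V]
  {ρ : Representation F (Equiv.Perm (Fin m)) V}

theorem IsDecomposition.nonempty_equiv_of_shape {ι κ : Type*} [Fintype ι] {s : ι → YoungDiagram}
    {φ : ∀ i, spechtSpace F m (s i) →ₗ[F] V}
    (h : IsDecomposition (S := fun i => spechtSpace F m (s i)) (fun i => specht F m (s i)) ρ φ)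
    {b : κ → YoungDiagram} (e : ι ≃ κ) (hb : ∀ i, b (e i) = s i) :
    Nonempty (ρ.Equiv (Representation.directSum fun j => specht F m (b j))) := by
  obtain rfl : b = fun j => s (e.symm j) := funext fun j => by rw [← hb, e.apply_symm_apply]
  have : Fintype κ := Fintype.ofEquiv ι e
  exact (h.reindex e.symm).nonempty_equiv (S := fun j => spechtSpace F m (s (e.symm j)))

end Reindexing

/-! ### The erasing map between multilinear components -/

section MultilinearRep

variable {F : Type*} [Field F] [CharZero F] {n k : ℕ} {X Y : Type} [Fintype X] [Fintype Y]
  [DecidableEq X]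

instance : FiniteDimensional F (multilinearPart F (n + 1) k X) :=
  have := FiniteDimensional.span_of_finite F (Set.finite_range fun σ : Pos k n ≃ X =>
    combOf (freeBracket F (n + 1) X) fun p => wordClass F (.letter (σ p)))
  Submodule.finiteDimensional_of_le multilinearPart_le_span_combOf

theorem symmetrizer_multilinearRep_eq_zero (hk : 1 ≤ k) {T : Finset X} (hT : k < T.card)
    (v : multilinearPart F n k X) : symmetrizer (multilinearRep F n k X) T v = 0 := by
  refine Subtype.ext ?_
  refine (map_symmetrizer (ρ := multilinearRep F n k X) (ρ' := freeFilippovRep F n X)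
    (φ := (multilinearPart F n k X).subtype) (fun _ _ => rfl) T v).trans ?_
  exact symmetrizer_eq_zero hk T hT v.2

variable (F n) in
/-- The reduction map between the multilinear components. -/
noncomputable def reducePart (θ : Y ⊕ Fin k ≃ X) :
    multilinearPart F (n + 2) k X →ₗ[F] multilinearPart F (n + 1) k Y :=
  (reduce F n (leftPart θ)).restrict fun _ hv => reduce_mem θ k hv

omit [DecidableEq X] in
theorem reducePart_surjective (θ : Y ⊕ Fin k ≃ X) : Function.Surjective (reducePart F n θ) := by
  rintro ⟨v, hv⟩
  obtain ⟨r, hr, hrv⟩ := exists_reduce_eq (F := F) (n := n) θ (v := v)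
    (by rwa [Fintype.card_fin])
  rw [Fintype.card_fin] at hr
  exact ⟨⟨r, hr⟩, Subtype.ext hrv⟩

omit [DecidableEq X] in
theorem reducePart_rep (θ : Y ⊕ Fin k ≃ X) (τ : Equiv.Perm Y) (v : multilinearPart F (n + 2) k X) :
    reducePart F n θ (multilinearRep F (n + 2) k X (leftPerm θ τ) v) =
      multilinearRep F (n + 1) k Y τ (reducePart F n θ v) := by
  refine Subtype.ext (reduce_freeFilippovRep (fun x => ?_) v.1)
  obtain ⟨a, rfl⟩ := θ.surjective x
  rcases a with y | z <;> simp

theorem reducePart_symmetrizer (θ : Y ⊕ Fin k ≃ X) (v : multilinearPart F (n + 2) k X) :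
    reducePart F n θ (symmetrizer (multilinearRep F (n + 2) k X) (rightLetters θ) v) =
      (permsOn (rightLetters θ)).card • reducePart F n θ v := by
  rw [symmetrizer_apply, map_sum, ← Finset.sum_const]
  refine Finset.sum_congr rfl fun σ hσ => Subtype.ext (reduce_eq_of_leftPart (fun x => ?_) v.1)
  by_cases hx : x ∈ rightLetters θ
  · have h1 : σ x ∈ rightLetters θ := by
      rw [← image_eq_of_mem_permsOn hσ]
      exact Finset.mem_image_of_mem _ hx
    rw [mem_rightLetters.1 hx, mem_rightLetters.1 h1]
  · rw [mem_permsOn.1 hσ x hx]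

theorem symmetrizer_eq_zero_of_reducePart_eq_zero (hk : 1 ≤ k) (θ : Y ⊕ Fin k ≃ X)
    {v : multilinearPart F (n + 2) k X} (hv : reducePart F n θ v = 0) :
    symmetrizer (multilinearRep F (n + 2) k X) (rightLetters θ) v = 0 := by
  refine Subtype.ext ?_
  refine (map_symmetrizer (ρ := multilinearRep F (n + 2) k X) (ρ' := freeFilippovRep F (n + 2) X)
    (φ := (multilinearPart F (n + 2) k X).subtype) (fun _ _ => rfl) _ v).trans ?_
  have h1 := insertLetters_reduce (F := F) (n := n) θ (by rwa [Fintype.card_fin]) (v := v.1)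
    (by rw [Fintype.card_fin]; exact v.2)
  rw [show reduce F n (leftPart θ) v.1 = 0 from congrArg Subtype.val hv, map_zero] at h1
  exact h1.symm

end MultilinearRep

/-! ### The stabilization isomorphism in arity at least two -/

section Stabilization

variable {F : Type*} [Field F] [CharZero F] {n k m m' : ℕ} {ι : Type} [Fintype ι]

/-- The upper bound comes from the vanishing of symmetrizers of k + 1 letters, the lower one from
generation by symmetrizations over K. -/
theorem rowLen_eq_of_isDecomposition (hk : 1 ≤ k) (hkn : k ≤ n + 2) (hm : m = k * (n + 1) + 1)
    {s : ι → YoungDiagram} {φ : ∀ i, spechtSpace F m (s i) →ₗ[F] multilinearPart F (n + 2) k (Fin m)}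
    (h : IsDecomposition (S := fun i => spechtSpace F m (s i)) (fun i => specht F m (s i))
      (multilinearRep F (n + 2) k (Fin m)) φ) (hs : ∀ i, (s i).card = m)
    {K : Finset (Fin m)} (hK : K.card = k) (i : ι) : (s i).rowLen 0 = k := by
  refine le_antisymm (rowLen_le_of_symmetrizer_eq_zero (F := F) (hs i) fun T hT v => ?_) ?_
  · refine h.injective i ?_
    rw [map_zero]
    refine (map_symmetrizer (V := spechtSpace F m (s i)) (φ := φ i) (h.map_rep i) T v).trans ?_
    exact symmetrizer_multilinearRep_eq_zero hk (by omega) _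
  · by_contra! hlt
    obtain ⟨p, hp, -, hpφ⟩ := h.exists_proj
    -- If the first row is shorter than k, the symmetrizer of K kills the summand, so all
    -- K-symmetrizations lie in the kernel of the projection onto it; generation would make the
    -- summand zero.
    have h1 := eq_top_of_symmetrizer_mem hk hkn (by rw [Fintype.card_fin, hm]) hK
      (LinearMap.ker (p i)) (fun π v hv => ?_) fun v => ?_
    · obtain ⟨t⟩ := exists_tableau (hs i)
      refine spechtVec_ne_zero (F := F) t ?_
      rw [← hpφ i (spechtVec F t), LinearMap.ker_eq_top.1 h1]
      rfl
    · rw [Submodule.mem_comap, LinearMap.mem_ker, hp, LinearMap.mem_ker.1 hv, map_zero]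
    · rw [LinearMap.mem_ker]
      refine (map_symmetrizer (W := spechtSpace F m (s i)) (ρ' := specht F m (s i)) (φ := p i)
        (hp i) K v).trans ?_
      exact symmetrizer_specht_eq_zero (by omega) _

/-- Removing the top rows from the summands of the multilinear component of the free Filippov
`(n+2)`-algebra gives the summands for the free Filippov `(n+1)`-algebra. -/
theorem exists_isDecomposition_of_addTopRow (hk : 1 ≤ k) (θ : Fin m' ⊕ Fin k ≃ Fin m)
    {μ : ι → YoungDiagram} (hle : ∀ i, (μ i).rowLen 0 ≤ k) (hμ : ∀ i, (μ i).card = m')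
    {φ : ∀ i, spechtSpace F m (addTopRow (μ i) k (hle i)) →ₗ[F]
      multilinearPart F (n + 2) k (Fin m)}
    (h : IsDecomposition (S := fun i => spechtSpace F m (addTopRow (μ i) k (hle i)))
      (fun i => specht F m (addTopRow (μ i) k (hle i))) (multilinearRep F (n + 2) k (Fin m)) φ) :
    ∃ ψ : ∀ i, spechtSpace F m' (μ i) →ₗ[F] multilinearPart F (n + 1) k (Fin m'),
      IsDecomposition (S := fun i => spechtSpace F m' (μ i)) (fun i => specht F m' (μ i))
        (multilinearRep F (n + 1) k (Fin m')) ψ := by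
  choose f hf hfi hfr using fun i => exists_specht_hom_range_eq (F := F) (hle i) θ (hμ i)
  refine ⟨fun i => reducePart F n θ ∘ₗ φ i ∘ₗ f i, fun i τ u => ?_, fun y hy => ?_, fun v => ?_⟩
  · simp only [LinearMap.comp_apply]
    rw [← reducePart_rep, hf i]
    exact congrArg _ (h.map_rep i _ _)
  -- Independence: a vector erased to zero has zero symmetrization, but on the invariants f i (y i)
  -- symmetrizing is multiplication by a nonzero number.
  · simp only [LinearMap.comp_apply, ← map_sum] at hy
    have h1 := symmetrizer_eq_zero_of_reducePart_eq_zero hk θ hy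
    have h2 : ∀ i, symmetrizer (multilinearRep F (n + 2) k (Fin m)) (rightLetters θ)
        (φ i (f i (y i))) = (permsOn (rightLetters θ)).card • φ i (f i (y i)) := by
      intro i
      obtain ⟨z, hz⟩ := (hfr i).le (LinearMap.mem_range_self (f i) (y i))
      refine symmetrizer_apply_of_fixed fun σ hσ => ?_
      rw [← hz]
      refine (h.map_rep i σ _).symm.trans (congrArg (φ i) ?_)
      exact rep_apply_symmetrizer (V := spechtSpace F m (addTopRow (μ i) k (hle i))) _ hσ z
    rw [map_sum, Finset.sum_congr rfl fun i _ => h2 i, ← Finset.smul_sum,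
      smul_card_permsOn_eq_zero F] at h1
    have h3 := h.eq_zero _ h1
    ext1 i
    exact hfi i ((congrFun h3 i).trans (map_zero (f i)).symm)
  -- Spanning: erasing does not distinguish a vector from its symmetrization divided by the number
  -- of permutations, so the preimage may be taken among the invariants.
  · obtain ⟨r, rfl⟩ := reducePart_surjective θ v
    obtain ⟨x, rfl⟩ := h.exists_eq r
    have h1 : ∀ i, ∃ u, f i u = symmetrizer (V := spechtSpace F m (addTopRow (μ i) k (hle i)))
        (specht F m (addTopRow (μ i) k (hle i))) (rightLetters θ) (x i) := fun i =>
      (hfr i).ge (LinearMap.mem_range_self _ (x i))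
    choose u hu using h1
    refine ⟨fun i => ((permsOn (rightLetters θ)).card : F)⁻¹ • u i, ?_⟩
    simp only [LinearMap.comp_apply, map_smul, hu, map_sum]
    refine Finset.sum_congr rfl fun i _ => ?_
    rw [map_symmetrizer (V := spechtSpace F m (addTopRow (μ i) k (hle i))) (φ := φ i)
      (h.map_rep i), reducePart_symmetrizer, ← Nat.cast_smul_eq_nsmul F, smul_smul,
      inv_mul_cancel₀, one_smul]
    exact Nat.cast_ne_zero.2
      (Finset.card_ne_zero_of_mem (a := 1) (mem_permsOn.2 fun _ _ => rfl))

theorem rowLen_le_of_containsSpecht (hk : 1 ≤ k) {μ : YoungDiagram} (hμ : μ.card = m)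
    (hc : ContainsSpecht (multilinearRep F n k (Fin m)) μ) : μ.rowLen 0 ≤ k := by
  obtain ⟨f, hf⟩ := hc
  refine rowLen_le_of_symmetrizer_eq_zero (F := F) hμ fun T hT v => hf ?_
  rw [map_zero]
  refine (map_symmetrizer (V := spechtSpace F m μ) (ρ := specht F m μ)
    (ρ' := multilinearRep F n k (Fin m)) (φ := f.toLinearMap)
    (fun σ u => LinearMap.congr_fun (f.isIntertwining' σ) u) T v).trans ?_
  exact symmetrizer_multilinearRep_eq_zero hk (by omega) _

theorem nonempty_equiv_beta (hk : 1 ≤ k) (hkn : k ≤ n + 2) :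
    Nonempty ((rho F (n + 2) k).Equiv (beta F (n + 2) k)) := by
  classical
  obtain ⟨ι, hι, s, φ, hs, h⟩ :=
    exists_isDecomposition (multilinearRep F (n + 2) k (Fin (k * (n + 1) + 1)))
  let θ : Fin (k * n + 1) ⊕ Fin k ≃ Fin (k * (n + 1) + 1) :=
    finSumFinEquiv.trans (finCongr (by ring))
  have hrow : ∀ i, (s i).rowLen 0 = k := rowLen_eq_of_isDecomposition hk hkn rfl h hs
    (K := rightLetters θ) (by rw [card_rightLetters, Fintype.card_fin])
  choose μ hle hμ using fun i => exists_addTopRow_eq (hrow i)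
  obtain rfl : (fun i => addTopRow (μ i) k (hle i)) = s := funext hμ
  have hcard : ∀ i, (μ i).card = k * n + 1 := fun i => by
    have h1 := hs i
    rw [card_addTopRow] at h1
    rw [mul_add] at h1
    omega
  obtain ⟨ψ, hψ⟩ := exists_isDecomposition_of_addTopRow hk θ hle hcard h
  let s' : ι → {ν : YoungDiagram // ν.card = k * n + 1 ∧ ν.rowLen 0 ≤ k} :=
    fun i => ⟨μ i, hcard i, hle i⟩
  -- Grouping the summands by shape: each fiber has the size of the multiplicity in the lower-arity
  -- representation, by the decomposition `hψ` indexed by the same set.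
  let e : ι ≃ BetaIndex F (n + 2) k := (Equiv.sigmaFiberEquiv s').symm.trans
    (Equiv.sigmaCongrRight fun ν => Fintype.equivFinOfCardEq (by
      refine Eq.trans ?_ (multiplicity_eq hψ ν.2.1).symm
      exact Fintype.card_congr (Equiv.subtypeEquivRight fun i => Subtype.ext_iff)))
  exact h.nonempty_equiv_of_shape (b := betaShape F (n + 2) k) e fun i => rfl

end Stabilization

/-! ### The unary case -/

section Unary

variable {F : Type*} [Field F]

theorem eq_singleCell {μ : YoungDiagram} (hμ : μ.card = 1) : μ = singleCell := by
  obtain ⟨c, hc⟩ := Finset.card_eq_one.1 hμ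
  have h0 : (0, 0) ∈ μ.cells := (YoungDiagram.mem_cells _).2 (μ.up_left_mem (i2 := c.1) (j2 := c.2)
    (Nat.zero_le _) (Nat.zero_le _) ((YoungDiagram.mem_cells c).1 (by rw [hc]; simp)))
  have h1 : μ.cells = {(0, 0)} := by
    rw [hc, Finset.mem_singleton] at h0
    rw [hc, h0]
  ext ⟨i, j⟩
  rw [YoungDiagram.mem_cells (μ := singleCell), singleCell, mem_addTopRow, h1]
  simp

/-- For arity one each relator has coefficient sum zero, so the functional sending every word to 1
descends to the free algebra. -/
theorem wordClass_unary_ne_zero {X : Type} (w : Word 1 X) : wordClass F w ≠ 0 := by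
  let f : (Word 1 X →₀ F) →ₗ[F] F := Finsupp.linearCombination F fun _ => (1 : F)
  have hf : relations F 1 X ≤ LinearMap.ker f := by
    refine Submodule.span_le.2 fun r hr => ?_
    rw [SetLike.mem_coe, LinearMap.mem_ker]
    induction hr with
    | antisymmetry w σ => simp [f, Subsingleton.elim σ 1]
    | jacobi x y => simp [f]
    | congr w i r hr ih =>
      rw [← ih]
      simp [f, Finsupp.linearCombination_mapDomain, Function.comp_def]
  intro h
  have h1 := hf ((Submodule.Quotient.mk_eq_zero _).1 h)
  rw [LinearMap.mem_ker] at h1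
  simp [f] at h1

theorem multilinearPart_unary : multilinearPart F 1 1 (Fin 1) =
    Submodule.span F {wordClass F (.bracket fun _ => .letter 0)} := by
  rw [multilinearPart, ← Set.image_singleton]
  congr 2
  ext w
  constructor
  · rintro ⟨hw, hk⟩
    rcases w with x | w
    · simp [Word.numBrackets] at hk
    · simp only [Word.numBrackets, Finset.univ_unique, Finset.sum_singleton] at hk
      rcases hw0 : w default with x | v
      · rw [Set.mem_singleton_iff]
        congr 1
        ext1 i
        rw [Subsingleton.elim i default, hw0, Subsingleton.elim x 0]
      · rw [hw0] at hk
        simp [Word.numBrackets] at hk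
  · rintro rfl
    refine ⟨?_, ?_⟩
    · simp [Word.IsBracketedPerm, Word.letters]
    · simp [Word.numBrackets]

theorem finrank_multilinearPart_unary :
    Module.finrank F (multilinearPart F 1 1 (Fin 1)) = 1 := by
  rw [multilinearPart_unary]
  exact finrank_span_singleton (wordClass_unary_ne_zero _)

variable [CharZero F]

variable (F) in
theorem nonempty_equiv_beta_unary : Nonempty ((rho F 1 1).Equiv (beta F 1 1)) := by
  have hr : Module.finrank F (multilinearPart F 1 1 (Fin 1)) = 1 := finrank_multilinearPart_unary
  have hfd : FiniteDimensional F (multilinearPart F 1 1 (Fin 1)) :=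
    Module.finite_of_finrank_eq_succ hr
  have hnt : Nontrivial (multilinearPart F 1 1 (Fin 1)) :=
    Module.nontrivial_of_finrank_pos (R := F) (by rw [hr]; exact Nat.one_pos)
  obtain ⟨μ, hμ, φ, hφ, hi⟩ := exists_specht_hom_injective (multilinearRep F 1 1 (Fin 1))
  obtain rfl := eq_singleCell hμ
  obtain ⟨t⟩ := exists_tableau hμ
  have hs : Function.Surjective φ := by
    rw [← LinearMap.range_eq_top]
    refine Submodule.eq_top_of_finrank_eq (le_antisymm (Submodule.finrank_le _) ?_)
    rw [hr, Nat.one_le_iff_ne_zero, Ne, Submodule.finrank_eq_zero, LinearMap.range_eq_bot]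
    intro h
    exact spechtVec_ne_zero t (hi (by rw [h]; rfl))
  have h : IsDecomposition (S := fun _ : Unit => spechtSpace F 1 singleCell)
      (fun _ => specht F 1 singleCell) (multilinearRep F 1 1 (Fin 1)) fun _ => φ := by
    refine ⟨fun _ => hφ, fun x hx => ?_, fun v => ?_⟩
    · ext1 i
      rw [Finset.univ_unique, Finset.sum_singleton] at hx
      exact hi (hx.trans (map_zero φ).symm)
    · obtain ⟨u, rfl⟩ := hs v
      exact ⟨fun _ => u, by simp⟩
  exact h.nonempty_equiv_of_shape (b := betaShape F 1 1) (Equiv.refl Unit) fun _ => rfl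

end Unary

end Filippov

theorem theorem1p4 (F : Type*) [Field F] [CharZero F] (n k : ℕ) (hk : 1 ≤ k) (hkn : k ≤ n) :
    (2 ≤ n → ∀ μ : YoungDiagram, μ.card = k * (n - 2) + 1 →
      Filippov.ContainsSpecht (Filippov.rho F (n - 1) k) μ →
        μ.rowLen 0 ≤ k) ∧
    Nonempty ((Filippov.rho F n k).Equiv (Filippov.beta F n k)) := by
  rcases n with _ | _ | n
  · omega
  · obtain rfl : k = 1 := by omega
    exact ⟨fun h => absurd h (by norm_num), Filippov.nonempty_equiv_beta_unary F⟩
  · exact ⟨fun _ μ hμ hc => Filippov.rowLen_le_of_containsSpecht hk hμ hc,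
      Filippov.nonempty_equiv_beta hk hkn⟩
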